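/- For $\varepsilon>0$ let $\check{\mathcal B}_\varepsilon$ be the unbounded operator on $L^2(\mathbb R,\mathbb C^3)$ $$\check{\mathcal B}_\varepsilon=\begin{pmatrix}-\frac{d^2}{dx^2}+ix&0&\frac{1}{\sqrt2}\varepsilon^{-1/2}\\0&-\frac{d^2}{dx^2}-ix&\frac1{\sqrt2}\varepsilon^{-1/2}\\-\frac1{\sqrt2}\varepsilon^{-1/2}&-\frac1{\sqrt2}\varepsilon^{-1/2}&-\frac{d^2}{dx^2}\end{pmatrix}$$ with domain $D(\check{\mathcal B}_\varepsilon)=\{\mathbf u=(u_1,u_2,u_3)\in H^2(\mathbb R,\mathbb C^3): xu_1,\,xu_2\in L^2(\mathbb R,\mathbb C)\}$. Write $t_+=\max(t,0)$. (1) For every $0<\delta\le 1/2$ there exist $\varepsilon_0>0$ and $C>0$ such that for all $0<\varepsilon<\varepsilon_0$ and all $\lambda\in\mathbb C$ with $0<|\Im\lambda|\le(1-2\delta^4)^{1/2}\varepsilon^{-1/2}$: (a) if $\mathbf u\in D(\check{\mathcal B}_\varepsilon)$, $\mathbf f\in L^2(\mathbb R,\mathbb C^3)$ and $(\check{\mathcal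 B}_\varepsilon-\lambda)\mathbf u=\mathbf f$, then $$\|u_1+u_2\|_2\le C\varepsilon^{1/2}\Big(1+\frac{1+\varepsilon^{1/2}(\Re\lambda)_+^{1/2}}{|\Im\lambda|}\Big)\|\mathbf f\|_2;$$ (b) $\lambda$ is in the resolvent set of $\check{\mathcal B}_\varepsilon$ and $$\|(\check{\mathcal B}_\varepsilon-\lambda)^{-1}\|\le C\Big(1+\frac1{|\Im\lambda|}\Big)\Big(1+\frac{1+\varepsilon^{1/2}(\Re\lambda)_+^{1/2}}{|\Im\lambda|}\Big).$$ (2) For every $\delta>0$ there exists $\varepsilon_0>0$ such that for all $0<\varepsilon<\varepsilon_0$ the spectrum of $\check{\mathcal B}_\varepsilon$ does not meet $$S(\varepsilon,\delta)=\{\lambda\in\mathbb C\setminus[0,\infty): |\Im\lambda|<(1-\delta)\varepsilon^{-1/2}\}.$$ -/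

import Mathlib

open MeasureTheory
open scoped ENNReal SchwartzMap

namespace BlochTorrey

/-! ### Resolvent set and spectrum of an unbounded operator -/

section Unbounded

variable {E : Type*} [NormedAddCommGroup E] [NormedSpace ℂ E]

/-- `R` is the resolvent `(T - lam)⁻¹`: a bounded, everywhere defined operator with values in
`D(T)` which is a left and right inverse of `T - lam : D(T) → E`. -/
def IsResolventAt (T : E →ₗ.[ℂ] E) (lam : ℂ) (R : E →L[ℂ] E) : Prop :=
  (∀ u : T.domain, R (T u - lam • (u : E)) = (u : E)) ∧
    ∀ f : E, ∃ u : T.domain, (u : E) = R f ∧ T u - lam • (u : E) = f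

/-- The resolvent set of an unbounded operator. -/
def resolventSet (T : E →ₗ.[ℂ] E) : Set ℂ := {lam | ∃ R : E →L[ℂ] E, IsResolventAt T lam R}

/-- The spectrum of an unbounded operator. -/
def spectrum (T : E →ₗ.[ℂ] E) : Set ℂ := (resolventSet T)ᶜ

end Unbounded

noncomputable section

/-! ### Function spaces on the line -/

/-- `L²(ℝ, ℂ)`. -/
abbrev L2 : Type := Lp ℂ 2 (volume : Measure ℝ)

/-- `L²(ℝ, ℂ³)`, with `‖u‖² = ‖u₁‖² + ‖u₂‖² + ‖u₃‖²`. The components are indexed by `0, 1, 2`. -/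
abbrev L2Vec : Type := PiLp 2 (fun _ : Fin 3 => L2)

/-- An element of `L²(ℝ, ℂ)` as a tempered distribution. -/
def toDistr : L2 →ₗ[ℂ] 𝓢'(ℝ, ℂ) := (Lp.toTemperedDistributionCLM ℂ volume 2).toLinearMap

lemma toDistr_injective : Function.Injective toDistr :=
  LinearMap.ker_eq_bot.mp (Lp.ker_toTemperedDistributionCLM_eq_bot (E := ℝ) (F := ℂ))

/-- The Sobolev space `H²(ℝ, ℂ)`. -/
def H2 : Submodule ℂ L2 where
  carrier := {u | TemperedDistribution.MemSobolev 2 2 (toDistr u)}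
  add_mem' {u v} hu hv := by
    change TemperedDistribution.MemSobolev 2 2 (toDistr (u + v))
    rw [map_add]
    exact TemperedDistribution.MemSobolev.add hu hv
  zero_mem' := by
    change TemperedDistribution.MemSobolev 2 2 (toDistr 0)
    rw [map_zero]
    exact TemperedDistribution.memSobolev_fun_zero ℝ ℂ 2 2
  smul_mem' c u hu := by
    change TemperedDistribution.MemSobolev 2 2 (toDistr (c • u))
    rw [map_smul]
    exact TemperedDistribution.MemSobolev.smul c hu

lemma exists_secondDeriv (u : H2) :
    ∃ v : L2, toDistr v = Laplacian.laplacian (toDistr (u : L2)) := by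
  have h : TemperedDistribution.MemSobolev 2 2 (toDistr (u : L2)) := u.2
  have h' := h.laplacian
  rw [sub_self, TemperedDistribution.memSobolev_zero_iff] at h'
  obtain ⟨v, hv⟩ := h'
  exact ⟨v, hv.symm⟩

/-- The distributional second derivative `u ↦ u''` from `H²(ℝ, ℂ)` to `L²(ℝ, ℂ)`
(on the line the Laplacian is `d²/dx²`). -/
def secondDeriv : H2 →ₗ[ℂ] L2 where
  toFun u := (exists_secondDeriv u).choose
  map_add' u v := toDistr_injective <| by
    rw [map_add, (exists_secondDeriv (u + v)).choose_spec, (exists_secondDeriv u).choose_spec,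
      (exists_secondDeriv v).choose_spec, Submodule.coe_add, map_add]
    simp only [← TemperedDistribution.laplacianCLM_apply, map_add]
  map_smul' c u := toDistr_injective <| by
    rw [RingHom.id_apply, map_smul, (exists_secondDeriv (c • u)).choose_spec,
      (exists_secondDeriv u).choose_spec, Submodule.coe_smul, map_smul]
    simp only [← TemperedDistribution.laplacianCLM_apply, map_smul]

lemma toDistr_secondDeriv (u : H2) :
    toDistr (secondDeriv u) = Laplacian.laplacian (toDistr (u : L2)) :=
  (exists_secondDeriv u).choose_spec

/-- The `u ∈ L²(ℝ, ℂ)` with `x u ∈ L²(ℝ, ℂ)`. -/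
def xDomain : Submodule ℂ L2 where
  carrier := {u | MemLp (fun x : ℝ => (x : ℂ) * u x) 2 volume}
  add_mem' {u v} hu hv := by
    refine (memLp_congr_ae ?_).mpr (MemLp.add hu hv)
    filter_upwards [Lp.coeFn_add u v] with x hx
    simp only [hx, Pi.add_apply, mul_add]
  zero_mem' := by
    refine (memLp_congr_ae ?_).mpr (MemLp.zero (ε := ℂ))
    filter_upwards [Lp.coeFn_zero ℂ 2 (volume : Measure ℝ)] with x hx
    rw [hx, Pi.zero_apply, mul_zero]
  smul_mem' c u hu := by
    refine (memLp_congr_ae ?_).mpr (MemLp.const_smul hu c)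
    filter_upwards [Lp.coeFn_smul c u] with x hx
    simp only [hx, Pi.smul_apply, smul_eq_mul]
    ring

lemma memLp_mul_x (u : xDomain) : MemLp (fun x : ℝ => (x : ℂ) * (u : L2) x) 2 volume := u.2

/-- Multiplication by `x`, as a map into `L²(ℝ, ℂ)`. -/
def mulX : xDomain →ₗ[ℂ] L2 where
  toFun u := (memLp_mul_x u).toLp
  map_add' u v := by
    refine Lp.ext ?_
    filter_upwards [Lp.coeFn_add (u : L2) (v : L2), (memLp_mul_x (u + v)).coeFn_toLp,
      (memLp_mul_x u).coeFn_toLp, (memLp_mul_x v).coeFn_toLp,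
      Lp.coeFn_add (memLp_mul_x u).toLp (memLp_mul_x v).toLp] with x h1 h2 h3 h4 h5
    rw [h2, h5, Pi.add_apply, h3, h4, Submodule.coe_add, h1, Pi.add_apply, mul_add]
  map_smul' c u := by
    refine Lp.ext ?_
    filter_upwards [Lp.coeFn_smul c (u : L2), (memLp_mul_x (c • u)).coeFn_toLp,
      (memLp_mul_x u).coeFn_toLp,
      Lp.coeFn_smul c (memLp_mul_x u).toLp] with x h1 h2 h3 h4
    rw [RingHom.id_apply, h2, h4, Pi.smul_apply, h3, Submodule.coe_smul, h1, Pi.smul_apply,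
      smul_eq_mul, smul_eq_mul, mul_left_comm]

/-! ### The rescaled operator -/

/-- The domain `{u ∈ H²(ℝ, ℂ³) | x u₁, x u₂ ∈ L²(ℝ, ℂ)}`. -/
def domB : Submodule ℂ L2Vec where
  carrier := {u | (∀ i, u i ∈ H2) ∧ u 0 ∈ xDomain ∧ u 1 ∈ xDomain}
  add_mem' hu hv := ⟨fun i => H2.add_mem (hu.1 i) (hv.1 i),
    xDomain.add_mem hu.2.1 hv.2.1, xDomain.add_mem hu.2.2 hv.2.2⟩
  zero_mem' := ⟨fun _ => H2.zero_mem, xDomain.zero_mem, xDomain.zero_mem⟩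
  smul_mem' c _ hu := ⟨fun i => H2.smul_mem c (hu.1 i),
    xDomain.smul_mem c hu.2.1, xDomain.smul_mem c hu.2.2⟩

/-- The `i`-th component of an element of the domain. -/
def comp (i : Fin 3) : domB →ₗ[ℂ] L2 :=
  (PiLp.proj 2 (fun _ : Fin 3 => L2) i : L2Vec →L[ℂ] L2).toLinearMap ∘ₗ domB.subtype

/-- `d²uᵢ/dx²` for `u` in the domain. -/
def D2 (i : Fin 3) : domB →ₗ[ℂ] L2 :=
  secondDeriv ∘ₗ (comp i).codRestrict H2 (fun u => u.2.1 i)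

/-- `x u₁` for `u` in the domain. -/
def xFst : domB →ₗ[ℂ] L2 := mulX ∘ₗ (comp 0).codRestrict xDomain (fun u => u.2.2.1)

/-- `x u₂` for `u` in the domain. -/
def xSnd : domB →ₗ[ℂ] L2 := mulX ∘ₗ (comp 1).codRestrict xDomain (fun u => u.2.2.2)

/-- The coupling constant `ε^(-1/2) / √2`. -/
def coupling (ε : ℝ) : ℂ := ((1 / √2 * ε ^ (-(1 / 2) : ℝ) : ℝ) : ℂ)

/-- The operator
`(-d²/dx² + i x, 0, a; 0, -d²/dx² - i x, a; -a, -a, -d²/dx²)`, with `a = ε^(-1/2) / √2`,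
on the domain `domB`. -/
def checkB (ε : ℝ) : L2Vec →ₗ.[ℂ] L2Vec where
  domain := domB
  toFun := (WithLp.linearEquiv 2 ℂ (Fin 3 → L2)).symm.toLinearMap ∘ₗ LinearMap.pi
    ![-D2 0 + Complex.I • xFst + coupling ε • comp 2,
      -D2 1 - Complex.I • xSnd + coupling ε • comp 2,
      -(coupling ε • comp 0) - coupling ε • comp 1 - D2 2]

/-- The part of the open strip `|Im lam| < (1 - δ) ε^(-1/2)` outside `[0, ∞)`. -/
def strip (ε δ : ℝ) : Set ℂ :=
  {lam | ¬(lam.im = 0 ∧ 0 ≤ lam.re) ∧ |lam.im| < (1 - δ) * ε ^ (-(1 / 2) : ℝ)}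

/-- The factor `1 + (1 + ε^(1/2) (Re lam)₊^(1/2)) / |Im lam|`. -/
def growth (ε : ℝ) (lam : ℂ) : ℝ :=
  1 + (1 + ε ^ (1 / 2 : ℝ) * max lam.re 0 ^ (1 / 2 : ℝ)) / |lam.im|

end

end BlochTorrey

/-! Everything rests on an a priori estimate for Schwartz triples, with f = (B - λ)u, ν = Im λ and
coupling a, so that 2a² = 1/ε.

The operator is symmetric for the indefinite form u₀v̄₁ + u₁v̄₀ - u₂v̄₂, whose value at (u, u) is
|u₀ + u₁|² - |u|². The imaginary part of the equation tested with this form bounds u by w = u₀ + u₁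
and f/ν (`BTSystem.integral_sq_le`), so only w has to be estimated.

For Re λ up to a multiple of ε⁻², w and the flux q = ix(u₀ - u₁) + 2a u₂ form an almost closed
second order system. Its Wronskian yields (x² + 2a²)|w|² + |q|² + 2ν Im(q̄w), which is positive
definite because ν² < 2a²; this is the origin of the threshold ε^(-1/2)
(`BTSystem.integral_sum_le`). The one term that leaves the pair is small for such λ.

For larger Re λ the length is rescaled by σ, with σ⁴ = 4 Re λ, and the problem becomes semiclassical
with h = 2/σ³. The solution splits into waves moving forward and backward, whose amplitudes are
transported by a real symmetric matrix and by its negative. A functional of these amplitudes, with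
Gaussian and tail weights, has a derivative that is positive up to O(h) and source terms;
integration over the line gives `exists_semi_estimate`. Products of the two waves oscillate like
e^(2iky) and are removed by an averaging correction.

The passage from the estimate to the resolvent is functional analysis. The range on Schwartz
functions is dense for a = 0, λ = -1, by an explicit Fourier computation, and density propagates by
continuity, first in the coupling and Im λ at real part -1 and then in Re λ
(`orthogonal_of_apriori`). A graph estimate puts limits of Schwartz solutions into the domain, and
density gives injectivity because diag(1, 1, -1) conjugates the operator to its transpose. To the
left of the imaginary axis accretivity suffices. -/

namespace BlochTorrey

open Set Filter Topology

/-! ### Functionals along the line -/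

/-- If `F` vanishes at both ends of the line and `F' ≥ g` with `g` integrable, then `∫ g ≤ 0`. -/
theorem integral_nonpos_of_le_deriv {F F' g : ℝ → ℝ} (hF : ∀ y, HasDerivAt F (F' y) y)
    (hg : Integrable g) (hle : ∀ y, g y ≤ F' y) (htop : Tendsto F atTop (𝓝 0))
    (hbot : Tendsto F atBot (𝓝 0)) : ∫ y, g y ≤ 0 := by
  have h1 : Tendsto (fun R : ℝ => ∫ y in (-R)..R, g y) atTop (𝓝 (∫ y, g y)) :=
    intervalIntegral_tendsto_integral hg tendsto_neg_atTop_atBot tendsto_id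
  have h2 : Tendsto (fun R : ℝ => F R - F (-R)) atTop (𝓝 (0 - 0)) :=
    htop.sub (hbot.comp tendsto_neg_atTop_atBot)
  rw [sub_zero] at h2
  refine le_of_tendsto_of_tendsto h1 h2 ?_
  filter_upwards [eventually_ge_atTop (0 : ℝ)] with R hR
  -- In this one-sided form of the fundamental theorem only `g` has to be integrable; nothing is
  -- needed of `F'`.
  exact intervalIntegral.integral_le_sub_of_hasDeriv_right_of_le (by linarith)
    (fun y _ => (hF y).continuousAt.continuousWithinAt) (fun y _ => (hF y).hasDerivWithinAt)
    hg.integrableOn (fun y _ => hle y)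

/-- The real inner product of two complex numbers. -/
def dot (a b : ℂ) : ℝ := a.re * b.re + a.im * b.im

/-- The imaginary part of `conj a * b`. -/
def wdg (a b : ℂ) : ℝ := a.re * b.im - a.im * b.re

/-- The square of the modulus. -/
def sq (a : ℂ) : ℝ := a.re ^ 2 + a.im ^ 2

theorem sq_nonneg' (a : ℂ) : 0 ≤ sq a := by unfold sq; positivity

theorem sq_eq (a : ℂ) : sq a = ‖a‖ ^ 2 := by
  rw [Complex.sq_norm, Complex.normSq_apply, sq]; ring

theorem dot_self (a : ℂ) : dot a a = sq a := by unfold dot sq; ring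

theorem abs_dot_le {t : ℝ} (ht : 0 < t) (a b : ℂ) :
    |dot a b| ≤ t / 2 * sq a + 1 / (2 * t) * sq b := by
  have h : 1 / (2 * t) * sq b = t / 2 * (sq b / t ^ 2) := by field_simp
  rw [h, abs_le, dot, sq, sq]
  have h1 : 0 ≤ t / 2 * ((a.re + b.re / t) ^ 2 + (a.im + b.im / t) ^ 2) := by positivity
  have h2 : 0 ≤ t / 2 * ((a.re - b.re / t) ^ 2 + (a.im - b.im / t) ^ 2) := by positivity
  have e1 : t / 2 * ((a.re + b.re / t) ^ 2 + (a.im + b.im / t) ^ 2) =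
    t / 2 * (a.re ^ 2 + a.im ^ 2) + t / 2 * ((b.re ^ 2 + b.im ^ 2) / t ^ 2) +
      (a.re * b.re + a.im * b.im) := by field_simp; ring
  have e2 : t / 2 * ((a.re - b.re / t) ^ 2 + (a.im - b.im / t) ^ 2) =
    t / 2 * (a.re ^ 2 + a.im ^ 2) + t / 2 * ((b.re ^ 2 + b.im ^ 2) / t ^ 2) -
      (a.re * b.re + a.im * b.im) := by field_simp; ring
  constructor <;> linarith

theorem abs_wdg_le {t : ℝ} (ht : 0 < t) (a b : ℂ) :
    |wdg a b| ≤ t / 2 * sq a + 1 / (2 * t) * sq b := by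
  have h := abs_dot_le ht a (-Complex.I * b)
  have e1 : dot a (-Complex.I * b) = wdg a b := by
    simp [dot, wdg]; ring
  have e2 : sq (-Complex.I * b) = sq b := by
    simp [sq]; ring
  rwa [e1, e2] at h

theorem abs_dot_le_norm (a b : ℂ) : |dot a b| ≤ ‖a‖ * ‖b‖ := by
  have : dot a b = (a * starRingEnd ℂ b).re := by simp [dot]
  rw [this, ← RCLike.norm_conj b, ← norm_mul]
  exact Complex.abs_re_le_norm _

theorem abs_wdg_le_norm (a b : ℂ) : |wdg a b| ≤ ‖a‖ * ‖b‖ := by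
  have : wdg a b = (starRingEnd ℂ a * b).im := by simp [wdg]; ring
  rw [this, ← RCLike.norm_conj a, ← norm_mul]
  exact Complex.abs_im_le_norm _

theorem hasDerivAt_re {f : ℝ → ℂ} {f' : ℂ} {y : ℝ} (hf : HasDerivAt f f' y) :
    HasDerivAt (fun t => (f t).re) f'.re y :=
  Complex.reCLM.hasFDerivAt.comp_hasDerivAt y hf

theorem hasDerivAt_im {f : ℝ → ℂ} {f' : ℂ} {y : ℝ} (hf : HasDerivAt f f' y) :
    HasDerivAt (fun t => (f t).im) f'.im y :=
  Complex.imCLM.hasFDerivAt.comp_hasDerivAt y hf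

theorem hasDerivAt_dot {f g : ℝ → ℂ} {f' g' : ℂ} {y : ℝ} (hf : HasDerivAt f f' y)
    (hg : HasDerivAt g g' y) :
    HasDerivAt (fun t => dot (f t) (g t)) (dot f' (g y) + dot (f y) g') y := by
  unfold dot
  refine (((hasDerivAt_re hf).mul (hasDerivAt_re hg)).add
    ((hasDerivAt_im hf).mul (hasDerivAt_im hg))).congr_deriv ?_
  ring

theorem hasDerivAt_wdg {f g : ℝ → ℂ} {f' g' : ℂ} {y : ℝ} (hf : HasDerivAt f f' y)
    (hg : HasDerivAt g g' y) :
    HasDerivAt (fun t => wdg (f t) (g t)) (wdg f' (g y) + wdg (f y) g') y := by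
  unfold wdg
  refine (((hasDerivAt_re hf).mul (hasDerivAt_im hg)).sub
    ((hasDerivAt_im hf).mul (hasDerivAt_re hg))).congr_deriv ?_
  ring

/-! ### Gaussian weights -/

noncomputable section

/-- The weight `exp (2 ν y - y² / 2)`. -/
def gaussR (ν y : ℝ) : ℝ := Real.exp (2 * ν * y - y ^ 2 / 2)

/-- The weight `exp (-y²)`. -/
def gaussC (y : ℝ) : ℝ := Real.exp (-y ^ 2)

/-- The solution of `n' = 2 ν n - gaussR ν` which is bounded on the line. -/
def tailR (ν y : ℝ) : ℝ := Real.exp (2 * ν * y) * ∫ t in Ioi y, Real.exp (-t ^ 2 / 2)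

/-- A primitive of `gaussC`. -/
def primC (y : ℝ) : ℝ := ∫ t in (0 : ℝ)..y, gaussC t

end

theorem hasDerivAt_gaussR (ν y : ℝ) : HasDerivAt (gaussR ν) ((2 * ν - y) * gaussR ν y) y := by
  have h : HasDerivAt (fun t : ℝ => 2 * ν * t - t ^ 2 / 2) (2 * ν - y) y := by
    refine (((hasDerivAt_id y).const_mul (2 * ν)).sub
      ((hasDerivAt_pow 2 y).div_const 2)).congr_deriv ?_
    simp
  refine h.exp.congr_deriv ?_
  rw [gaussR]; ring

theorem hasDerivAt_gaussC (y : ℝ) : HasDerivAt gaussC (-2 * y * gaussC y) y := by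
  have h : HasDerivAt (fun t : ℝ => -t ^ 2) (-2 * y) y := by
    refine (hasDerivAt_pow 2 y).neg.congr_deriv ?_
    simp
  refine h.exp.congr_deriv ?_
  rw [gaussC]; ring

theorem continuous_gaussC : Continuous gaussC := by unfold gaussC; fun_prop

theorem hasDerivAt_primC (y : ℝ) : HasDerivAt primC (gaussC y) y :=
  (continuous_gaussC.integral_hasStrictDerivAt 0 y).hasDerivAt

theorem integrable_exp_neg_sq_half : Integrable (fun t : ℝ => Real.exp (-t ^ 2 / 2)) := by
  refine (integrable_exp_neg_mul_sq (b := 1 / 2) (by norm_num)).congr (ae_of_all _ fun t => ?_)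
  dsimp only; congr 1; ring

theorem hasDerivAt_tailR (ν y : ℝ) :
    HasDerivAt (tailR ν) (2 * ν * tailR ν y - gaussR ν y) y := by
  have hc : Continuous (fun t : ℝ => Real.exp (-t ^ 2 / 2)) := by fun_prop
  have h0 : (fun x : ℝ => ∫ t in Ioi x, Real.exp (-t ^ 2 / 2)) = fun x =>
      (∫ t in Ioi (0 : ℝ), Real.exp (-t ^ 2 / 2)) - ∫ t in (0 : ℝ)..x, Real.exp (-t ^ 2 / 2) := by
    funext x
    rw [← intervalIntegral.integral_interval_add_Ioi
      (integrable_exp_neg_sq_half.integrableOn (s := Ioi 0))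
      (integrable_exp_neg_sq_half.integrableOn (s := Ioi x))]
    ring
  have h1 : HasDerivAt (fun x : ℝ => ∫ t in Ioi x, Real.exp (-t ^ 2 / 2))
      (-Real.exp (-y ^ 2 / 2)) y := by
    rw [h0]
    exact (hc.integral_hasStrictDerivAt 0 y).hasDerivAt.const_sub _
  have h2 : HasDerivAt (fun t : ℝ => 2 * ν * t) (2 * ν) y := by
    simpa using (hasDerivAt_id y).const_mul (2 * ν)
  refine (h2.exp.mul h1).congr_deriv ?_
  have h3 : gaussR ν y = Real.exp (2 * ν * y) * Real.exp (-y ^ 2 / 2) := by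
    rw [gaussR, ← Real.exp_add]; congr 1; ring
  rw [h3, tailR]; ring

theorem gaussR_pos (ν y : ℝ) : 0 < gaussR ν y := Real.exp_pos _

theorem gaussC_pos (y : ℝ) : 0 < gaussC y := Real.exp_pos _

theorem gaussC_le_one (y : ℝ) : gaussC y ≤ 1 := by
  rw [gaussC, Real.exp_le_one_iff]; nlinarith [sq_nonneg y]

theorem tailR_nonneg (ν y : ℝ) : 0 ≤ tailR ν y :=
  mul_nonneg (Real.exp_pos _).le (integral_nonneg fun _ => (Real.exp_pos _).le)

theorem primC_abs_le (y : ℝ) : |primC y| ≤ 2 := by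
  have hi : Integrable gaussC := by
    refine (integrable_exp_neg_mul_sq (b := 1) one_pos).congr (ae_of_all _ fun t => ?_)
    simp [gaussC]
  have h1 : |primC y| ≤ ∫ t, gaussC t := by
    have := intervalIntegral.norm_integral_le_integral_norm_uIoc (f := gaussC) (a := 0) (b := y)
      (μ := volume)
    rw [Real.norm_eq_abs] at this
    refine this.trans ?_
    have e : ∀ t, ‖gaussC t‖ = gaussC t := fun t => Real.norm_of_nonneg (gaussC_pos t).le
    simp_rw [e]
    exact setIntegral_le_integral hi (ae_of_all _ fun t => (gaussC_pos t).le)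
  have h2 : ∫ t, gaussC t = √Real.pi := by
    have := integral_gaussian 1
    simpa [gaussC] using this
  rw [h2] at h1
  refine h1.trans ?_
  rw [Real.sqrt_le_left (by norm_num)]
  linarith [Real.pi_le_four]

theorem primC_mono : Monotone primC :=
  monotone_of_deriv_nonneg (fun y => (hasDerivAt_primC y).differentiableAt)
    fun y => by rw [(hasDerivAt_primC y).deriv]; exact (gaussC_pos y).le

theorem primC_zero : primC 0 = 0 := by simp [primC]

theorem primC_mul_self_nonneg (y : ℝ) : 0 ≤ primC y * y := by
  rcases le_total 0 y with h | h
  · exact mul_nonneg (primC_zero ▸ primC_mono h) h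
  · exact mul_nonneg_of_nonpos_of_nonpos (primC_zero ▸ primC_mono h) h

theorem primC_neg (y : ℝ) : primC (-y) = -primC y := by
  unfold primC
  have := intervalIntegral.integral_comp_neg (a := 0) (b := y) gaussC
  rw [neg_zero] at this
  rw [intervalIntegral.integral_symm, ← this]
  simp [gaussC]

theorem exp_neg_one_le_primC {y : ℝ} (hy : 1 ≤ y) : Real.exp (-1) ≤ primC y := by
  refine le_trans ?_ (primC_mono hy)
  have h : ∫ t in (0 : ℝ)..1, Real.exp (-1) ≤ ∫ t in (0 : ℝ)..1, gaussC t := by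
    refine intervalIntegral.integral_mono_on zero_le_one (by simp)
      (continuous_gaussC.intervalIntegrable _ _) fun t ht => ?_
    rw [gaussC, Real.exp_le_exp]
    nlinarith [ht.1, ht.2]
  simpa [primC] using h

theorem le_primC_mul_self {y : ℝ} (hy : 1 ≤ |y|) : |y| / 3 ≤ primC y * y := by
  have he : (1 : ℝ) / 3 ≤ Real.exp (-1) := by
    rw [Real.exp_neg, ← one_div]
    exact one_div_le_one_div_of_le (Real.exp_pos _) (by linarith [Real.exp_one_lt_d9])
  rcases le_total 0 y with h | h
  · rw [abs_of_nonneg h] at hy ⊢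
    nlinarith [exp_neg_one_le_primC hy]
  · rw [abs_of_nonpos h] at hy ⊢
    have := exp_neg_one_le_primC hy
    rw [primC_neg] at this
    nlinarith

/-- The last two bounds are the essential ones: `gaussC` decays faster than every `gaussR ν`, even
after multiplication by a quadratic polynomial, so a small multiple of it can be absorbed. The tail
is bounded only for ν ≥ 0, where e^(2νy) ≤ e^(2νt) inside the integral over t > y. -/
theorem exists_gauss_bounds (V : ℝ) : ∃ K : ℝ, 1 ≤ K ∧ ∀ ν : ℝ, |ν| ≤ V → ∀ y : ℝ,
    gaussR ν y * (1 + |y|) ^ 2 ≤ K ∧ gaussC y * (1 + |y|) ^ 2 ≤ K ∧ (0 ≤ ν → tailR ν y ≤ K) ∧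
    gaussC y ≤ K * gaussR ν y ∧ (3 * y + 2 * ν) ^ 2 * gaussC y ≤ K * gaussR ν y := by
  refine ⟨(36 + 32 * V ^ 2) * Real.exp (4 * V ^ 2), ?_, fun ν hν y => ?_⟩
  · have : 1 ≤ Real.exp (4 * V ^ 2) := Real.one_le_exp (by positivity)
    nlinarith [sq_nonneg V]
  have hV : ν ^ 2 ≤ V ^ 2 := sq_le_sq.mpr (hν.trans (le_abs_self V))
  have hE : 1 ≤ Real.exp (4 * V ^ 2) := Real.one_le_exp (by positivity)
  have hy2 : (1 + |y|) ^ 2 ≤ 2 * (1 + y ^ 2) := by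
    nlinarith [sq_nonneg (1 - |y|), sq_abs y]
  have hG : ∀ t : ℝ, gaussR ν t ≤ Real.exp (4 * V ^ 2) * Real.exp (-t ^ 2 / 4) := by
    intro t
    rw [gaussR, ← Real.exp_add, Real.exp_le_exp]
    nlinarith [sq_nonneg (t / 2 - 2 * ν)]
  -- Completing the square, the quotient of `gaussR ν` by `gaussC` is exp((y + 2ν)²/2 - 2ν²).
  have hlow : gaussC y * Real.exp (-(2 * V ^ 2)) * Real.exp ((y + 2 * ν) ^ 2 / 2) ≤
      gaussR ν y := by
    rw [gaussC, gaussR, ← Real.exp_add, ← Real.exp_add, Real.exp_le_exp]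
    nlinarith
  have hlow2 : gaussC y * Real.exp ((y + 2 * ν) ^ 2 / 2) ≤
      Real.exp (4 * V ^ 2) * gaussR ν y := by
    have h1 : Real.exp (2 * V ^ 2) * Real.exp (-(2 * V ^ 2)) = 1 := by
      rw [← Real.exp_add, add_neg_cancel, Real.exp_zero]
    have h2 : Real.exp (2 * V ^ 2) ≤ Real.exp (4 * V ^ 2) := by
      rw [Real.exp_le_exp]; nlinarith [sq_nonneg V]
    calc gaussC y * Real.exp ((y + 2 * ν) ^ 2 / 2)
        = Real.exp (2 * V ^ 2) *
          (gaussC y * Real.exp (-(2 * V ^ 2)) * Real.exp ((y + 2 * ν) ^ 2 / 2)) := by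
          linear_combination -(gaussC y * Real.exp ((y + 2 * ν) ^ 2 / 2)) * h1
      _ ≤ Real.exp (2 * V ^ 2) * gaussR ν y := by gcongr
      _ ≤ _ := by have := gaussR_pos ν y; gcongr
  have hexp : (y + 2 * ν) ^ 2 / 2 + 1 ≤ Real.exp ((y + 2 * ν) ^ 2 / 2) := Real.add_one_le_exp _
  have hR := gaussR_pos ν y
  have hC := gaussC_pos y
  have hER : 0 < Real.exp (4 * V ^ 2) * gaussR ν y := by positivity
  have hlow3 : gaussC y * ((y + 2 * ν) ^ 2 / 2 + 1) ≤ Real.exp (4 * V ^ 2) * gaussR ν y :=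
    (mul_le_mul_of_nonneg_left hexp hC.le).trans hlow2
  refine ⟨?_, ?_, ?_, ?_, ?_⟩
  · have h1 : 1 + y ^ 2 / 4 ≤ Real.exp (y ^ 2 / 4) := by
      linarith [Real.add_one_le_exp (y ^ 2 / 4)]
    have h2 : Real.exp (-y ^ 2 / 4) * Real.exp (y ^ 2 / 4) = 1 := by
      rw [← Real.exp_add]; simp [neg_div]
    have h3 : Real.exp (-y ^ 2 / 4) * (1 + |y|) ^ 2 ≤ 8 := by
      calc Real.exp (-y ^ 2 / 4) * (1 + |y|) ^ 2
          ≤ Real.exp (-y ^ 2 / 4) * (8 * Real.exp (y ^ 2 / 4)) := by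
            gcongr; nlinarith
        _ = 8 := by linear_combination 8 * h2
    calc gaussR ν y * (1 + |y|) ^ 2
        ≤ Real.exp (4 * V ^ 2) * Real.exp (-y ^ 2 / 4) * (1 + |y|) ^ 2 := by gcongr; exact hG y
      _ ≤ Real.exp (4 * V ^ 2) * 8 := by rw [mul_assoc]; gcongr
      _ ≤ _ := by nlinarith [sq_nonneg V]
  · have h1 : 1 + y ^ 2 ≤ Real.exp (y ^ 2) := by linarith [Real.add_one_le_exp (y ^ 2)]
    have h2 : gaussC y * Real.exp (y ^ 2) = 1 := by
      rw [gaussC, ← Real.exp_add]; simp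
    calc gaussC y * (1 + |y|) ^ 2 ≤ gaussC y * (2 * Real.exp (y ^ 2)) := by
          gcongr; linarith
      _ = 2 := by linear_combination 2 * h2
      _ ≤ _ := by nlinarith [sq_nonneg V]
  · intro hν0
    have hi : Integrable (fun t : ℝ => Real.exp (-t ^ 2 / 4)) := by
      refine (integrable_exp_neg_mul_sq (b := 1 / 4) (by norm_num)).congr
        (ae_of_all _ fun t => ?_)
      dsimp only; congr 1; ring
    have hint : ∫ t : ℝ, Real.exp (-t ^ 2 / 4) ≤ 4 := by
      have h := integral_gaussian (1 / 4)
      have e : (fun x : ℝ => Real.exp (-(1 / 4) * x ^ 2)) = fun t => Real.exp (-t ^ 2 / 4) := by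
        funext t; congr 1; ring
      rw [e] at h
      rw [h, Real.sqrt_le_left (by norm_num)]
      linarith [Real.pi_le_four]
    have h1 : tailR ν y ≤ ∫ t in Ioi y, Real.exp (4 * V ^ 2) * Real.exp (-t ^ 2 / 4) := by
      rw [tailR, ← integral_const_mul]
      refine setIntegral_mono_on (integrable_exp_neg_sq_half.const_mul _).integrableOn
        (hi.const_mul _).integrableOn measurableSet_Ioi fun t ht => ?_
      refine le_trans ?_ (hG t)
      rw [gaussR, ← Real.exp_add, Real.exp_le_exp]
      nlinarith [mul_le_mul_of_nonneg_left (le_of_lt (mem_Ioi.mp ht)) hν0]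
    have h2 : ∫ t in Ioi y, Real.exp (4 * V ^ 2) * Real.exp (-t ^ 2 / 4) ≤
        Real.exp (4 * V ^ 2) * 4 := by
      refine (setIntegral_le_integral (hi.const_mul _)
        (ae_of_all _ fun t => by positivity)).trans ?_
      rw [integral_const_mul]
      gcongr
    nlinarith [sq_nonneg V]
  · nlinarith [sq_nonneg (y + 2 * ν), sq_nonneg V]
  · have h1 : (3 * y + 2 * ν) ^ 2 ≤ (36 + 32 * V ^ 2) * ((y + 2 * ν) ^ 2 / 2 + 1) := by
      have : (3 * y + 2 * ν) ^ 2 ≤ 18 * (y + 2 * ν) ^ 2 + 32 * ν ^ 2 := by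
        nlinarith [sq_nonneg (3 * (y + 2 * ν) + 4 * ν)]
      nlinarith [sq_nonneg (y + 2 * ν), mul_nonneg (sq_nonneg V) (sq_nonneg (y + 2 * ν))]
    calc (3 * y + 2 * ν) ^ 2 * gaussC y
        ≤ (36 + 32 * V ^ 2) * ((y + 2 * ν) ^ 2 / 2 + 1) * gaussC y := by gcongr
      _ = (36 + 32 * V ^ 2) * (gaussC y * ((y + 2 * ν) ^ 2 / 2 + 1)) := by ring
      _ ≤ (36 + 32 * V ^ 2) * (Real.exp (4 * V ^ 2) * gaussR ν y) := by gcongr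
      _ = _ := by ring

end BlochTorrey

namespace BlochTorrey

open Set Filter Topology

/-! ### The semiclassical system -/

noncomputable section

/-- The matrix `(y - ν, 0, a; 0, -y - ν, a; a, a, -ν)` applied to `u`. -/
def mulM (a ν y : ℝ) (u : Fin 3 → ℂ) : Fin 3 → ℂ :=
  ![((y - ν : ℝ) : ℂ) * u 0 + (a : ℂ) * u 2, ((-y - ν : ℝ) : ℂ) * u 1 + (a : ℂ) * u 2,
    (a : ℂ) * (u 0 + u 1) - (ν : ℂ) * u 2]

/-- The first order form of `-k⁻² u'' - u + 2 i k⁻¹ M u = 2 k⁻¹ f`, where `M` is `mulM`. -/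
structure SemiSystem (k a ν : ℝ) (u z f : Fin 3 → ℝ → ℂ) : Prop where
  deriv_u : ∀ j y, HasDerivAt (u j) (k * Complex.I * z j y) y
  deriv_z : ∀ j y, HasDerivAt (z j)
    (k * Complex.I * u j y + 2 * (mulM a ν y (fun i => u i y) j + Complex.I * f j y)) y

/-- The forward part of a solution. -/
def fwd (u z : Fin 3 → ℝ → ℂ) (j : Fin 3) (y : ℝ) : ℂ := ((1 / 2 : ℝ) : ℂ) * (u j y + z j y)

/-- The backward part of a solution. -/
def bwd (u z : Fin 3 → ℝ → ℂ) (j : Fin 3) (y : ℝ) : ℂ := ((1 / 2 : ℝ) : ℂ) * (u j y - z j y)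

/-- The source which couples the forward and the backward part. -/
def drive (a ν : ℝ) (u f : Fin 3 → ℝ → ℂ) (j : Fin 3) (y : ℝ) : ℂ :=
  mulM a ν y (fun i => u i y) j + Complex.I * f j y

variable {k a ν : ℝ} {u z f : Fin 3 → ℝ → ℂ}

/-- Write A and B for the forward and backward part and M for `mulM`. Apart from the coupling of A
and B in `drive` and the source, A is a wave e^(iky) with amplitude transported by A' = MA, and B is
a wave e^(-iky) with amplitude transported by B' = -MB. -/
theorem SemiSystem.deriv_fwd (hs : SemiSystem k a ν u z f) (j : Fin 3) (y : ℝ) :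
    HasDerivAt (fwd u z j) (k * Complex.I * fwd u z j y + drive a ν u f j y) y := by
  refine (((hs.deriv_u j y).add (hs.deriv_z j y)).const_mul ((1 / 2 : ℝ) : ℂ)).congr_deriv ?_
  rw [fwd, drive]; push_cast; ring

theorem SemiSystem.deriv_bwd (hs : SemiSystem k a ν u z f) (j : Fin 3) (y : ℝ) :
    HasDerivAt (bwd u z j) (-(k * Complex.I * bwd u z j y) - drive a ν u f j y) y := by
  refine (((hs.deriv_u j y).sub (hs.deriv_z j y)).const_mul ((1 / 2 : ℝ) : ℂ)).congr_deriv ?_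
  rw [bwd, drive]; push_cast; ring

/-- The Gaussian functional. -/
def funH (ν ζ : ℝ) (A B : Fin 3 → ℝ → ℂ) (y : ℝ) : ℝ :=
  gaussR ν y * dot (A 2 y) (A 0 y) - gaussR (-ν) y * dot (B 2 y) (B 1 y) +
    ζ * gaussC y * (dot (A 2 y) (A 1 y) - dot (B 2 y) (B 0 y))

/-- The coefficients of the mixed terms in the derivative of `funH`. -/
def mix (a ν ζ : ℝ) (y : ℝ) : Fin 3 → Fin 3 → ℝ :=
  ![![a * (gaussR ν y + ζ * gaussC y), a * (gaussR ν y + gaussR (-ν) y),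
      -ν * gaussR ν y + ζ * ((y - ν) * gaussC y)],
    ![2 * a * ζ * gaussC y, a * (gaussR (-ν) y + ζ * gaussC y),
      -(y + ν) * gaussR (-ν) y - ν * ζ * gaussC y],
    ![(y - ν) * gaussR ν y - ν * ζ * gaussC y, -ν * gaussR (-ν) y - ζ * ((y + ν) * gaussC y),
      a * (gaussR ν y + gaussR (-ν) y + 2 * ζ * gaussC y)]]

/-- The source terms in the derivative of `funH`. -/
def srcH (ν ζ y : ℝ) (A B f : Fin 3 → ℂ) : ℝ :=
  gaussR ν y * (wdg (f 2) (A 0) + wdg (f 0) (A 2)) +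
  gaussR (-ν) y * (wdg (f 2) (B 1) + wdg (f 1) (B 2)) +
  ζ * gaussC y * (wdg (f 2) (A 1) + wdg (f 1) (A 2) + wdg (f 2) (B 0) + wdg (f 0) (B 2))

/-- The weights are integrating factors. Under the diagonal of M the product A₂·A₀ has growth rate y
- 2ν, and `gaussR ν` has logarithmic derivative 2ν - y, so only the terms produced by the coupling
survive, among them the squares. B₂·B₁ with `gaussR (-ν)` behaves in the same way. The products with
weight `gaussC` are not matched, which leaves the residues with 3y ± 2ν; they are needed to gain
|A₁|² and |B₀|². -/
theorem SemiSystem.deriv_funH (hs : SemiSystem k a ν u z f) (ζ y : ℝ) :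
    HasDerivAt (funH ν ζ (fwd u z) (bwd u z))
      (a * gaussR ν y * (sq (fwd u z 0 y) + dot (fwd u z 0 y) (fwd u z 1 y) + sq (fwd u z 2 y)) +
        a * gaussR (-ν) y *
          (sq (bwd u z 1 y) + dot (bwd u z 0 y) (bwd u z 1 y) + sq (bwd u z 2 y)) +
        a * ζ * gaussC y * (sq (fwd u z 1 y) + dot (fwd u z 0 y) (fwd u z 1 y) +
          sq (fwd u z 2 y) + sq (bwd u z 0 y) + dot (bwd u z 0 y) (bwd u z 1 y) +
          sq (bwd u z 2 y)) -
        ζ * gaussC y * ((3 * y + 2 * ν) * dot (fwd u z 2 y) (fwd u z 1 y) -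
          (3 * y - 2 * ν) * dot (bwd u z 2 y) (bwd u z 0 y)) +
        ∑ i, ∑ j, mix a ν ζ y i j * dot (fwd u z i y) (bwd u z j y) +
        srcH ν ζ y (fun i => fwd u z i y) (fun i => bwd u z i y) (fun i => f i y)) y := by
  have hA := hs.deriv_fwd
  have hB := hs.deriv_bwd
  have hu : ∀ j, u j y = fwd u z j y + bwd u z j y := fun j => by
    rw [fwd, bwd]; push_cast; ring
  refine ((((hasDerivAt_gaussR ν y).mul (hasDerivAt_dot (hA 2 y) (hA 0 y))).sub
    ((hasDerivAt_gaussR (-ν) y).mul (hasDerivAt_dot (hB 2 y) (hB 1 y)))).add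
    (((hasDerivAt_gaussC y).const_mul ζ).mul ((hasDerivAt_dot (hA 2 y) (hA 1 y)).sub
      (hasDerivAt_dot (hB 2 y) (hB 0 y))))).congr_deriv ?_
  simp only [Fin.sum_univ_three, mix, drive, mulM, srcH, hu, Matrix.cons_val_zero,
    Matrix.cons_val_one, Matrix.cons_val, Pi.sub_apply]
  generalize gaussR ν y = g1
  generalize gaussR (-ν) y = g2
  generalize gaussC y = g3
  generalize fwd u z 0 y = A0
  generalize fwd u z 1 y = A1
  generalize fwd u z 2 y = A2
  generalize bwd u z 0 y = B0
  generalize bwd u z 1 y = B1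
  generalize bwd u z 2 y = B2
  simp only [dot, wdg, sq, Complex.add_re, Complex.add_im, Complex.mul_re, Complex.mul_im,
    Complex.sub_re, Complex.sub_im, Complex.neg_re, Complex.neg_im, Complex.ofReal_re,
    Complex.ofReal_im, Complex.I_re, Complex.I_im]
  ring

/-- The real part of the Hermitian form `u₀ v̄₁ + u₁ v̄₀ - u₂ v̄₂`. -/
def formRe (u v : Fin 3 → ℂ) : ℝ := dot (u 0) (v 1) + dot (u 1) (v 0) - dot (u 2) (v 2)

/-- The imaginary part of the Hermitian form `u₀ v̄₁ + u₁ v̄₀ - u₂ v̄₂`. -/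
def formIm (u v : Fin 3 → ℂ) : ℝ := -(wdg (u 0) (v 1) + wdg (u 1) (v 0) - wdg (u 2) (v 2))

/-- The quadratic form associated with the antisymmetric matrix `(0, -y, a; y, 0, a; -a, -a, 0)`. -/
def skew (a y : ℝ) (u : Fin 3 → ℂ) : ℝ :=
  -2 * y * wdg (u 0) (u 1) - 2 * a * wdg (u 2) (u 0 + u 1)

/-- The even part of the tail weight. -/
def tailE (a ν y : ℝ) : ℝ := a / 4 * (tailR ν y + tailR ν (-y))

/-- The odd part of the tail weight. -/
def tailO (a ν y : ℝ) : ℝ := a / 4 * (tailR ν y - tailR ν (-y))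

theorem hasDerivAt_tailR_neg (ν y : ℝ) : HasDerivAt (fun t => tailR ν (-t))
    (-(2 * ν * tailR ν (-y)) + gaussR (-ν) y) y := by
  refine ((hasDerivAt_tailR ν (-y)).comp y (hasDerivAt_neg y)).congr_deriv ?_
  have : gaussR ν (-y) = gaussR (-ν) y := by unfold gaussR; congr 1; ring
  rw [this]; ring

theorem hasDerivAt_tailE (a ν y : ℝ) : HasDerivAt (tailE a ν)
    (2 * ν * tailO a ν y - a / 4 * (gaussR ν y - gaussR (-ν) y)) y := by
  refine (((hasDerivAt_tailR ν y).add (hasDerivAt_tailR_neg ν y)).const_mul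
    (a / 4)).congr_deriv ?_
  rw [tailO]; ring

theorem hasDerivAt_tailO (a ν y : ℝ) : HasDerivAt (tailO a ν)
    (2 * ν * tailE a ν y - a / 4 * (gaussR ν y + gaussR (-ν) y)) y := by
  refine (((hasDerivAt_tailR ν y).sub (hasDerivAt_tailR_neg ν y)).const_mul
    (a / 4)).congr_deriv ?_
  rw [tailE]; ring

/-- The functional built on the form `u₀ v̄₁ + u₁ v̄₀ - u₂ v̄₂`. -/
def funN (h a ν : ℝ) (u z : Fin 3 → ℝ → ℂ) (y : ℝ) : ℝ :=
  tailE a ν y * formRe (fun i => z i y) (fun i => u i y) +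
    1 / 2 * tailO a ν y * (formRe (fun i => u i y) (fun i => u i y) +
      formRe (fun i => z i y) (fun i => z i y)) +
    h * (tailO a ν y * skew a y (fun i => u i y) -
      ν * tailE a ν y * formIm (fun i => u i y) (fun i => z i y))

theorem hasDerivAt_formRe {u v : Fin 3 → ℝ → ℂ} {u' v' : Fin 3 → ℂ} {y : ℝ}
    (hu : ∀ j, HasDerivAt (u j) (u' j) y) (hv : ∀ j, HasDerivAt (v j) (v' j) y) :
    HasDerivAt (fun t => formRe (fun i => u i t) (fun i => v i t))
      (formRe u' (fun i => v i y) + formRe (fun i => u i y) v') y := by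
  refine (((hasDerivAt_dot (hu 0) (hv 1)).add (hasDerivAt_dot (hu 1) (hv 0))).sub
    (hasDerivAt_dot (hu 2) (hv 2))).congr_deriv ?_
  unfold formRe; ring

theorem hasDerivAt_formIm {u v : Fin 3 → ℝ → ℂ} {u' v' : Fin 3 → ℂ} {y : ℝ}
    (hu : ∀ j, HasDerivAt (u j) (u' j) y) (hv : ∀ j, HasDerivAt (v j) (v' j) y) :
    HasDerivAt (fun t => formIm (fun i => u i t) (fun i => v i t))
      (formIm u' (fun i => v i y) + formIm (fun i => u i y) v') y := by
  refine (((hasDerivAt_wdg (hu 0) (hv 1)).add (hasDerivAt_wdg (hu 1) (hv 0))).sub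
    (hasDerivAt_wdg (hu 2) (hv 2))).neg.congr_deriv ?_
  unfold formIm; ring

theorem hasDerivAt_skew {u : Fin 3 → ℝ → ℂ} {u' : Fin 3 → ℂ} {y : ℝ} (a : ℝ)
    (hu : ∀ j, HasDerivAt (u j) (u' j) y) :
    HasDerivAt (fun t => skew a t (fun i => u i t))
      (-2 * wdg (u 0 y) (u 1 y) - 2 * y * (wdg (u' 0) (u 1 y) + wdg (u 0 y) (u' 1)) -
        2 * a * (wdg (u' 2) (u 0 y + u 1 y) + wdg (u 2 y) (u' 0 + u' 1))) y := by
  refine ((((hasDerivAt_id y).const_mul (-2)).mul (hasDerivAt_wdg (hu 0) (hu 1))).sub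
    ((hasDerivAt_wdg (hu 2) ((hu 0).add (hu 1))).const_mul (2 * a))).congr_deriv ?_
  simp only [id, Pi.add_apply]; ring

/-- The real part of the form at (Mu, u) is -ν times its value at (u, u), so the form of A decays
like e^(-2νy) along the transport, and a weight n with n' = 2νn - `gaussR ν` turns this into
-`gaussR ν` times the form of A. The resulting cross term cancels the indefinite A₀·A₁ in the
derivative of `funH`. The tail weights lack decay uniform in ν, so the mixed terms cannot be
averaged like those of `funH`; the explicit h-terms of `funN` remove them instead, with a remainder
of order h. -/
theorem SemiSystem.deriv_funN (hs : SemiSystem k a ν u z f) {h : ℝ} (hk : h * k = 1) (y : ℝ) :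
    HasDerivAt (funN h a ν u z)
      (-(a / 2 * gaussR ν y * formRe (fun i => fwd u z i y) (fun i => fwd u z i y)) -
        a / 2 * gaussR (-ν) y * formRe (fun i => bwd u z i y) (fun i => bwd u z i y) +
        h * (2 * ν * tailE a ν y * skew a y (fun i => u i y) -
          ν * (2 * ν * tailO a ν y - a / 4 * (gaussR ν y - gaussR (-ν) y)) *
            formIm (fun i => u i y) (fun i => z i y) -
          2 * tailO a ν y * wdg (u 0 y) (u 1 y) +
          (2 * ν * tailE a ν y - a / 4 * (gaussR ν y + gaussR (-ν) y)) *
            skew a y (fun i => u i y)) +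
        (-2 * tailE a ν y * formIm (fun i => f i y) (fun i => u i y) -
          2 * tailO a ν y * formIm (fun i => f i y) (fun i => z i y) +
          2 * h * ν * tailE a ν y * formRe (fun i => u i y) (fun i => f i y))) y := by
  have hu := fun j => hs.deriv_u j y
  have hz := fun j => hs.deriv_z j y
  refine ((((hasDerivAt_tailE a ν y).mul (hasDerivAt_formRe hz hu)).add
    (((hasDerivAt_tailO a ν y).const_mul (1 / 2)).mul
      ((hasDerivAt_formRe hu hu).add (hasDerivAt_formRe hz hz)))).add
    ((((hasDerivAt_tailO a ν y).mul (hasDerivAt_skew a hu)).sub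
      (((hasDerivAt_tailE a ν y).const_mul ν).mul (hasDerivAt_formIm hu hz))).const_mul
        h)).congr_deriv ?_
  simp only [formRe, formIm, skew, mulM, fwd, bwd, Matrix.cons_val_zero, Pi.add_apply,
    Matrix.cons_val_one, Matrix.cons_val]
  generalize gaussR ν y = g1
  generalize gaussR (-ν) y = g2
  generalize tailE a ν y = e
  generalize tailO a ν y = o
  have hk' : h = k⁻¹ := eq_inv_of_mul_eq_one_left hk
  have hk0 : k ≠ 0 := right_ne_zero_of_mul_eq_one hk
  rw [hk']
  generalize u 0 y = u0
  generalize u 1 y = u1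
  generalize u 2 y = u2
  generalize z 0 y = z0
  generalize z 1 y = z1
  generalize z 2 y = z2
  simp only [dot, wdg, Complex.add_re, Complex.add_im, Complex.mul_re, Complex.mul_im,
    Complex.sub_re, Complex.sub_im, Complex.ofReal_re,
    Complex.ofReal_im, Complex.I_re, Complex.I_im, Complex.re_ofNat, Complex.im_ofNat]
  field_simp
  ring

/-- The functional which is effective far out. -/
def funP (u z : Fin 3 → ℝ → ℂ) (y : ℝ) : ℝ :=
  primC y * (dot (z 0 y) (u 0 y) - dot (z 1 y) (u 1 y))

/-- The entries y and -y of the matrix have opposite signs, so the difference of the two components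
produces y(|u₀|² + |u₁|²), and `primC` has the sign of y. This gives confinement with weight |y|. -/
theorem SemiSystem.deriv_funP (hs : SemiSystem k a ν u z f) (y : ℝ) :
    HasDerivAt (funP u z)
      (gaussC y * (dot (z 0 y) (u 0 y) - dot (z 1 y) (u 1 y)) +
        primC y * (2 * y * (sq (u 0 y) + sq (u 1 y)) - 2 * ν * (sq (u 0 y) - sq (u 1 y)) +
          2 * a * (dot (u 2 y) (u 0 y) - dot (u 2 y) (u 1 y))) +
        2 * primC y * (wdg (f 0 y) (u 0 y) - wdg (f 1 y) (u 1 y))) y := by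
  have hu := fun j => hs.deriv_u j y
  have hz := fun j => hs.deriv_z j y
  refine ((hasDerivAt_primC y).mul ((hasDerivAt_dot (hz 0) (hu 0)).sub
    (hasDerivAt_dot (hz 1) (hu 1)))).congr_deriv ?_
  simp only [mulM, Matrix.cons_val_zero, Matrix.cons_val_one, Pi.sub_apply]
  simp only [dot, wdg, sq, Complex.add_re, Complex.add_im, Complex.mul_re, Complex.mul_im,
    Complex.ofReal_re, Complex.ofReal_im, Complex.I_re, Complex.I_im, Complex.re_ofNat,
    Complex.im_ofNat]
  ring

/-- The entries y and a cancel in the form. Minus the form at (u, u) contains +|u₂|², which supplies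
the control of u₂ far out that `funP` does not give. -/
theorem SemiSystem.deriv_formRe (hs : SemiSystem k a ν u z f) (y : ℝ) :
    HasDerivAt (fun y => formRe (fun i => z i y) (fun i => u i y))
      (-2 * ν * formRe (fun i => u i y) (fun i => u i y) -
        2 * formIm (fun i => f i y) (fun i => u i y)) y := by
  refine (hasDerivAt_formRe (fun j => hs.deriv_z j y) (fun j => hs.deriv_u j y)).congr_deriv ?_
  simp only [formRe, formIm, mulM, Matrix.cons_val_zero, Matrix.cons_val_one, Matrix.cons_val]
  simp only [dot, wdg, Complex.add_re, Complex.add_im, Complex.mul_re, Complex.mul_im,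
    Complex.sub_re, Complex.sub_im, Complex.ofReal_re,
    Complex.ofReal_im, Complex.I_re, Complex.I_im, Complex.re_ofNat, Complex.im_ofNat]
  ring

/-- M is real symmetric, so it drops out of the imaginary part. What remains is equipartition
between u and z up to the source. -/
theorem SemiSystem.deriv_energy (hs : SemiSystem k a ν u z f) {h : ℝ} (hk : h * k = 1) (y : ℝ) :
    HasDerivAt (fun y => h * ∑ j, wdg (u j y) (z j y))
      (∑ j, (sq (u j y) - sq (z j y) + 2 * h * dot (f j y) (u j y))) y := by
  refine ((HasDerivAt.fun_sum fun j (_ : j ∈ Finset.univ) =>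
    hasDerivAt_wdg (hs.deriv_u j y) (hs.deriv_z j y)).const_mul h).congr_deriv ?_
  have hk' : h = k⁻¹ := eq_inv_of_mul_eq_one_left hk
  have hk0 : k ≠ 0 := right_ne_zero_of_mul_eq_one hk
  rw [hk']
  simp only [Fin.sum_univ_three, mulM, Matrix.cons_val_zero, Matrix.cons_val_one, Matrix.cons_val]
  simp only [dot, wdg, sq, Complex.add_re, Complex.add_im, Complex.mul_re, Complex.mul_im,
    Complex.sub_re, Complex.sub_im, Complex.ofReal_re,
    Complex.ofReal_im, Complex.I_re, Complex.I_im, Complex.re_ofNat, Complex.im_ofNat]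
  field_simp
  ring

/-- The averaging step: conj(A)B rotates at rate -2k, so differentiating its imaginary part returns
-2k times the real part. The factor h/2 normalises this, and the mixed term is traded for quantities
of order h. -/
theorem SemiSystem.deriv_mix (hs : SemiSystem k a ν u z f) {h : ℝ} (hk : h * k = 1) (i j : Fin 3)
    {q : ℝ → ℝ} {q' y : ℝ} (hq : HasDerivAt q q' y) :
    HasDerivAt (fun y => h / 2 * (q y * wdg (fwd u z i y) (bwd u z j y)))
      (-(q y * dot (fwd u z i y) (bwd u z j y)) +
        h / 2 * (q' * wdg (fwd u z i y) (bwd u z j y) +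
          q y * (wdg (drive a ν u f i y) (bwd u z j y) -
            wdg (fwd u z i y) (drive a ν u f j y)))) y := by
  refine ((hq.mul (hasDerivAt_wdg (hs.deriv_fwd i y) (hs.deriv_bwd j y))).const_mul
    (h / 2)).congr_deriv ?_
  have hk' : h = k⁻¹ := eq_inv_of_mul_eq_one_left hk
  have hk0 : k ≠ 0 := right_ne_zero_of_mul_eq_one hk
  rw [hk']
  simp only [dot, wdg, Complex.add_re, Complex.add_im, Complex.mul_re, Complex.mul_im,
    Complex.sub_re, Complex.sub_im, Complex.neg_re, Complex.neg_im, Complex.ofReal_re,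
    Complex.ofReal_im, Complex.I_re, Complex.I_im]
  field_simp
  ring

end

end BlochTorrey

/-! ### Weights admissible for averaging, and positivity of the Gaussian part -/

namespace BlochTorrey

open Set Filter Topology

/-- A weight whose product with `1 + |y|` and whose derivative are bounded by `K`. -/
def Mild (K : ℝ) (q : ℝ → ℝ) : Prop :=
  ∃ q' : ℝ → ℝ, ∀ y, HasDerivAt q (q' y) y ∧ |q y| * (1 + |y|) ≤ K ∧ |q' y| ≤ K

theorem Mild.add {K L : ℝ} {q r : ℝ → ℝ} (hq : Mild K q) (hr : Mild L r) :
    Mild (K + L) (fun y => q y + r y) := by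
  obtain ⟨q', hq⟩ := hq
  obtain ⟨r', hr⟩ := hr
  refine ⟨fun y => q' y + r' y, fun y => ⟨(hq y).1.add (hr y).1, ?_, ?_⟩⟩
  · have := abs_add_le (q y) (r y)
    nlinarith [(hq y).2.1, (hr y).2.1, abs_nonneg y]
  · exact (abs_add_le _ _).trans (add_le_add (hq y).2.2 (hr y).2.2)

theorem Mild.const_mul {K M c : ℝ} {q : ℝ → ℝ} (hq : Mild K q) (hc : |c| ≤ M) :
    Mild (M * K) (fun y => c * q y) := by
  obtain ⟨q', hq⟩ := hq
  refine ⟨fun y => c * q' y, fun y => ⟨(hq y).1.const_mul c, ?_, ?_⟩⟩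
  · rw [abs_mul, mul_assoc]
    have : 0 ≤ |q y| * (1 + |y|) := by positivity
    exact mul_le_mul hc (hq y).2.1 this ((abs_nonneg c).trans hc)
  · rw [abs_mul]
    exact mul_le_mul hc (hq y).2.2 (abs_nonneg _) ((abs_nonneg c).trans hc)

/-- A Gaussian weight and its product with `y` are mild. -/
theorem mild_of_gauss {K V σ τ : ℝ} {g : ℝ → ℝ} (hV : 2 ≤ V) (hσ : |σ| ≤ V) (hτ : |τ| ≤ V)
    (hg : ∀ y, HasDerivAt g ((σ + τ * y) * g y) y) (h0 : ∀ y, 0 < g y)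
    (hK : ∀ y, g y * (1 + |y|) ^ 2 ≤ K) :
    Mild (2 * V * K) g ∧ Mild (2 * V * K) (fun y => y * g y) := by
  have hst : ∀ y, |σ + τ * y| ≤ V * (1 + |y|) := fun y => by
    refine (abs_add_le _ _).trans ?_
    rw [abs_mul]
    nlinarith [abs_nonneg y, mul_le_mul_of_nonneg_right hτ (abs_nonneg y)]
  have hg1 : ∀ y, g y * (1 + |y|) ≤ K := fun y => by
    nlinarith [hK y, mul_nonneg (h0 y).le (abs_nonneg y), abs_nonneg y,
      mul_nonneg (mul_nonneg (h0 y).le (abs_nonneg y)) (abs_nonneg y)]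
  have hK0 : 0 ≤ K := le_trans (by have := h0 0; positivity) (hK 0)
  refine ⟨⟨_, fun y => ⟨hg y, ?_, ?_⟩⟩, ⟨fun y => 1 * g y + y * ((σ + τ * y) * g y), fun y =>
    ⟨(hasDerivAt_id y).mul (hg y), ?_, ?_⟩⟩⟩
  · rw [abs_of_pos (h0 y)]
    nlinarith [hg1 y]
  · rw [abs_mul, abs_of_pos (h0 y)]
    calc |σ + τ * y| * g y ≤ V * (1 + |y|) * g y := by
          gcongr; exacts [(h0 y).le, hst y]
      _ = V * (g y * (1 + |y|)) := by ring
      _ ≤ V * K := by gcongr; exact hg1 y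
      _ ≤ 2 * V * K := by nlinarith
  · rw [abs_mul, abs_of_pos (h0 y)]
    have : |y| * g y * (1 + |y|) ≤ g y * (1 + |y|) ^ 2 := by
      nlinarith [mul_nonneg (h0 y).le (abs_nonneg y), h0 y]
    nlinarith [hK y]
  · have h1 : |1 * g y + y * ((σ + τ * y) * g y)| ≤ g y + |y| * (V * (1 + |y|) * g y) := by
      refine (abs_add_le _ _).trans ?_
      rw [one_mul, abs_of_pos (h0 y), abs_mul, abs_mul, abs_of_pos (h0 y)]
      gcongr
      exacts [(h0 y).le, hst y]
    refine h1.trans ?_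
    have h2 : g y + |y| * (V * (1 + |y|) * g y) ≤ (1 + V) * (g y * (1 + |y|) ^ 2) := by
      have e1 : 0 ≤ |y| * g y := mul_nonneg (abs_nonneg y) (h0 y).le
      have e2 : 0 ≤ V * (g y * (1 + |y|)) := by have := h0 y; positivity
      have e3 : 0 ≤ |y| * (|y| * g y) := mul_nonneg (abs_nonneg y) e1
      nlinarith
    have h3 : (1 + V) * (g y * (1 + |y|) ^ 2) ≤ (1 + V) * K := by gcongr; exact hK y
    nlinarith

/-- Every entry combines the three Gaussians and their products with y. The factor 1 + |y| in `Mild`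
pays for the linear growth of `drive` when the mixed terms are averaged. -/
theorem exists_mild_mix (A : ℝ) : ∃ K : ℝ, 0 < K ∧ ∀ a ν ζ : ℝ, |a| ≤ A → |ν| ≤ A → |ζ| ≤ 1 →
    ∀ i j, Mild K (fun y => mix a ν ζ y i j) := by
  obtain ⟨K, hK1, hK⟩ := exists_gauss_bounds |A|
  set V : ℝ := 2 * |A| + 2
  have hA := abs_nonneg A
  set L : ℝ := 2 * V * K with hL
  have hL0 : 0 < L := by positivity
  refine ⟨6 * (V * V * L), by positivity, fun a ν ζ ha hν hζ => ?_⟩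
  have hAA := le_abs_self A
  have hA0 : 0 ≤ A := (abs_nonneg a).trans ha
  have hν' : |-ν| ≤ |A| := by rw [abs_neg]; exact hν.trans hAA
  have h2ν : |2 * ν| ≤ V := by rw [abs_mul, abs_two]; linarith
  have h2ν' : |2 * -ν| ≤ V := by rw [mul_neg, abs_neg]; exact h2ν
  have hR := mild_of_gauss (K := K) (V := V) (σ := 2 * ν) (τ := -1) (g := gaussR ν) (by grind)
    h2ν (by rw [abs_neg, abs_one]; grind)
    (fun y => (hasDerivAt_gaussR ν y).congr_deriv (by ring)) (gaussR_pos ν)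
    (fun y => (hK ν (hν.trans hAA) y).1)
  have hL := mild_of_gauss (K := K) (V := V) (σ := 2 * -ν) (τ := -1) (g := gaussR (-ν)) (by grind)
    h2ν' (by rw [abs_neg, abs_one]; grind)
    (fun y => (hasDerivAt_gaussR (-ν) y).congr_deriv (by ring)) (gaussR_pos (-ν))
    (fun y => (hK (-ν) hν' y).1)
  have hC := mild_of_gauss (K := K) (V := V) (σ := 0) (τ := -2) (g := gaussC) (by grind)
    (by simp; grind) (by rw [abs_neg, abs_two]; grind)
    (fun y => (hasDerivAt_gaussC y).congr_deriv (by ring)) gaussC_pos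
    (fun y => (hK ν (hν.trans hAA) y).2.1)
  have key : ∀ c₁ c₂ c₃ d₁ d₂ d₃ : ℝ, |c₁| ≤ V * V → |c₂| ≤ V * V → |c₃| ≤ V * V →
      |d₁| ≤ V * V → |d₂| ≤ V * V → |d₃| ≤ V * V →
      Mild (6 * (V * V * L)) (fun y => c₁ * gaussR ν y + c₂ * gaussR (-ν) y + c₃ * gaussC y +
        d₁ * (y * gaussR ν y) + d₂ * (y * gaussR (-ν) y) + d₃ * (y * gaussC y)) := by
    intro c₁ c₂ c₃ d₁ d₂ d₃ h₁ h₂ h₃ k₁ k₂ k₃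
    convert ((((((hR.1.const_mul h₁).add (hL.1.const_mul h₂)).add (hC.1.const_mul h₃)).add
      (hR.2.const_mul k₁)).add (hL.2.const_mul k₂)).add (hC.2.const_mul k₃)) using 1
    ring
  have hV2 : 2 ≤ V := by grind
  have b0 : |(0 : ℝ)| ≤ V * V := by rw [abs_zero]; positivity
  have b1 : |(1 : ℝ)| ≤ V * V := by rw [abs_one]; nlinarith
  have b1' : |(-1 : ℝ)| ≤ V * V := by rw [abs_neg]; exact b1
  have ba : |a| ≤ V * V := by nlinarith
  have bν : |ν| ≤ V * V := by nlinarith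
  have bν' : |-ν| ≤ V * V := by rw [abs_neg]; exact bν
  have bζ : |ζ| ≤ V * V := by nlinarith
  have bζ' : |-ζ| ≤ V * V := by rw [abs_neg]; exact bζ
  have baζ : |a * ζ| ≤ V * V := by
    rw [abs_mul]; nlinarith [abs_nonneg a, abs_nonneg ζ]
  have b2aζ : |2 * a * ζ| ≤ V * V := by
    rw [abs_mul, abs_mul, abs_two]; nlinarith [abs_nonneg a, abs_nonneg ζ]
  have bνζ : |-(ν * ζ)| ≤ V * V := by
    rw [abs_neg, abs_mul]; nlinarith [abs_nonneg ν, abs_nonneg ζ]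
  intro i j
  fin_cases i <;> fin_cases j
  · convert key a 0 (a * ζ) 0 0 0 ba b0 baζ b0 b0 b0 using 2 with y; simp [mix]; ring
  · convert key a a 0 0 0 0 ba ba b0 b0 b0 b0 using 2 with y; simp [mix]; ring
  · convert key (-ν) 0 (-(ν * ζ)) 0 0 ζ bν' b0 bνζ b0 b0 bζ using 2 with y; simp [mix]; ring
  · convert key 0 0 (2 * a * ζ) 0 0 0 b0 b0 b2aζ b0 b0 b0 using 2 with y; simp [mix]
  · convert key 0 a (a * ζ) 0 0 0 b0 ba baζ b0 b0 b0 using 2 with y; simp [mix]; ring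
  · convert key 0 (-ν) (-(ν * ζ)) 0 (-1) 0 b0 bν' bνζ b0 b1' b0 using 2 with y; simp [mix]; ring
  · convert key (-ν) 0 (-(ν * ζ)) 1 0 0 bν' b0 bνζ b1 b0 b0 using 2 with y; simp [mix]; ring
  · convert key 0 (-ν) (-(ν * ζ)) 0 0 (-ζ) b0 bν' bνζ b0 b0 bζ' using 2 with y; simp [mix]; ring
  · convert key a a (2 * a * ζ) 0 0 0 ba ba b2aζ b0 b0 b0 using 2 with y; simp [mix]; ring

/-- Positivity of the Gaussian part of the derivative. -/
theorem gauss_part_ge {a g c ζ s : ℝ} (ha : 0 < a) (hg : 0 < g) (hc : 0 < c) (hζ : 0 < ζ)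
    (h1 : 2 * (ζ * c) ≤ g) (h2 : ζ * (s ^ 2 * c) ≤ a ^ 2 * g) (p q r : ℂ) :
    a / 2 * (ζ * c) * (sq p + sq q + sq r) ≤
      a * g * (sq p + dot p q + sq r) + a * ζ * c * (sq q + dot p q + sq r) -
        ζ * c * s * dot r q - a / 2 * g * (2 * dot p q - sq r) := by
  -- The product p·q with weight g cancels between the first and the last bracket. Its copy with the
  -- small weight ζc is charged to |p|², which has weight g to spare, and to a quarter of |q|².
  have e1 : a * (ζ * c) * |dot p q| ≤ a * (ζ * c) * (sq p + 1 / 4 * sq q) := by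
    gcongr
    have := abs_dot_le (t := 2) two_pos p q
    linarith
  -- The unmatched residue takes a second quarter of |q|², so exactly half of it is left; the
  -- hypothesis `h2` lets |r|² pay for the rest.
  have e2 : ζ * c * s * dot r q ≤ a / 4 * (ζ * c) * sq q + a * g * sq r := by
    have h3 : ζ * c * s * dot r q ≤ ζ * c * (|s| * |dot r q|) := by
      rw [mul_assoc, ← abs_mul]
      gcongr
      exact le_abs_self _
    rcases eq_or_ne s 0 with rfl | hs
    · have := sq_nonneg' q
      have := sq_nonneg' r
      simp only [mul_zero, zero_mul]
      positivity
    · have hs' : 0 < |s| := abs_pos.mpr hs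
      have h4 := abs_dot_le (t := 2 * |s| / a) (by positivity) r q
      have h5 : |s| * |dot r q| ≤ s ^ 2 / a * sq r + a / 4 * sq q := by
        calc |s| * |dot r q| ≤ |s| * (2 * |s| / a / 2 * sq r + 1 / (2 * (2 * |s| / a)) * sq q) := by
              gcongr
          _ = |s| ^ 2 / a * sq r + a / 4 * sq q := by field_simp; ring
          _ = _ := by rw [sq_abs]
      have h6 : ζ * c * (s ^ 2 / a) ≤ a * g := by
        have : ζ * c * (s ^ 2 / a) = ζ * (s ^ 2 * c) / a := by ring
        rw [this, div_le_iff₀ ha]; linarith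
      calc ζ * c * s * dot r q ≤ ζ * c * (|s| * |dot r q|) := h3
        _ ≤ ζ * c * (s ^ 2 / a * sq r + a / 4 * sq q) := by gcongr
        _ = ζ * c * (s ^ 2 / a) * sq r + a / 4 * (ζ * c) * sq q := by ring
        _ ≤ a * g * sq r + a / 4 * (ζ * c) * sq q := by
            gcongr; exact sq_nonneg' r
        _ = _ := by ring
  have e3 : -(a * (ζ * c) * |dot p q|) ≤ a * (ζ * c) * dot p q := by
    rw [← mul_neg]; gcongr; exact neg_abs_le _
  have hp := sq_nonneg' p
  have hq := sq_nonneg' q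
  have hr := sq_nonneg' r
  have e4 : a * (2 * (ζ * c)) * sq p ≤ a * g * sq p := by gcongr
  have e5 : a * (2 * (ζ * c)) * sq r ≤ a * g * sq r := by gcongr
  have e6 : 0 ≤ a * (ζ * c) * sq q := by positivity
  have e7 : 0 ≤ a * (ζ * c) * sq p := by positivity
  have e8 : 0 ≤ a * (ζ * c) * sq r := by positivity
  linarith

end BlochTorrey

/-! ### Control far out, and pointwise bounds for the terms of the functional -/

namespace BlochTorrey

open Set Filter Topology

set_option maxHeartbeats 800000 in
/-- Far out the functional `funP` controls everything. -/
theorem exists_outer_part_ge {V : ℝ} (hV : 0 ≤ V) : ∃ c d : ℝ, 0 < c ∧ 0 < d ∧ c ≤ 1 ∧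
    ∀ a ν y : ℝ, |a| ≤ V → |ν| ≤ V → ∀ u z : Fin 3 → ℂ,
      d * ((1 + |y|) * (sq (u 0) + sq (u 1)) + sq (u 2)) ≤
        1 / 4 * gaussC y * (∑ j, sq (u j) + ∑ j, sq (z j)) +
          c * (gaussC y * (dot (z 0) (u 0) - dot (z 1) (u 1)) +
            primC y * (2 * y * (sq (u 0) + sq (u 1)) - 2 * ν * (sq (u 0) - sq (u 1)) +
              2 * a * (dot (u 2) (u 0) - dot (u 2) (u 1))) - 1 / 4 * formRe u u) := by
  -- `M` bounds what |u₀|² + |u₁|² loses: 4V to the term with ν, 64V² to the coupling with u₂, and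
  -- less than 1 to `formRe`.
  set M : ℝ := 4 * V + 64 * V ^ 2 + 1 with hM
  have hM1 : 1 ≤ M := by rw [hM]; nlinarith [sq_nonneg V]
  set κ : ℝ := gaussC (6 * M) with hκ
  have hκ0 : 0 < κ := gaussC_pos _
  have hκ1 : κ ≤ 1 := gaussC_le_one _
  -- For |y| ≤ 6M the loss cM = κ/16 is paid by `gaussC y` ≥ κ. For |y| ≥ 6M the confinement 2
  -- `primC y` y ≥ 2|y|/3 exceeds `M` by at least (1 + |y|)/4.
  set c : ℝ := κ / (16 * M) with hc
  have hc0 : 0 < c := by positivity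
  have hc1 : c ≤ 1 / 16 := by rw [hc, div_le_iff₀ (by positivity)]; nlinarith
  have hcM : c * M = κ / 16 := by rw [hc]; field_simp
  set d : ℝ := min (c / 8) (κ / (16 * (1 + 6 * M))) with hd
  have hd0 : 0 < d := by rw [hd]; positivity
  have hdc : d ≤ c / 8 := min_le_left _ _
  have hdκ : d * (1 + 6 * M) ≤ κ / 16 := by
    calc d * (1 + 6 * M) ≤ κ / (16 * (1 + 6 * M)) * (1 + 6 * M) := by
          gcongr; exact min_le_right _ _
      _ = _ := by field_simp
  refine ⟨c, d, hc0, hd0, by linarith, fun a ν y ha hν u z => ?_⟩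
  have s0 := sq_nonneg' (u 0)
  have s1 := sq_nonneg' (u 1)
  have s2 := sq_nonneg' (u 2)
  have t0 := sq_nonneg' (z 0)
  have t1 := sq_nonneg' (z 1)
  have t2 := sq_nonneg' (z 2)
  have hP := primC_abs_le y
  have hg := gaussC_pos y
  rw [Fin.sum_univ_three, Fin.sum_univ_three]
  set w := sq (u 0) + sq (u 1) with hw
  have hw0 : 0 ≤ w := by positivity
  have h1 : -(1 / 2 * gaussC y * (w + sq (z 0) + sq (z 1))) ≤
      gaussC y * (dot (z 0) (u 0) - dot (z 1) (u 1)) := by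
    have e0 := abs_le.mp (abs_dot_le one_pos (z 0) (u 0))
    have e1 := abs_le.mp (abs_dot_le one_pos (z 1) (u 1))
    have : -(1 / 2 * (w + sq (z 0) + sq (z 1))) ≤ dot (z 0) (u 0) - dot (z 1) (u 1) := by
      linarith [e0.1, e1.2]
    nlinarith
  have h2 : -(4 * V * w) ≤ primC y * (-2 * ν * (sq (u 0) - sq (u 1))) := by
    have e : |primC y * (-2 * ν * (sq (u 0) - sq (u 1)))| ≤ 2 * (2 * V * w) := by
      rw [abs_mul, abs_mul, abs_mul, abs_neg, abs_two]
      gcongr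
      exact abs_le.mpr ⟨by linarith, by linarith⟩
    linarith [(abs_le.mp e).1]
  have h3 : -(64 * V ^ 2 * w + 1 / 8 * sq (u 2)) ≤
      primC y * (2 * a * (dot (u 2) (u 0) - dot (u 2) (u 1))) := by
    have e : ∀ j, |primC y * (2 * a * dot (u 2) (u j))| ≤
        64 * V ^ 2 * sq (u j) + 1 / 16 * sq (u 2) := by
      intro j
      have e1 : |primC y * (2 * a * dot (u 2) (u j))| ≤ 2 * (2 * V * |dot (u 2) (u j)|) := by
        rw [abs_mul, abs_mul, abs_mul, abs_two]
        gcongr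
      refine e1.trans ?_
      rcases hV.eq_or_lt with h | h
      · rw [← h]
        have := sq_nonneg' (u j)
        simp only [mul_zero, zero_mul]
        positivity
      · have e2 := abs_dot_le (t := 1 / (32 * V)) (by positivity) (u 2) (u j)
        calc 2 * (2 * V * |dot (u 2) (u j)|) ≤ 2 * (2 * V * (1 / (32 * V) / 2 * sq (u 2) +
              1 / (2 * (1 / (32 * V))) * sq (u j))) := by gcongr
          _ = _ := by field_simp; ring
    have e0 := abs_le.mp (e 0)
    have e1 := abs_le.mp (e 1)
    have : primC y * (2 * a * (dot (u 2) (u 0) - dot (u 2) (u 1))) =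
      primC y * (2 * a * dot (u 2) (u 0)) - primC y * (2 * a * dot (u 2) (u 1)) := by ring
    rw [this]
    linarith [e0.1, e1.2]
  have h4 : -(1 / 4 * w) + 1 / 4 * sq (u 2) ≤ -(1 / 4 * formRe u u) := by
    have e := abs_le.mp (abs_dot_le one_pos (u 0) (u 1))
    have : dot (u 1) (u 0) = dot (u 0) (u 1) := by unfold dot; ring
    rw [formRe, this, dot_self]
    linarith [e.2]
  have h5 : c * (primC y * y * 2 * w - M * w + 1 / 8 * sq (u 2) -
      1 / 2 * gaussC y * (w + sq (z 0) + sq (z 1))) ≤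
      c * (gaussC y * (dot (z 0) (u 0) - dot (z 1) (u 1)) +
            primC y * (2 * y * w - 2 * ν * (sq (u 0) - sq (u 1)) +
              2 * a * (dot (u 2) (u 0) - dot (u 2) (u 1))) - 1 / 4 * formRe u u) := by
    refine mul_le_mul_of_nonneg_left ?_ hc0.le
    rw [hM]
    linarith
  have h6 : d * sq (u 2) ≤ c * (1 / 8 * sq (u 2)) := by nlinarith
  have h7 : d * ((1 + |y|) * w) ≤ 1 / 8 * gaussC y * w + c * (primC y * y * 2 * w - M * w) := by
    rcases le_total (6 * M) |y| with hy | hy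
    · have hp := le_primC_mul_self (y := y) (by linarith)
      have e1 : 1 / 4 * (1 + |y|) ≤ primC y * y * 2 - M := by linarith
      have e2 : c * (1 / 4 * (1 + |y|) * w) ≤ c * ((primC y * y * 2 - M) * w) := by gcongr
      have e3 : d * ((1 + |y|) * w) ≤ c / 8 * ((1 + |y|) * w) := by
        have : 0 ≤ |y| := abs_nonneg y
        gcongr
      have e4 : 0 ≤ gaussC y * w := by positivity
      have e5 : 0 ≤ c * ((1 + |y|) * w) := by positivity
      linarith
    · have hk : κ ≤ gaussC y := by
        rw [hκ, gaussC, gaussC, Real.exp_le_exp, ← sq_abs y]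
        exact neg_le_neg (pow_le_pow_left₀ (abs_nonneg y) hy 2)
      have e0 : 0 ≤ c * (primC y * y * 2 * w) := by
        have := primC_mul_self_nonneg y
        positivity
      have e1 : κ * w ≤ gaussC y * w := by gcongr
      have e2 : c * (M * w) = κ / 16 * w := by rw [← mul_assoc, hcM]
      have e3 : d * ((1 + |y|) * w) ≤ κ / 16 * w := by
        calc d * ((1 + |y|) * w) ≤ d * ((1 + 6 * M) * w) := by gcongr
          _ = d * (1 + 6 * M) * w := by ring
          _ ≤ _ := by gcongr
      linarith
  have h8 : 0 ≤ gaussC y * (sq (u 2) + sq (z 2)) := by positivity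
  have h9 : c * (1 / 2 * gaussC y * (w + sq (z 0) + sq (z 1))) ≤
      1 / 8 * (gaussC y * (w + sq (z 0) + sq (z 1))) := by
    have : 0 ≤ gaussC y * (w + sq (z 0) + sq (z 1)) := by positivity
    nlinarith
  have h10 : 0 ≤ gaussC y * (sq (z 0) + sq (z 1)) := by positivity
  linarith

noncomputable section

/-- The complete functional. -/
def funTotal (h a ν ζ c : ℝ) (u z : Fin 3 → ℝ → ℂ) (y : ℝ) : ℝ :=
  funH ν ζ (fwd u z) (bwd u z) y + funN h a ν u z y + c * ζ * a * funP u z y +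
    c * ζ * a / (8 * ν) * formRe (fun i => z i y) (fun i => u i y) +
    ∑ i, ∑ j, h / 2 * (mix a ν ζ y i j * wdg (fwd u z i y) (bwd u z j y))

end

theorem norm_le_sqrt_of_sq_le {x : ℂ} {S : ℝ} (h : sq x ≤ S) : ‖x‖ ≤ √S :=
  Real.le_sqrt_of_sq_le (by rwa [← sq_eq])

theorem abs_wdg_le_mul {x y : ℂ} {s t : ℝ} (hx : ‖x‖ ≤ s) (hy : ‖y‖ ≤ t) : |wdg x y| ≤ s * t :=
  (abs_wdg_le_norm x y).trans
    (mul_le_mul hx hy (norm_nonneg _) ((norm_nonneg _).trans hx))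

theorem abs_dot_le_mul {x y : ℂ} {s t : ℝ} (hx : ‖x‖ ≤ s) (hy : ‖y‖ ≤ t) : |dot x y| ≤ s * t :=
  (abs_dot_le_norm x y).trans
    (mul_le_mul hx hy (norm_nonneg _) ((norm_nonneg _).trans hx))

theorem abs_formRe_le {u v : Fin 3 → ℂ} {s t : ℝ} (hu : ∀ i, ‖u i‖ ≤ s) (hv : ∀ i, ‖v i‖ ≤ t) :
    |formRe u v| ≤ 3 * (s * t) := by
  have h1 := abs_le.mp (abs_dot_le_mul (hu 0) (hv 1))
  have h2 := abs_le.mp (abs_dot_le_mul (hu 1) (hv 0))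
  have h3 := abs_le.mp (abs_dot_le_mul (hu 2) (hv 2))
  rw [formRe, abs_le]
  constructor <;> linarith [h1.1, h1.2, h2.1, h2.2, h3.1, h3.2]

theorem abs_formIm_le {u v : Fin 3 → ℂ} {s t : ℝ} (hu : ∀ i, ‖u i‖ ≤ s) (hv : ∀ i, ‖v i‖ ≤ t) :
    |formIm u v| ≤ 3 * (s * t) := by
  have h1 := abs_le.mp (abs_wdg_le_mul (hu 0) (hv 1))
  have h2 := abs_le.mp (abs_wdg_le_mul (hu 1) (hv 0))
  have h3 := abs_le.mp (abs_wdg_le_mul (hu 2) (hv 2))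
  rw [formIm, abs_le]
  constructor <;> linarith [h1.1, h1.2, h2.1, h2.2, h3.1, h3.2]

theorem abs_skew_le {V a : ℝ} (y : ℝ) {s : ℝ} {u : Fin 3 → ℂ} (ha : |a| ≤ V)
    (hu : ∀ i, ‖u i‖ ≤ s) :
    |skew a y u| ≤ (1 + 4 * V) * ((1 + |y|) * (sq (u 0) + sq (u 1)) + s ^ 2) := by
  have hV : 0 ≤ V := (abs_nonneg a).trans ha
  have hs : 0 ≤ s := (norm_nonneg _).trans (hu 0)
  have h1 : |-2 * y * wdg (u 0) (u 1)| ≤ |y| * (sq (u 0) + sq (u 1)) := by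
    rw [abs_mul, abs_mul, abs_neg, abs_two]
    have := abs_wdg_le one_pos (u 0) (u 1)
    nlinarith [abs_nonneg y]
  have h2 : |2 * a * wdg (u 2) (u 0 + u 1)| ≤ 4 * V * s ^ 2 := by
    rw [abs_mul, abs_mul, abs_two]
    have h3 : ‖u 0 + u 1‖ ≤ 2 * s := (norm_add_le _ _).trans (by linarith [hu 0, hu 1])
    calc 2 * |a| * |wdg (u 2) (u 0 + u 1)| ≤ 2 * V * (s * (2 * s)) := by
          gcongr; exact abs_wdg_le_mul (hu 2) h3
      _ = _ := by ring
  have h4 : 0 ≤ (1 + |y|) * (sq (u 0) + sq (u 1)) := by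
    have := sq_nonneg' (u 0); have := sq_nonneg' (u 1); positivity
  have h5 := sq_nonneg' (u 0)
  have h6 := sq_nonneg' (u 1)
  rw [skew]
  refine (abs_sub _ _).trans ?_
  nlinarith [mul_nonneg hV h4, sq_nonneg s]

theorem abs_mul_le_mul' {q w K S : ℝ} (hq : |q| ≤ K) (hw : |w| ≤ S) : |q * w| ≤ K * S := by
  rw [abs_mul]
  exact mul_le_mul hq hw (abs_nonneg _) ((abs_nonneg _).trans hq)

theorem norm_drive_le {V a ν : ℝ} {u f : Fin 3 → ℝ → ℂ} {y s : ℝ} (ha : |a| ≤ V) (hν : |ν| ≤ V)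
    (hu : ∀ i, ‖u i y‖ ≤ s) (hf : ∀ i, ‖f i y‖ ≤ s) (j : Fin 3) :
    ‖drive a ν u f j y‖ ≤ (3 * V + 2) * (1 + |y|) * s := by
  have hs : 0 ≤ s := (norm_nonneg _).trans (hu 0)
  have hV : 0 ≤ V := (abs_nonneg a).trans ha
  have hy := abs_nonneg y
  have n1 : ∀ (c : ℝ) {C : ℝ} (i : Fin 3), |c| ≤ C → ‖(c : ℂ) * u i y‖ ≤ C * s := by
    intro c C i hc
    rw [norm_mul, Complex.norm_real, Real.norm_eq_abs]
    exact mul_le_mul hc (hu i) (norm_nonneg _) ((abs_nonneg _).trans hc)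
  have n2 : ‖Complex.I * f j y‖ ≤ s := by
    rw [norm_mul, Complex.norm_I, one_mul]; exact hf j
  have n3 : |y - ν| ≤ |y| + V := (abs_sub _ _).trans (by gcongr)
  have n4 : |-y - ν| ≤ |y| + V := (abs_sub _ _).trans (by rw [abs_neg]; gcongr)
  have key : (|y| + V) * s + V * s + V * s + s ≤ (3 * V + 2) * (1 + |y|) * s := by
    nlinarith [mul_nonneg hy hs, mul_nonneg (mul_nonneg hV hy) hs]
  have hVs : 0 ≤ V * s := by positivity
  have hys : 0 ≤ |y| * s := by positivity
  refine (norm_add_le _ _).trans (le_trans (add_le_add ?_ n2) key)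
  fin_cases j
  · simp only [mulM, Matrix.cons_val_zero, Fin.zero_eta]
    refine (norm_add_le _ _).trans ?_
    linarith [n1 (y - ν) 0 n3, n1 a 2 ha]
  · simp only [mulM, Matrix.cons_val_one, Fin.mk_one, Matrix.cons_val_zero]
    refine (norm_add_le _ _).trans ?_
    linarith [n1 (-y - ν) 1 n4, n1 a 2 ha]
  · simp only [mulM, Fin.reduceFinMk, Matrix.cons_val, mul_add]
    refine (norm_sub_le _ _).trans (le_trans (add_le_add_left (norm_add_le _ _) _) ?_)
    linarith [n1 a 0 ha, n1 a 1 ha, n1 ν 2 hν]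

end BlochTorrey

/-! ### Lower bound for the derivative of the complete functional -/

namespace BlochTorrey

open Set Filter Topology

theorem sum_sq_fwd_bwd (u z : Fin 3 → ℝ → ℂ) (y : ℝ) :
    ∑ j, sq (fwd u z j y) + ∑ j, sq (bwd u z j y) =
      1 / 2 * (∑ j, sq (u j y) + ∑ j, sq (z j y)) := by
  rw [← Finset.sum_add_distrib, ← Finset.sum_add_distrib, Finset.mul_sum]
  refine Finset.sum_congr rfl fun j _ => ?_
  simp only [fwd, bwd, sq, Complex.re_ofReal_mul, Complex.im_ofReal_mul, Complex.add_re,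
    Complex.add_im, Complex.sub_re, Complex.sub_im]
  ring

theorem norm_fwd_le {u z : Fin 3 → ℝ → ℂ} {y s : ℝ} (hu : ∀ i, ‖u i y‖ ≤ s)
    (hz : ∀ i, ‖z i y‖ ≤ s) (j : Fin 3) : ‖fwd u z j y‖ ≤ s := by
  rw [fwd, norm_mul, Complex.norm_real]
  have := norm_add_le (u j y) (z j y)
  norm_num
  linarith [hu j, hz j]

theorem norm_bwd_le {u z : Fin 3 → ℝ → ℂ} {y s : ℝ} (hu : ∀ i, ‖u i y‖ ≤ s)
    (hz : ∀ i, ‖z i y‖ ≤ s) (j : Fin 3) : ‖bwd u z j y‖ ≤ s := by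
  rw [bwd, norm_mul, Complex.norm_real]
  have := norm_sub_le (u j y) (z j y)
  norm_num
  linarith [hu j, hz j]

theorem abs_srcH_le {K ν ζ y s t : ℝ} {A B f : Fin 3 → ℂ} (h1 : gaussR ν y ≤ K)
    (h2 : gaussR (-ν) y ≤ K) (h3 : gaussC y ≤ K) (hζ : |ζ| ≤ 1) (hA : ∀ i, ‖A i‖ ≤ s)
    (hB : ∀ i, ‖B i‖ ≤ s) (hf : ∀ i, ‖f i‖ ≤ t) :
    |srcH ν ζ y A B f| ≤ 8 * K * (t * s) := by
  have hC0 := gaussC_pos y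
  have g1 : |gaussR ν y| ≤ K := by rwa [abs_of_pos (gaussR_pos ν y)]
  have g2 : |gaussR (-ν) y| ≤ K := by rwa [abs_of_pos (gaussR_pos (-ν) y)]
  have g3 : |ζ * gaussC y| ≤ K := by
    rw [abs_mul, abs_of_pos hC0]; nlinarith [abs_nonneg ζ]
  have wA : ∀ i j, |wdg (f i) (A j)| ≤ t * s := fun i j => abs_wdg_le_mul (hf i) (hA j)
  have wB : ∀ i j, |wdg (f i) (B j)| ≤ t * s := fun i j => abs_wdg_le_mul (hf i) (hB j)
  have e1 : |wdg (f 2) (A 0) + wdg (f 0) (A 2)| ≤ 2 * (t * s) :=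
    (abs_add_le _ _).trans (by linarith [wA 2 0, wA 0 2])
  have e2 : |wdg (f 2) (B 1) + wdg (f 1) (B 2)| ≤ 2 * (t * s) :=
    (abs_add_le _ _).trans (by linarith [wB 2 1, wB 1 2])
  have e3 : |wdg (f 2) (A 1) + wdg (f 1) (A 2) + wdg (f 2) (B 0) + wdg (f 0) (B 2)| ≤
      4 * (t * s) := by
    refine (abs_add_le _ _).trans ?_
    refine (add_le_add_left (abs_add_le _ _) _).trans ?_
    refine (add_le_add_left (add_le_add_left (abs_add_le _ _) _) _).trans ?_
    linarith [wA 2 1, wA 1 2, wB 2 0, wB 0 2]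
  rw [srcH]
  refine (abs_add_le _ _).trans ((add_le_add_left (abs_add_le _ _) _).trans ?_)
  linarith [abs_mul_le_mul' g1 e1, abs_mul_le_mul' g2 e2, abs_mul_le_mul' g3 e3]

/-- The terms of lower order in the derivative of `funN`. -/
theorem abs_funN_error_le {K V a ν y s W : ℝ} {u z : Fin 3 → ℂ} (hK : 1 ≤ K) (hV : 1 ≤ V)
    (ha : |a| ≤ V)
    (hν : |ν| ≤ V) (h1 : |gaussR ν y| ≤ K) (h2 : |gaussR (-ν) y| ≤ K) (h3 : |tailE a ν y| ≤ V * K)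
    (h4 : |tailO a ν y| ≤ V * K) (hu : ∀ i, ‖u i‖ ≤ s) (hz : ∀ i, ‖z i‖ ≤ s)
    (hW : (1 + |y|) * (sq (u 0) + sq (u 1)) + s ^ 2 ≤ W) :
    |2 * ν * tailE a ν y * skew a y u -
          ν * (2 * ν * tailO a ν y - a / 4 * (gaussR ν y - gaussR (-ν) y)) * formIm u z -
          2 * tailO a ν y * wdg (u 0) (u 1) +
          (2 * ν * tailE a ν y - a / 4 * (gaussR ν y + gaussR (-ν) y)) * skew a y u| ≤
      40 * V ^ 3 * K * W := by
  have hsk := abs_skew_le y ha hu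
  have hW1 : s ^ 2 ≤ W := by
    have := sq_nonneg' (u 0); have := sq_nonneg' (u 1)
    have : 0 ≤ (1 + |y|) * (sq (u 0) + sq (u 1)) := by positivity
    linarith
  have hsk' : |skew a y u| ≤ 5 * V * W := by
    refine hsk.trans ?_
    have : 0 ≤ W := (sq_nonneg s).trans hW1
    calc (1 + 4 * V) * ((1 + |y|) * (sq (u 0) + sq (u 1)) + s ^ 2) ≤ (1 + 4 * V) * W := by gcongr
      _ ≤ _ := by nlinarith
  have hfi : |formIm u z| ≤ 3 * W := by
    refine (abs_formIm_le hu hz).trans ?_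
    nlinarith
  have hw : |wdg (u 0) (u 1)| ≤ W := (abs_wdg_le_mul (hu 0) (hu 1)).trans (by nlinarith)
  have c1 : |2 * ν * tailE a ν y| ≤ 2 * V * (V * K) := by
    refine abs_mul_le_mul' ?_ h3
    rw [abs_mul, abs_two]; linarith
  have c2 : |2 * ν * tailO a ν y| ≤ 2 * V * (V * K) := by
    refine abs_mul_le_mul' ?_ h4
    rw [abs_mul, abs_two]; linarith
  have c3 : |a / 4| ≤ V / 4 := by rw [abs_div]; norm_num; linarith
  have c4 : |a / 4 * (gaussR ν y - gaussR (-ν) y)| ≤ V / 4 * (2 * K) :=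
    abs_mul_le_mul' c3 ((abs_sub _ _).trans (by linarith))
  have c5 : |a / 4 * (gaussR ν y + gaussR (-ν) y)| ≤ V / 4 * (2 * K) :=
    abs_mul_le_mul' c3 ((abs_add_le _ _).trans (by linarith))
  have d1 := abs_mul_le_mul' c1 hsk'
  have d2 := abs_mul_le_mul' (abs_mul_le_mul' hν
    ((abs_sub (2 * ν * tailO a ν y) (a / 4 * (gaussR ν y - gaussR (-ν) y))).trans
      (add_le_add c2 c4))) hfi
  have d3 : |2 * tailO a ν y * wdg (u 0) (u 1)| ≤ 2 * (V * K) * W := by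
    refine abs_mul_le_mul' ?_ hw
    rw [abs_mul, abs_two]; linarith
  have d4 := abs_mul_le_mul' ((abs_sub (2 * ν * tailE a ν y)
    (a / 4 * (gaussR ν y + gaussR (-ν) y))).trans (add_le_add c1 c5)) hsk'
  refine (abs_add_le _ _).trans ((add_le_add_left ((abs_sub _ _).trans
    (add_le_add_left (abs_sub _ _) _)) _).trans ?_)
  have hW0 : 0 ≤ W := (sq_nonneg s).trans hW1
  have hKW : 0 ≤ K * W := by positivity
  have p1 : V * (K * W) ≤ V ^ 3 * (K * W) := by
    gcongr; exact le_self_pow₀ hV (by norm_num)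
  have p2 : V ^ 2 * (K * W) ≤ V ^ 3 * (K * W) := by
    exact mul_le_mul_of_nonneg_right (pow_le_pow_right₀ hV (by norm_num)) hKW
  have p3 : 0 ≤ V ^ 3 * (K * W) := by positivity
  linarith

/-- The averaging corrections cancel the mixed terms identically, so only contributions with a
factor h remain; the 9 counts the pairs (i, j). -/
theorem mix_error_ge {L V a ν h s y : ℝ} {u z f : Fin 3 → ℝ → ℂ} {q q' : Fin 3 → Fin 3 → ℝ}
    (hh : 0 ≤ h) (ha : |a| ≤ V) (hν : |ν| ≤ V) (hu : ∀ i, ‖u i y‖ ≤ s) (hz : ∀ i, ‖z i y‖ ≤ s)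
    (hf : ∀ i, ‖f i y‖ ≤ s) (hq : ∀ i j, |q i j| * (1 + |y|) ≤ L ∧ |q' i j| ≤ L) :
    -(h * (9 * (1 + 2 * (3 * V + 2)) * L) * s ^ 2) ≤
      ∑ i, ∑ j, q i j * dot (fwd u z i y) (bwd u z j y) +
      ∑ i, ∑ j, (-(q i j * dot (fwd u z i y) (bwd u z j y)) +
        h / 2 * (q' i j * wdg (fwd u z i y) (bwd u z j y) +
          q i j * (wdg (drive a ν u f i y) (bwd u z j y) -
            wdg (fwd u z i y) (drive a ν u f j y)))) := by
  have hV : 0 ≤ V := (abs_nonneg a).trans ha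
  have hL : 0 ≤ L := (abs_nonneg _).trans (hq 0 0).2
  have hA := norm_fwd_le hu hz
  have hB := norm_bwd_le hu hz
  have hX := norm_drive_le ha hν hu hf
  have e : ∀ i j, -(h * ((1 + 2 * (3 * V + 2)) * L) * s ^ 2) ≤
      h / 2 * (q' i j * wdg (fwd u z i y) (bwd u z j y) +
        q i j * (wdg (drive a ν u f i y) (bwd u z j y) -
          wdg (fwd u z i y) (drive a ν u f j y))) := by
    intro i j
    have e1 : |q' i j * wdg (fwd u z i y) (bwd u z j y)| ≤ L * (s * s) :=
      abs_mul_le_mul' (hq i j).2 (abs_wdg_le_mul (hA i) (hB j))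
    have e2 : |q i j * (wdg (drive a ν u f i y) (bwd u z j y) -
          wdg (fwd u z i y) (drive a ν u f j y))| ≤ 2 * (3 * V + 2) * L * (s * s) := by
      have e4 := abs_wdg_le_mul (hX i) (hB j)
      have e5 := abs_wdg_le_mul (hA i) (hX j)
      rw [abs_mul]
      calc |q i j| * |wdg (drive a ν u f i y) (bwd u z j y) -
              wdg (fwd u z i y) (drive a ν u f j y)| ≤
            |q i j| * ((3 * V + 2) * (1 + |y|) * s * s + s * ((3 * V + 2) * (1 + |y|) * s)) := by
              gcongr; exact (abs_sub _ _).trans (add_le_add e4 e5)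
        _ = |q i j| * (1 + |y|) * (2 * (3 * V + 2) * (s * s)) := by ring
        _ ≤ L * (2 * (3 * V + 2) * (s * s)) := by
          have := mul_self_nonneg s
          gcongr; exact (hq i j).1
        _ = _ := by ring
    have e5 : -((1 + 2 * (3 * V + 2)) * L * s ^ 2) ≤
        q' i j * wdg (fwd u z i y) (bwd u z j y) +
        q i j * (wdg (drive a ν u f i y) (bwd u z j y) -
          wdg (fwd u z i y) (drive a ν u f j y)) := by
      linarith [(abs_le.mp e1).1, (abs_le.mp e2).1]
    have e6 := mul_le_mul_of_nonneg_left e5 (by positivity : 0 ≤ h / 2)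
    have e7 : 0 ≤ h / 2 * ((1 + 2 * (3 * V + 2)) * L * s ^ 2) := by positivity
    linarith
  have e' := Finset.sum_le_sum fun i (_ : i ∈ Finset.univ) =>
    Finset.sum_le_sum fun j (_ : j ∈ Finset.univ) => e i j
  simp only [← Finset.sum_add_distrib, add_neg_cancel_left]
  refine le_trans (le_of_eq ?_) e'
  simp only [Finset.sum_const, Finset.card_univ, Fintype.card_fin, nsmul_eq_mul]
  push_cast
  ring

/-- The source terms in the derivative of `funTotal`. -/
theorem abs_source_le {K V a ν h ζ c y s t : ℝ} {u z f A B : Fin 3 → ℂ} (hK : 1 ≤ K)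
    (hV : 1 ≤ V) (ha : 0 ≤ a) (haV : a ≤ V) (hν : 0 < ν) (hνV : ν ≤ V) (hh : 0 ≤ h) (hh1 : h ≤ 1)
    (hζ : 0 ≤ ζ) (hζa : ζ ≤ a ^ 2) (hζ1 : ζ ≤ 1) (hc : 0 ≤ c) (hc1 : c ≤ 1)
    (h1 : gaussR ν y ≤ K) (h2 : gaussR (-ν) y ≤ K) (h3 : gaussC y ≤ K)
    (h4 : |tailE a ν y| ≤ V * K) (h5 : |tailO a ν y| ≤ V * K) (hu : ∀ i, ‖u i‖ ≤ s)
    (hz : ∀ i, ‖z i‖ ≤ s) (hA : ∀ i, ‖A i‖ ≤ s) (hB : ∀ i, ‖B i‖ ≤ s) (hf : ∀ i, ‖f i‖ ≤ t) :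
    |srcH ν ζ y A B f + (-2 * tailE a ν y * formIm f u - 2 * tailO a ν y * formIm f z +
        2 * h * ν * tailE a ν y * formRe u f) +
      c * ζ * a * (2 * primC y * (wdg (f 0) (u 0) - wdg (f 1) (u 1))) +
      c * ζ * a / (8 * ν) * (-(2 * formIm f u))| ≤
      100 * V ^ 2 * K * (1 + a ^ 3 / ν) * (t * s) := by
  have hs : 0 ≤ s := (norm_nonneg _).trans (hu 0)
  have ht : 0 ≤ t := (norm_nonneg _).trans (hf 0)
  have hts : 0 ≤ t * s := by positivity
  have e1 := abs_srcH_le (f := f) h1 h2 h3 (by rwa [abs_of_nonneg hζ]) hA hB hf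
  have hfu := abs_formIm_le hf hu
  have hfz := abs_formIm_le hf hz
  have huf := abs_formRe_le hu hf
  have e2 : |-2 * tailE a ν y * formIm f u| ≤ 2 * (V * K) * (3 * (t * s)) := by
    refine abs_mul_le_mul' ?_ hfu
    rw [abs_mul, abs_neg, abs_two]; linarith
  have e3 : |2 * tailO a ν y * formIm f z| ≤ 2 * (V * K) * (3 * (t * s)) := by
    refine abs_mul_le_mul' ?_ hfz
    rw [abs_mul, abs_two]; linarith
  have e4 : |2 * h * ν * tailE a ν y * formRe u f| ≤ 2 * 1 * V * (V * K) * (3 * (s * t)) := by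
    refine abs_mul_le_mul' (abs_mul_le_mul' ?_ h4) huf
    rw [abs_mul, abs_mul, abs_two, abs_of_nonneg hh, abs_of_pos hν]
    gcongr
  have hcζ : c * ζ * a ≤ 1 * 1 * V := by gcongr
  have hcζ0 : 0 ≤ c * ζ * a := by positivity
  have e5 : |c * ζ * a * (2 * primC y * (wdg (f 0) (u 0) - wdg (f 1) (u 1)))| ≤
      1 * 1 * V * (2 * 2 * (2 * (t * s))) := by
    refine abs_mul_le_mul' (by rwa [abs_of_nonneg hcζ0]) (abs_mul_le_mul' ?_ ?_)
    · rw [abs_mul, abs_two]; linarith [primC_abs_le y]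
    · have w0 := abs_wdg_le_mul (hf 0) (hu 0)
      have w1 := abs_wdg_le_mul (hf 1) (hu 1)
      exact (abs_sub _ _).trans (by linarith)
  have e6 : |c * ζ * a / (8 * ν) * (-(2 * formIm f u))| ≤ a ^ 3 / (8 * ν) * (6 * (t * s)) := by
    refine abs_mul_le_mul' ?_ ?_
    · rw [abs_of_nonneg (by positivity)]
      gcongr
      nlinarith [mul_nonneg hζ ha, mul_le_mul_of_nonneg_right hζa ha,
        mul_le_mul_of_nonneg_right hc1 (mul_nonneg hζ ha)]
    · rw [abs_neg, abs_mul, abs_two]; linarith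
  have e7 : a ^ 3 / (8 * ν) * (6 * (t * s)) ≤ 1 * (a ^ 3 / ν * (t * s)) := by
    have : 0 ≤ a ^ 3 / ν * (t * s) := by positivity
    have e : a ^ 3 / (8 * ν) * (6 * (t * s)) = 6 / 8 * (a ^ 3 / ν * (t * s)) := by
      field_simp
    rw [e]; linarith
  have hV2 : 1 ≤ V ^ 2 := one_le_pow₀ hV
  have k1 : K ≤ V ^ 2 * K := by nlinarith
  have k2 : V ≤ V ^ 2 * K := by nlinarith
  have k3 : V * K ≤ V ^ 2 * K := by nlinarith
  have k4 : 1 * (a ^ 3 / ν * (t * s)) ≤ 100 * V ^ 2 * K * (a ^ 3 / ν * (t * s)) := by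
    gcongr; linarith
  have k5 := mul_le_mul_of_nonneg_right k1 hts
  have k6 := mul_le_mul_of_nonneg_right k2 hts
  have k7 := mul_le_mul_of_nonneg_right k3 hts
  have k8 : 0 ≤ V ^ 2 * K * (t * s) := by positivity
  refine (abs_add_le _ _).trans ((add_le_add_left ((abs_add_le _ _).trans (add_le_add_left
    ((abs_add_le _ _).trans (add_le_add_right ((abs_add_le _ _).trans
      (add_le_add_left (abs_sub _ _) _)) _)) _)) _).trans ?_)
  linarith

theorem le_of_mul_one_add_abs_sq_le {g y K : ℝ} (hg : 0 ≤ g) (h : g * (1 + |y|) ^ 2 ≤ K) :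
    g ≤ K :=
  (le_mul_of_one_le_right hg (one_le_pow₀ (by linarith [abs_nonneg y]))).trans h

theorem abs_tail_le {K V a ν y : ℝ} (ha : 0 ≤ a) (haV : a ≤ V) (h1 : tailR ν y ≤ K)
    (h2 : tailR ν (-y) ≤ K) : |tailE a ν y| ≤ V * K ∧ |tailO a ν y| ≤ V * K := by
  have t1 := tailR_nonneg ν y
  have t2 := tailR_nonneg ν (-y)
  have ha4 : |a / 4| ≤ V / 4 := by rw [abs_of_nonneg (by positivity)]; linarith
  have hVK : 0 ≤ V * K := mul_nonneg (ha.trans haV) (t1.trans h1)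
  refine ⟨(abs_mul_le_mul' (S := 2 * K) ha4 ?_).trans (by linarith),
    (abs_mul_le_mul' (S := 2 * K) ha4 ?_).trans (by linarith)⟩ <;> rw [abs_le] <;>
  constructor <;> linarith

/-- The combination of all positive terms. -/
theorem positive_part_ge {K V a ν ζ d y : ℝ} (u z : Fin 3 → ℝ → ℂ) (ha : 0 < a) (hζ : 0 < ζ)
    (hζK : 2 * (ζ * K) ≤ 1) (hζK2 : ζ * K ≤ a ^ 2)
    (k4 : gaussC y ≤ K * gaussR ν y) (k5 : (3 * y + 2 * ν) ^ 2 * gaussC y ≤ K * gaussR ν y)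
    (l4 : gaussC y ≤ K * gaussR (-ν) y)
    (l5 : (3 * y + 2 * -ν) ^ 2 * gaussC y ≤ K * gaussR (-ν) y)
    (hout : d * ((1 + |y|) * (sq (u 0 y) + sq (u 1 y)) + sq (u 2 y)) ≤
        1 / 4 * gaussC y * (∑ j, sq (u j y) + ∑ j, sq (z j y)) + V) :
    a * ζ * (d * ((1 + |y|) * (sq (u 0 y) + sq (u 1 y)) + sq (u 2 y))) ≤
      a * gaussR ν y * (sq (fwd u z 0 y) + dot (fwd u z 0 y) (fwd u z 1 y) + sq (fwd u z 2 y)) +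
        a * gaussR (-ν) y *
          (sq (bwd u z 1 y) + dot (bwd u z 0 y) (bwd u z 1 y) + sq (bwd u z 2 y)) +
        a * ζ * gaussC y * (sq (fwd u z 1 y) + dot (fwd u z 0 y) (fwd u z 1 y) +
          sq (fwd u z 2 y) + sq (bwd u z 0 y) + dot (bwd u z 0 y) (bwd u z 1 y) +
          sq (bwd u z 2 y)) -
        ζ * gaussC y * ((3 * y + 2 * ν) * dot (fwd u z 2 y) (fwd u z 1 y) -
          (3 * y - 2 * ν) * dot (bwd u z 2 y) (bwd u z 0 y)) -
        a / 2 * gaussR ν y * formRe (fun i => fwd u z i y) (fun i => fwd u z i y) -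
        a / 2 * gaussR (-ν) y * formRe (fun i => bwd u z i y) (fun i => bwd u z i y) +
        a * ζ * V := by
  have hC0 := gaussC_pos y
  have p1 : ∀ g, 0 < g → gaussC y ≤ K * g → 2 * (ζ * gaussC y) ≤ g := fun g hg0 hg => by
    calc 2 * (ζ * gaussC y) ≤ 2 * (ζ * (K * g)) := by gcongr
      _ = 2 * (ζ * K) * g := by ring
      _ ≤ 1 * g := by gcongr
      _ = g := one_mul g
  have p2 : ∀ g t, 0 < g → t ≤ K * g → ζ * t ≤ a ^ 2 * g := fun g t hg0 hg => by
    calc ζ * t ≤ ζ * (K * g) := by gcongr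
      _ = ζ * K * g := by ring
      _ ≤ a ^ 2 * g := by gcongr
  have hA := gauss_part_ge ha (gaussR_pos ν y) hC0 hζ (p1 _ (gaussR_pos ν y) k4)
    (p2 _ _ (gaussR_pos ν y) k5) (fwd u z 0 y) (fwd u z 1 y) (fwd u z 2 y)
  -- The backward part is the mirror image of the forward one: the first two components are
  -- exchanged and ν changes sign in the weight.
  have hB := gauss_part_ge (s := -(3 * y - 2 * ν)) ha (gaussR_pos (-ν) y) hC0 hζ
    (p1 _ (gaussR_pos (-ν) y) l4)
    (p2 _ _ (gaussR_pos (-ν) y) (by rw [neg_sq]; convert l5 using 3; ring))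
    (bwd u z 1 y) (bwd u z 0 y) (bwd u z 2 y)
  have hdc : ∀ p q : ℂ, dot p q = dot q p := fun p q => by unfold dot; ring
  have hAB := sum_sq_fwd_bwd u z y
  rw [Fin.sum_univ_three, Fin.sum_univ_three] at hAB
  have hO := mul_le_mul_of_nonneg_left hout (mul_pos ha hζ).le
  have hform : ∀ v : Fin 3 → ℂ, formRe v v = 2 * dot (v 0) (v 1) - sq (v 2) := fun v => by
    rw [formRe, hdc (v 1), dot_self]; ring
  rw [hdc (bwd u z 1 y)] at hB
  rw [hform (fun i => fwd u z i y), hform (fun i => bwd u z i y)]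
  -- Since |A|² + |B|² is half of |u|² + |z|², the Gaussian gain is exactly the term with factor 1/4
  -- consumed by the outer estimate.
  have e9 : a / 2 * (ζ * gaussC y) * (sq (fwd u z 0 y) + sq (fwd u z 1 y) + sq (fwd u z 2 y)) +
      a / 2 * (ζ * gaussC y) * (sq (bwd u z 1 y) + sq (bwd u z 0 y) + sq (bwd u z 2 y)) =
      a * ζ * (1 / 4 * gaussC y * (∑ j, sq (u j y) + ∑ j, sq (z j y))) := by
    linear_combination (a / 2 * (ζ * gaussC y)) * hAB
  linarith only [hA, hB, hO, e9]

-- The gain has size a³ because it carries aζ, and ζ = ba² is the size for which the unmatched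
-- `gaussC` terms can be absorbed. Averaging costs O(h). The source carries 1 + a³/ν because the
-- multiple of `formRe` that controls u₂ has a coefficient proportional to a³/ν. The gain contains
-- no |z|²; this is recovered after integration.
set_option maxHeartbeats 800000 in
theorem exists_funTotal_deriv_ge {V : ℝ} (hV : 1 ≤ V) : ∃ b c d K : ℝ, 0 < b ∧ 0 < c ∧ 0 < d ∧
    0 < K ∧ b * V ^ 2 ≤ 1 ∧ ∀ (a ν h k : ℝ) (u z f : Fin 3 → ℝ → ℂ), 0 < a → a ≤ V → 0 < ν → ν ≤ V → 0 < h →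
      h ≤ 1 → h * k = 1 → SemiSystem k a ν u z f → ∃ F' : ℝ → ℝ, ∀ y,
        HasDerivAt (funTotal h a ν (b * a ^ 2) c u z) (F' y) y ∧
        d * a ^ 3 * ((1 + |y|) * (sq (u 0 y) + sq (u 1 y)) + sq (u 2 y)) -
          h * K * ((1 + |y|) * (sq (u 0 y) + sq (u 1 y)) +
            (∑ j, sq (u j y) + ∑ j, sq (z j y)) + ∑ j, sq (f j y)) -
          K * (1 + a ^ 3 / ν) *
            (√(∑ j, sq (f j y)) * √(∑ j, sq (u j y) + ∑ j, sq (z j y))) ≤ F' y := by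
  obtain ⟨K, hK1, hK⟩ := exists_gauss_bounds V
  obtain ⟨L, hL0, hL⟩ := exists_mild_mix V
  obtain ⟨c, d, hc0, hd0, hc1, hout⟩ := exists_outer_part_ge (V := V) (by linarith)
  -- This choice gives both 2ζK ≤ 1 and ζK ≤ a², the smallness required by `positive_part_ge`.
  set b : ℝ := 1 / (2 * K * (1 + V ^ 2)) with hb
  have hb0 : 0 < b := by positivity
  have hbK : b * K * (1 + V ^ 2) = 1 / 2 := by rw [hb]; field_simp
  have hb1 : b ≤ 1 := by
    rw [hb, div_le_one (by positivity)]; nlinarith [sq_nonneg V]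
  set N : ℝ := 9 * (1 + 2 * (3 * V + 2)) * L + 40 * V ^ 3 * K + 100 * V ^ 2 * K with hN
  have hN0 : 0 < N := by positivity
  refine ⟨b, c, d * b, N, hb0, hc0, by positivity, hN0,
    by nlinarith [sq_nonneg V, mul_le_mul_of_nonneg_left hK1 hb0.le], fun a ν h k u z f ha haV hν hνV hh hh1 hhk hs => ?_⟩
  have ha' : |a| ≤ V := by rwa [abs_of_pos ha]
  have hν' : |ν| ≤ V := by rwa [abs_of_pos hν]
  have hν'' : |-ν| ≤ V := by rwa [abs_neg]
  set ζ : ℝ := b * a ^ 2 with hζ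
  have hζ0 : 0 < ζ := by positivity
  have haV2 : a ^ 2 ≤ V ^ 2 := by gcongr
  have hζK : 2 * (ζ * K) ≤ 1 := by
    have : ζ * K = b * K * a ^ 2 := by rw [hζ]; ring
    have h2 : b * K * a ^ 2 ≤ b * K * (1 + V ^ 2) := by gcongr; linarith
    linarith
  have hζK2 : ζ * K ≤ a ^ 2 := by
    have : ζ * K = b * K * 1 * a ^ 2 := by rw [hζ]; ring
    have h2 : b * K * 1 ≤ b * K * (1 + V ^ 2) := by gcongr; linarith [sq_nonneg V]
    nlinarith [sq_nonneg a]
  have hζ1 : |ζ| ≤ 1 := by rw [abs_of_pos hζ0]; nlinarith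
  choose q' hq' using fun i j => hL a ν ζ ha' hν' hζ1 i j
  refine ⟨_, fun y => ⟨((((hs.deriv_funH ζ y).add (hs.deriv_funN hhk y)).add
    ((hs.deriv_funP y).const_mul (c * ζ * a))).add
    ((hs.deriv_formRe y).const_mul (c * ζ * a / (8 * ν)))).add
    (HasDerivAt.fun_sum fun i (_ : i ∈ Finset.univ) =>
      HasDerivAt.fun_sum fun j (_ : j ∈ Finset.univ) => hs.deriv_mix hhk i j (hq' i j y).1), ?_⟩⟩
  set P := ∑ j, sq (u j y) + ∑ j, sq (z j y) with hP
  set Q := ∑ j, sq (f j y) with hQ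
  have hP0 : 0 ≤ P := add_nonneg (Finset.sum_nonneg fun j _ => sq_nonneg' _)
    (Finset.sum_nonneg fun j _ => sq_nonneg' _)
  have hQ0 : 0 ≤ Q := Finset.sum_nonneg fun j _ => sq_nonneg' _
  have leu : ∀ i, sq (u i y) ≤ P := fun i =>
    (Finset.single_le_sum (f := fun j => sq (u j y)) (fun j _ => sq_nonneg' _)
      (Finset.mem_univ i)).trans (le_add_of_nonneg_right
        (Finset.sum_nonneg fun j _ => sq_nonneg' _))
  have lez : ∀ i, sq (z i y) ≤ P := fun i =>
    (Finset.single_le_sum (f := fun j => sq (z j y)) (fun j _ => sq_nonneg' _)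
      (Finset.mem_univ i)).trans (le_add_of_nonneg_left
        (Finset.sum_nonneg fun j _ => sq_nonneg' _))
  have lef : ∀ i, sq (f i y) ≤ Q := fun i =>
    Finset.single_le_sum (f := fun j => sq (f j y)) (fun j _ => sq_nonneg' _)
      (Finset.mem_univ i)
  have nu := fun i => norm_le_sqrt_of_sq_le (leu i)
  have nz := fun i => norm_le_sqrt_of_sq_le (lez i)
  have nf := fun i => norm_le_sqrt_of_sq_le (lef i)
  have nA := norm_fwd_le nu nz
  have nB := norm_bwd_le nu nz
  -- In the averaging error `drive` contains the source, so a bound common to u, z and f is needed.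
  -- The direct source terms keep the sharper product √Q √P.
  have nu' : ∀ i, ‖u i y‖ ≤ √(P + Q) := fun i => (nu i).trans (Real.sqrt_le_sqrt (by linarith))
  have nf' : ∀ i, ‖f i y‖ ≤ √(P + Q) := fun i => (nf i).trans (Real.sqrt_le_sqrt (by linarith))
  have nz' : ∀ i, ‖z i y‖ ≤ √(P + Q) := fun i => (nz i).trans (Real.sqrt_le_sqrt (by linarith))
  have nA' := norm_fwd_le nu' nz'
  have nB' := norm_bwd_le nu' nz'
  have hss : √(P + Q) * √(P + Q) = P + Q := Real.mul_self_sqrt (by linarith)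
  set w := (1 + |y|) * (sq (u 0 y) + sq (u 1 y)) with hw
  have hw0 : 0 ≤ w := by
    have := sq_nonneg' (u 0 y); have := sq_nonneg' (u 1 y); positivity
  set S := √Q * √P with hS
  have hS0 : 0 ≤ S := by positivity
  have hmix := mix_error_ge (q := fun i j => mix a ν ζ y i j) (q' := fun i j => q' i j y) hh.le ha' hν' nu' nz' nf' (fun i j => (hq' i j y).2)
  rw [Real.sq_sqrt (by linarith)] at hmix
  obtain ⟨k1, k2, k3, k4, k5⟩ := hK ν hν' y
  obtain ⟨l1, -, -, l4, l5⟩ := hK (-ν) hν'' y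
  obtain ⟨-, -, m3, -, -⟩ := hK ν hν' (-y)
  have g1 : gaussR ν y ≤ K := le_of_mul_one_add_abs_sq_le (gaussR_pos ν y).le k1
  have g2 : gaussR (-ν) y ≤ K := le_of_mul_one_add_abs_sq_le (gaussR_pos (-ν) y).le l1
  have g3 : gaussC y ≤ K := le_of_mul_one_add_abs_sq_le (gaussC_pos y).le k2
  obtain ⟨hTE, hTO⟩ := abs_tail_le ha.le haV (k3 hν.le) (m3 hν.le)
  have hsrc := abs_source_le (ζ := ζ) (c := c) (h := h) hK1 hV ha.le haV hν hνV hh.le hh1 hζ0.le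
    (mul_le_of_le_one_left (sq_nonneg a) hb1) ((abs_of_pos hζ0) ▸ hζ1) hc0.le hc1 g1 g2 g3
    hTE hTO nu nz nA nB nf
  have hfN := abs_funN_error_le (y := y) (W := w + P) (u := fun i => u i y) (z := fun i => z i y)
    hK1 hV ha' hν' (by rwa [abs_of_pos (gaussR_pos ν y)]) (by rwa [abs_of_pos (gaussR_pos (-ν) y)])
    hTE hTO nu nz (by rw [Real.sq_sqrt hP0])
  have hpos := positive_part_ge u z ha hζ0 hζK hζK2 k4 k5 l4 l5
    ((hout a ν y ha' hν' (fun i => u i y) (fun i => z i y)).trans (le_of_eq rfl))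
  -- The coefficient 1/(8ν) times -2ν is the -1/4 that multiplies `formRe` in
  -- `exists_outer_part_ge`; the other half is a source term.
  have e8 : c * ζ * a / (8 * ν) * (-2 * ν * formRe (fun i => u i y) (fun i => u i y) -
      2 * formIm (fun i => f i y) (fun i => u i y)) =
      -(a * ζ * c * (1 / 4 * formRe (fun i => u i y) (fun i => u i y))) +
      c * ζ * a / (8 * ν) * (-(2 * formIm (fun i => f i y) (fun i => u i y))) := by
    field_simp; ring
  rw [e8]
  have hsrc' := (abs_le.mp hsrc).1
  have hfN' := mul_le_mul_of_nonneg_left (abs_le.mp hfN).1 hh.le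
  have hE1 : h * (40 * V ^ 3 * K * (w + P)) + h * (9 * (1 + 2 * (3 * V + 2)) * L) * (P + Q) ≤
      h * N * (w + P + Q) := by
    have n1 : 0 ≤ h * (40 * V ^ 3 * K) * Q := by positivity
    have n2 : 0 ≤ h * (9 * (1 + 2 * (3 * V + 2)) * L) * w := by positivity
    have n3 : 0 ≤ h * (100 * V ^ 2 * K) * (w + P + Q) := by positivity
    rw [hN]; linarith
  have hE2 : 100 * V ^ 2 * K * (1 + a ^ 3 / ν) * S ≤ N * (1 + a ^ 3 / ν) * S := by
    gcongr
    have : 0 ≤ 9 * (1 + 2 * (3 * V + 2)) * L + 40 * V ^ 3 * K := by positivity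
    rw [hN]; linarith
  have hE3 : d * b * a ^ 3 * (w + sq (u 2 y)) = a * ζ * (d * (w + sq (u 2 y))) := by
    rw [hζ]; ring
  rw [hE3]
  linarith only [hpos, hE1, hE2, hsrc', hfN', hmix]

end BlochTorrey

/-! ### Integration over the line: the semiclassical estimate -/

namespace BlochTorrey

open Set Filter Topology

/-- This serves only to make the functional vanish at both ends of the line, so the constant may
depend on all parameters. -/
theorem exists_abs_funTotal_le {V a ν h ζ c : ℝ} (ha : 0 ≤ a) (haV : a ≤ V) (hν : 0 < ν)
    (hνV : ν ≤ V) (hζ : |ζ| ≤ 1) (u z : Fin 3 → ℝ → ℂ) : ∃ C : ℝ, ∀ y,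
      |funTotal h a ν ζ c u z y| ≤ C * ((1 + |y|) * (sq (u 0 y) + sq (u 1 y)) +
        (∑ j, sq (u j y) + ∑ j, sq (z j y))) := by
  obtain ⟨K, hK1, hK⟩ := exists_gauss_bounds V
  obtain ⟨L, hL0, hL⟩ := exists_mild_mix V
  have hV : 0 ≤ V := ha.trans haV
  have ha' : |a| ≤ V := by rwa [abs_of_nonneg ha]
  have hν' : |ν| ≤ V := by rwa [abs_of_pos hν]
  have hν'' : |-ν| ≤ V := by rwa [abs_neg]
  refine ⟨(1 * K + 1 * K + 1 * K * 2) + (V * K * 3 + 1 / 2 * (V * K) * 6 +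
    |h| * (V * K * (1 + 4 * V) + V * (V * K) * 3)) + |c * ζ * a| * (2 * 2) +
    |c * ζ * a / (8 * ν)| * 3 + 9 * (|h / 2| * L), fun y => ?_⟩
  set P := ∑ j, sq (u j y) + ∑ j, sq (z j y) with hP
  have hP0 : 0 ≤ P := add_nonneg (Finset.sum_nonneg fun j _ => sq_nonneg' _)
    (Finset.sum_nonneg fun j _ => sq_nonneg' _)
  have leu : ∀ i, sq (u i y) ≤ P := fun i =>
    (Finset.single_le_sum (f := fun j => sq (u j y)) (fun j _ => sq_nonneg' _)
      (Finset.mem_univ i)).trans (le_add_of_nonneg_right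
        (Finset.sum_nonneg fun j _ => sq_nonneg' _))
  have lez : ∀ i, sq (z i y) ≤ P := fun i =>
    (Finset.single_le_sum (f := fun j => sq (z j y)) (fun j _ => sq_nonneg' _)
      (Finset.mem_univ i)).trans (le_add_of_nonneg_left
        (Finset.sum_nonneg fun j _ => sq_nonneg' _))
  have nu := fun i => norm_le_sqrt_of_sq_le (leu i)
  have nz := fun i => norm_le_sqrt_of_sq_le (lez i)
  have nA := norm_fwd_le nu nz
  have nB := norm_bwd_le nu nz
  set w := (1 + |y|) * (sq (u 0 y) + sq (u 1 y)) with hw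
  have hw0 : 0 ≤ w := by
    have := sq_nonneg' (u 0 y); have := sq_nonneg' (u 1 y); positivity
  set T := w + P with hT
  have hPT : P ≤ T := by linarith
  have hss : √P * √P ≤ T := by rw [Real.mul_self_sqrt hP0]; exact hPT
  obtain ⟨k1, k2, k3, k4, k5⟩ := hK ν hν' y
  obtain ⟨l1, -, -, l4, l5⟩ := hK (-ν) hν'' y
  obtain ⟨-, -, m3, -, -⟩ := hK ν hν' (-y)
  have g1 : |gaussR ν y| ≤ 1 * K := by
    rw [abs_of_pos (gaussR_pos ν y), one_mul]
    exact le_of_mul_one_add_abs_sq_le (gaussR_pos ν y).le k1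
  have g2 : |gaussR (-ν) y| ≤ 1 * K := by
    rw [abs_of_pos (gaussR_pos (-ν) y), one_mul]
    exact le_of_mul_one_add_abs_sq_le (gaussR_pos (-ν) y).le l1
  have g3 : |ζ * gaussC y| ≤ 1 * K := by
    refine abs_mul_le_mul' hζ ?_
    rw [abs_of_pos (gaussC_pos y)]
    exact le_of_mul_one_add_abs_sq_le (gaussC_pos y).le k2
  obtain ⟨hTE, hTO⟩ := abs_tail_le ha haV (k3 hν.le) (m3 hν.le)
  have dA : ∀ i j, |dot (fwd u z i y) (fwd u z j y)| ≤ T := fun i j =>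
    (abs_dot_le_mul (nA i) (nA j)).trans hss
  have dB : ∀ i j, |dot (bwd u z i y) (bwd u z j y)| ≤ T := fun i j =>
    (abs_dot_le_mul (nB i) (nB j)).trans hss
  have dz : ∀ j, |dot (z j y) (u j y)| ≤ T := fun j =>
    (abs_dot_le_mul (nz j) (nu j)).trans hss
  have ffr : ∀ p q : Fin 3 → ℂ, (∀ i, ‖p i‖ ≤ √P) → (∀ i, ‖q i‖ ≤ √P) → |formRe p q| ≤ 3 * T :=
    fun p q hp hq => (abs_formRe_le hp hq).trans (by linarith)
  have ffi : |formIm (fun i => u i y) (fun i => z i y)| ≤ 3 * T :=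
    (abs_formIm_le nu nz).trans (by linarith)
  have fsk : |skew a y (fun i => u i y)| ≤ (1 + 4 * V) * T := by
    have := abs_skew_le y ha' nu
    rwa [Real.sq_sqrt hP0] at this
  have H : |funH ν ζ (fwd u z) (bwd u z) y| ≤ (1 * K + 1 * K + 1 * K * 2) * T := by
    rw [funH]
    refine (abs_add_le _ _).trans ((add_le_add_left (abs_sub _ _) _).trans ?_)
    have := abs_mul_le_mul' g3 ((abs_sub (dot (fwd u z 2 y) (fwd u z 1 y)) (dot (bwd u z 2 y)
      (bwd u z 0 y))).trans (add_le_add (dA 2 1) (dB 2 0)))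
    linarith [abs_mul_le_mul' g1 (dA 2 0), abs_mul_le_mul' g2 (dB 2 1)]
  have N : |funN h a ν u z y| ≤ (V * K * 3 + 1 / 2 * (V * K) * 6 +
    |h| * (V * K * (1 + 4 * V) + V * (V * K) * 3)) * T := by
    rw [funN]
    refine (abs_add_le _ _).trans ((add_le_add_left (abs_add_le _ _) _).trans ?_)
    have e1 := abs_mul_le_mul' hTE (ffr _ _ nz nu)
    have e2 := abs_mul_le_mul' (q := 1 / 2 * tailO a ν y) (K := 1 / 2 * (V * K))
      (by rw [abs_mul, abs_of_pos (by norm_num : (0 : ℝ) < 1 / 2)]; linarith)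
      ((abs_add_le _ _).trans (add_le_add (ffr _ _ nu nu) (ffr _ _ nz nz)))
    have e3 := abs_mul_le_mul' hTO fsk
    have e4 := abs_mul_le_mul' (abs_mul_le_mul' hν' hTE) ffi
    have e5 := abs_mul_le_mul' (le_refl |h|) ((abs_sub (tailO a ν y * skew a y fun i => u i y)
      (ν * tailE a ν y * formIm (fun i => u i y) fun i => z i y)).trans (add_le_add e3 e4))
    linarith
  have E : |funP u z y| ≤ 2 * (T + T) := by
    rw [funP]
    exact abs_mul_le_mul' (primC_abs_le y) ((abs_sub _ _).trans (add_le_add (dz 0) (dz 1)))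
  have M : |∑ i, ∑ j, h / 2 * (mix a ν ζ y i j * wdg (fwd u z i y) (bwd u z j y))| ≤
      9 * (|h / 2| * L) * T := by
    have e : ∀ i j, |h / 2 * (mix a ν ζ y i j * wdg (fwd u z i y) (bwd u z j y))| ≤
        |h / 2| * (L * T) := fun i j => by
      obtain ⟨q', hq'⟩ := hL a ν ζ ha' hν' hζ i j
      refine abs_mul_le_mul' le_rfl (abs_mul_le_mul' ?_
        ((abs_wdg_le_mul (nA i) (nB j)).trans hss))
      exact (le_mul_of_one_le_right (abs_nonneg _) (by linarith [abs_nonneg y])).trans (hq' y).2.1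
    refine (Finset.abs_sum_le_sum_abs _ _).trans ((Finset.sum_le_sum fun i _ =>
      (Finset.abs_sum_le_sum_abs _ _).trans (Finset.sum_le_sum fun j _ => e i j)).trans ?_)
    simp only [Finset.sum_const, Finset.card_univ, Fintype.card_fin, nsmul_eq_mul]
    push_cast
    linarith
  rw [funTotal]
  refine (abs_add_le _ _).trans ((add_le_add_left ((abs_add_le _ _).trans (add_le_add_left
    ((abs_add_le _ _).trans (add_le_add_left (abs_add_le _ _) _)) _)) _).trans ?_)
  have E' := abs_mul_le_mul' (le_refl |c * ζ * a|) E
  have F' := abs_mul_le_mul' (le_refl |c * ζ * a / (8 * ν)|) (ffr _ _ nz nu)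
  linarith only [H, N, E', F', M]

theorem sqrt_mul_sqrt_le {P Q t : ℝ} (hP : 0 ≤ P) (hQ : 0 ≤ Q) (ht : 0 < t) :
    √Q * √P ≤ t / 2 * P + 1 / (2 * t) * Q := by
  have h : t / 2 * P + 1 / (2 * t) * Q - √Q * √P = t / 2 * (√P - √Q / t) ^ 2 := by
    conv_lhs => rw [← Real.sq_sqrt hP, ← Real.sq_sqrt hQ]
    rw [Real.sqrt_sq (Real.sqrt_nonneg _), Real.sqrt_sq (Real.sqrt_nonneg _)]
    field_simp; ring
  have : 0 ≤ t / 2 * (√P - √Q / t) ^ 2 := by positivity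
  linarith

/-- The resolvent estimate for the semiclassical system. -/
theorem exists_semi_estimate {V : ℝ} (hV : 1 ≤ V) : ∃ η C : ℝ, 0 < η ∧ 0 < C ∧
    ∀ (a ν h k : ℝ) (u z f : Fin 3 → ℝ → ℂ), 0 < a → a ≤ V → 0 < ν → ν ≤ V → 0 < h →
      h ≤ η * a ^ 3 → h * k = 1 → SemiSystem k a ν u z f →
      (∀ j, Integrable fun y => (1 + |y|) * sq (u j y)) → (∀ j, Integrable fun y => sq (u j y)) →
      (∀ j, Integrable fun y => sq (z j y)) → (∀ j, Integrable fun y => sq (f j y)) →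
      (∀ j, Tendsto (fun y => (1 + |y|) * sq (u j y)) (cocompact ℝ) (𝓝 0)) →
      (∀ j, Tendsto (fun y => sq (z j y)) (cocompact ℝ) (𝓝 0)) →
      ∫ y, ∑ j, sq (u j y) ≤ C * (1 / a ^ 3 + 1 / ν) ^ 2 * ∫ y, ∑ j, sq (f j y) := by
  obtain ⟨b, c, d, K, hb0, hc0, hd0, hK0, hbV, H⟩ := exists_funTotal_deriv_ge hV
  have hV0 : 0 < V := by linarith
  -- The first entry forces h ≤ 1; the second makes the averaging loss hK at most a sixteenth of the
  -- gain da³.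
  set η : ℝ := min (1 / V ^ 3) (d / (16 * K)) with hη
  have hη0 : 0 < η := by positivity
  refine ⟨η, V ^ 6 + 8 * K ^ 2 / d ^ 2, hη0, by positivity, ?_⟩
  intro a ν h k u z f ha haV hν hνV hh hha hhk hs iw iu iz jf tu tz
  have ha3 : 0 < a ^ 3 := by positivity
  have hh1 : h ≤ 1 := by
    calc h ≤ η * a ^ 3 := hha
      _ ≤ 1 / V ^ 3 * V ^ 3 := by gcongr; exact min_le_left _ _
      _ = 1 := by field_simp
  have hhK : h * K ≤ d * a ^ 3 / 16 := by
    calc h * K ≤ d / (16 * K) * a ^ 3 * K := by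
          gcongr; exact hha.trans (by gcongr; exact min_le_right _ _)
      _ = _ := by field_simp
  obtain ⟨F', hF'⟩ := H a ν h k u z f ha haV hν hνV hh hh1 hhk hs
  set κ : ℝ := K * (1 + a ^ 3 / ν) with hκ
  have hκ0 : 0 < κ := by positivity
  -- With this weight in Young's inequality the source also costs at most a sixteenth of the gain
  -- coefficient on u and z.
  set t : ℝ := d * a ^ 3 / (8 * κ) with ht
  have ht0 : 0 < t := by positivity
  have hbot : atBot ≤ cocompact ℝ := atBot_le_cocompact
  have htop : atTop ≤ cocompact ℝ := atTop_le_cocompact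
  have tu' : ∀ j, Tendsto (fun y => sq (u j y)) (cocompact ℝ) (𝓝 0) := fun j =>
    squeeze_zero (fun y => sq_nonneg' _) (fun y => le_mul_of_one_le_left (sq_nonneg' _)
      (by linarith [abs_nonneg y])) (tu j)
  have tsum : Tendsto (fun y => (1 + |y|) * (sq (u 0 y) + sq (u 1 y)) +
      (∑ j, sq (u j y) + ∑ j, sq (z j y))) (cocompact ℝ) (𝓝 0) := by
    have := (((tu 0).add (tu 1)).add ((tendsto_finsetSum Finset.univ fun j _ => tu' j).add
      (tendsto_finsetSum Finset.univ fun j _ => tz j)))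
    simp only [Finset.sum_const_zero, add_zero] at this
    refine this.congr fun y => ?_
    ring
  obtain ⟨C1, hC1⟩ := exists_abs_funTotal_le (h := h) (c := c) (ζ := b * a ^ 2) ha.le haV hν hνV
    (by
      rw [abs_of_pos (by positivity)]
      exact (mul_le_mul_of_nonneg_left (pow_le_pow_left₀ ha.le haV 2) hb0.le).trans hbV) u z
  have tF : Tendsto (funTotal h a ν (b * a ^ 2) c u z) (cocompact ℝ) (𝓝 0) := by
    refine squeeze_zero_norm hC1 ?_
    simpa using tsum.const_mul C1
  -- integrated quantities
  have iw' : Integrable fun y => (1 + |y|) * (sq (u 0 y) + sq (u 1 y)) :=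
    ((iw 0).add (iw 1)).congr (ae_of_all _ fun y => by simp only [Pi.add_apply]; ring)
  have iU : Integrable fun y => ∑ j, sq (u j y) := integrable_finsetSum _ fun j _ => iu j
  have iZ : Integrable fun y => ∑ j, sq (z j y) := integrable_finsetSum _ fun j _ => iz j
  have iF : Integrable fun y => ∑ j, sq (f j y) := integrable_finsetSum _ fun j _ => jf j
  set U := ∫ y, ∑ j, sq (u j y) with hU
  set Z := ∫ y, ∑ j, sq (z j y) with hZ
  set Q := ∫ y, ∑ j, sq (f j y) with hQ
  set W := ∫ y, (1 + |y|) * (sq (u 0 y) + sq (u 1 y)) with hW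
  set X := ∫ y, sq (u 2 y) with hX
  have hX0 : 0 ≤ X := integral_nonneg fun y => sq_nonneg' _
  have hQ0 : 0 ≤ Q := integral_nonneg fun y => Finset.sum_nonneg fun j _ => sq_nonneg' _
  have hUW : U ≤ W + X := by
    rw [hU, hW, hX, ← integral_add iw' (iu 2)]
    refine integral_mono iU (iw'.add (iu 2)) fun y => ?_
    have h0 := sq_nonneg' (u 0 y)
    have h1 := sq_nonneg' (u 1 y)
    simp only [Fin.sum_univ_three]
    nlinarith [abs_nonneg y]
  -- The gain does not contain z; the energy identity supplies it.
  have hZU : Z ≤ 2 * U + Q := by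
    have e := integral_nonpos_of_le_deriv
      (g := fun y => ∑ j, sq (z j y) - 2 * ∑ j, sq (u j y) - ∑ j, sq (f j y))
      (fun y => (hs.deriv_energy hhk y).neg) ((iZ.sub (iU.const_mul 2)).sub iF) (fun y => ?_) ?_ ?_
    · have i1 : Integrable fun y => ∑ j, sq (z j y) - 2 * ∑ j, sq (u j y) :=
        iZ.sub (iU.const_mul 2)
      rw [integral_sub i1 iF, integral_sub iZ (iU.const_mul 2), integral_const_mul] at e
      linarith
    · rw [Finset.mul_sum, ← Finset.sum_sub_distrib, ← Finset.sum_sub_distrib,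
        ← Finset.sum_neg_distrib]
      refine Finset.sum_le_sum fun j _ => ?_
      have e1 := abs_le.mp (abs_dot_le one_pos (f j y) (u j y))
      have e2 := sq_nonneg' (f j y)
      have e3 := sq_nonneg' (u j y)
      nlinarith [e1.1, e1.2]
    all_goals
      have e : Tendsto (fun y => -(h * ∑ j, wdg (u j y) (z j y))) (cocompact ℝ) (𝓝 0) := by
        have e1 : ∀ j, Tendsto (fun y => wdg (u j y) (z j y)) (cocompact ℝ) (𝓝 0) := fun j => by
          refine squeeze_zero_norm (fun y => abs_wdg_le one_pos (u j y) (z j y)) ?_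
          have := ((tu' j).const_mul (1 / 2)).add ((tz j).const_mul (1 / (2 * 1)))
          rwa [mul_zero, mul_zero, add_zero] at this
        simpa using ((tendsto_finsetSum Finset.univ fun j _ => e1 j).const_mul h).neg
      first | exact e.mono_left htop | exact e.mono_left hbot
  have i1 : Integrable fun y => (1 + |y|) * (sq (u 0 y) + sq (u 1 y)) + sq (u 2 y) :=
    iw'.add (iu 2)
  have i2 : Integrable fun y => ∑ j, sq (u j y) + ∑ j, sq (z j y) := iU.add iZ
  have i3 : Integrable fun y => (1 + |y|) * (sq (u 0 y) + sq (u 1 y)) +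
      (∑ j, sq (u j y) + ∑ j, sq (z j y)) := iw'.add i2
  have i4 : Integrable fun y => (1 + |y|) * (sq (u 0 y) + sq (u 1 y)) +
      (∑ j, sq (u j y) + ∑ j, sq (z j y)) + ∑ j, sq (f j y) := i3.add iF
  have i5 : Integrable fun y =>
      d * a ^ 3 * ((1 + |y|) * (sq (u 0 y) + sq (u 1 y)) + sq (u 2 y)) -
      d * a ^ 3 / 16 * ((1 + |y|) * (sq (u 0 y) + sq (u 1 y)) +
        (∑ j, sq (u j y) + ∑ j, sq (z j y)) + ∑ j, sq (f j y)) :=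
    (i1.const_mul _).sub (i4.const_mul _)
  have i6 : Integrable fun y => d * a ^ 3 / 16 * (∑ j, sq (u j y) + ∑ j, sq (z j y)) +
      4 * κ ^ 2 / (d * a ^ 3) * ∑ j, sq (f j y) := (i2.const_mul _).add (iF.const_mul _)
  have main := integral_nonpos_of_le_deriv
    (g := fun y => d * a ^ 3 * ((1 + |y|) * (sq (u 0 y) + sq (u 1 y)) + sq (u 2 y)) -
      d * a ^ 3 / 16 * ((1 + |y|) * (sq (u 0 y) + sq (u 1 y)) +
        (∑ j, sq (u j y) + ∑ j, sq (z j y)) + ∑ j, sq (f j y)) -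
      (d * a ^ 3 / 16 * (∑ j, sq (u j y) + ∑ j, sq (z j y)) +
        4 * κ ^ 2 / (d * a ^ 3) * ∑ j, sq (f j y)))
    (fun y => (hF' y).1) ?_ (fun y => ?_) (tF.mono_left htop) (tF.mono_left hbot)
  · rw [integral_sub i5 i6, integral_sub (i1.const_mul _) (i4.const_mul _), integral_const_mul,
      integral_const_mul, integral_add iw' (iu 2), integral_add i3 iF, integral_add iw' i2,
      integral_add iU iZ, integral_add (i2.const_mul _) (iF.const_mul _), integral_const_mul,
      integral_const_mul, integral_add iU iZ] at main
    have hp : 0 < d * a ^ 3 := by positivity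
    -- All losses together are W + 2U + 2Z + Q ≤ 7(W + X) + 3Q in units of a sixteenth of the gain;
    -- 7/16 < 1, so they can be absorbed.
    have e1 : d * a ^ 3 * (W + X) ≤ d * a ^ 3 / 16 * (7 * (W + X) + 3 * Q) +
        4 * κ ^ 2 / (d * a ^ 3) * Q := by
      have : d * a ^ 3 / 16 * (W + (U + Z) + Q + (U + Z)) ≤
          d * a ^ 3 / 16 * (7 * (W + X) + 3 * Q) :=
        mul_le_mul_of_nonneg_left (by linarith) (by positivity)
      linarith
    have e2 : 4 * κ ^ 2 / (d * a ^ 3) * Q =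
        d * a ^ 3 * (4 * K ^ 2 / d ^ 2 * (1 / a ^ 3 + 1 / ν) ^ 2 * Q) := by
      rw [hκ]; field_simp
    have e3 : W + X ≤ (7 * (W + X) + 3 * Q) / 16 +
        4 * K ^ 2 / d ^ 2 * (1 / a ^ 3 + 1 / ν) ^ 2 * Q := by
      rw [e2] at e1
      refine le_of_mul_le_mul_left ?_ hp
      linarith
    have e4 : Q ≤ V ^ 6 * (1 / a ^ 3 + 1 / ν) ^ 2 * Q := by
      refine le_mul_of_one_le_left hQ0 ?_
      have : 1 ≤ V ^ 3 * (1 / a ^ 3 + 1 / ν) := by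
        have h1 : 1 ≤ V ^ 3 * (1 / a ^ 3) := by
          rw [mul_one_div, one_le_div ha3]; gcongr
        have h2 : 0 ≤ V ^ 3 * (1 / ν) := by positivity
        linarith
      calc (1 : ℝ) ≤ (V ^ 3 * (1 / a ^ 3 + 1 / ν)) ^ 2 := one_le_pow₀ this
        _ = _ := by ring
    have e5 : 0 ≤ K ^ 2 / d ^ 2 * (1 / a ^ 3 + 1 / ν) ^ 2 * Q := by positivity
    have e6 : (V ^ 6 + 8 * K ^ 2 / d ^ 2) * (1 / a ^ 3 + 1 / ν) ^ 2 * Q =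
      V ^ 6 * (1 / a ^ 3 + 1 / ν) ^ 2 * Q +
        8 * (K ^ 2 / d ^ 2 * (1 / a ^ 3 + 1 / ν) ^ 2 * Q) := by ring
    have e7 : 4 * K ^ 2 / d ^ 2 * (1 / a ^ 3 + 1 / ν) ^ 2 * Q =
      4 * (K ^ 2 / d ^ 2 * (1 / a ^ 3 + 1 / ν) ^ 2 * Q) := by ring
    rw [e6]
    rw [e7] at e3
    linarith
  · exact i5.sub i6
  · refine le_trans ?_ (hF' y).2
    have hP0 : 0 ≤ ∑ j, sq (u j y) + ∑ j, sq (z j y) :=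
      add_nonneg (Finset.sum_nonneg fun j _ => sq_nonneg' _)
        (Finset.sum_nonneg fun j _ => sq_nonneg' _)
    have hQ0 : 0 ≤ ∑ j, sq (f j y) := Finset.sum_nonneg fun j _ => sq_nonneg' _
    have h0 := sq_nonneg' (u 0 y)
    have h1 := sq_nonneg' (u 1 y)
    have e1 := mul_le_mul_of_nonneg_left (sqrt_mul_sqrt_le hP0 hQ0 ht0) hκ0.le
    have e2 : κ * (t / 2 * (∑ j, sq (u j y) + ∑ j, sq (z j y)) + 1 / (2 * t) * ∑ j, sq (f j y)) =
        d * a ^ 3 / 16 * (∑ j, sq (u j y) + ∑ j, sq (z j y)) +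
        4 * κ ^ 2 / (d * a ^ 3) * ∑ j, sq (f j y) := by
      rw [ht]; field_simp; ring
    have e3 : h * K * ((1 + |y|) * (sq (u 0 y) + sq (u 1 y)) +
        (∑ j, sq (u j y) + ∑ j, sq (z j y)) + ∑ j, sq (f j y)) ≤ d * a ^ 3 / 16 *
        ((1 + |y|) * (sq (u 0 y) + sq (u 1 y)) +
        (∑ j, sq (u j y) + ∑ j, sq (z j y)) + ∑ j, sq (f j y)) := by
      gcongr
    linarith only [e1, e2, e3]

end BlochTorrey

namespace BlochTorrey

open Set Filter Topology

/-! ### The stationary system -/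

/-- The matrix part `(i x, 0, a; 0, -i x, a; -a, -a, 0) - lam` of the operator, minus the source:
the value of `u''` for a solution of `(B - lam) u = f`. -/
def rhsB (a : ℝ) (lam : ℂ) (y : ℝ) (u f : Fin 3 → ℂ) : Fin 3 → ℂ :=
  ![Complex.I * y * u 0 + a * u 2 - lam * u 0 - f 0,
    -(Complex.I * y * u 1) + a * u 2 - lam * u 1 - f 1,
    -(a * (u 0 + u 1)) - lam * u 2 - f 2]

/-- Classical decaying solutions of `(B - lam) u = f`, with `p = u'`. -/
structure BTSystem (a : ℝ) (lam : ℂ) (u p f : Fin 3 → ℝ → ℂ) : Prop where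
  deriv_u : ∀ j y, HasDerivAt (u j) (p j y) y
  deriv_p : ∀ j y, HasDerivAt (p j) (rhsB a lam y (fun i => u i y) (fun i => f i y) j) y
  int_u : ∀ j, Integrable fun y => (1 + y ^ 2) * sq (u j y)
  int_p : ∀ j, Integrable fun y => (1 + y ^ 2) * sq (p j y)
  int_f : ∀ j, Integrable fun y => sq (f j y)
  lim_u : ∀ j, Tendsto (fun y => (1 + y ^ 2) * sq (u j y)) (cocompact ℝ) (𝓝 0)
  lim_p : ∀ j, Tendsto (fun y => (1 + y ^ 2) * sq (p j y)) (cocompact ℝ) (𝓝 0)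

variable {a : ℝ} {lam : ℂ} {u p f : Fin 3 → ℝ → ℂ}

/-- Continuous, square integrable and vanishing at infinity. -/
structure Decays (g : ℝ → ℂ) : Prop where
  cont : Continuous g
  int : Integrable fun y => sq (g y)
  lim : Tendsto (fun y => sq (g y)) (cocompact ℝ) (𝓝 0)

theorem continuous_sq {g : ℝ → ℂ} (hg : Continuous g) : Continuous fun y => sq (g y) := by
  unfold sq; fun_prop

theorem sq_add_le (x y : ℂ) : sq (x + y) ≤ 2 * sq x + 2 * sq y := by
  simp only [sq, Complex.add_re, Complex.add_im]
  nlinarith [sq_nonneg (x.re - y.re), sq_nonneg (x.im - y.im)]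

theorem sq_mul (x y : ℂ) : sq (x * y) = sq x * sq y := by
  rw [sq_eq, sq_eq, sq_eq, norm_mul, mul_pow]

theorem Decays.of_le {g : ℝ → ℂ} {b : ℝ → ℝ} (hg : Continuous g) (hb : Integrable b)
    (hl : Tendsto b (cocompact ℝ) (𝓝 0)) (h : ∀ y, sq (g y) ≤ b y) : Decays g :=
  ⟨hg, hb.mono' (continuous_sq hg).aestronglyMeasurable
    (ae_of_all _ fun y => by rw [Real.norm_of_nonneg (sq_nonneg' _)]; exact h y),
    squeeze_zero (fun _ => sq_nonneg' _) h hl⟩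

theorem Decays.add {g k : ℝ → ℂ} (hg : Decays g) (hk : Decays k) :
    Decays fun y => g y + k y :=
  Decays.of_le (b := fun y => 2 * sq (g y) + 2 * sq (k y)) (hg.cont.add hk.cont) ((hg.int.const_mul 2).add (hk.int.const_mul 2))
    (by simpa using (hg.lim.const_mul 2).add (hk.lim.const_mul 2)) fun y => sq_add_le _ _

theorem Decays.const_mul {g : ℝ → ℂ} (hg : Decays g) (c : ℂ) : Decays fun y => c * g y :=
  Decays.of_le (continuous_const.mul hg.cont) (hg.int.const_mul (sq c))
    (by simpa using hg.lim.const_mul (sq c)) fun y => (sq_mul _ _).le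

theorem Decays.tendsto_dot {g k : ℝ → ℂ} (hg : Decays g) (hk : Decays k) :
    Tendsto (fun y => dot (g y) (k y)) (cocompact ℝ) (𝓝 0) := by
  refine squeeze_zero_norm (fun y => abs_dot_le one_pos _ _) ?_
  have := (hg.lim.const_mul (1 / 2)).add (hk.lim.const_mul (1 / (2 * 1)))
  rwa [mul_zero, mul_zero, add_zero] at this

theorem Decays.tendsto_wdg {g k : ℝ → ℂ} (hg : Decays g) (hk : Decays k) :
    Tendsto (fun y => wdg (g y) (k y)) (cocompact ℝ) (𝓝 0) := by
  refine squeeze_zero_norm (fun y => abs_wdg_le one_pos _ _) ?_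
  have := (hg.lim.const_mul (1 / 2)).add (hk.lim.const_mul (1 / (2 * 1)))
  rwa [mul_zero, mul_zero, add_zero] at this

theorem decays_of_weight {g : ℝ → ℂ} (hg : Continuous g)
    (hi : Integrable fun y => (1 + y ^ 2) * sq (g y))
    (hl : Tendsto (fun y => (1 + y ^ 2) * sq (g y)) (cocompact ℝ) (𝓝 0)) :
    Decays g ∧ Decays fun y => (y : ℂ) * g y := by
  refine ⟨Decays.of_le hg hi hl fun y => le_mul_of_one_le_left (sq_nonneg' _)
    (by linarith [sq_nonneg y]), Decays.of_le (by fun_prop) hi hl fun y => ?_⟩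
  rw [sq_mul]
  have : sq (y : ℂ) = y ^ 2 := by simp [sq]
  rw [this]
  exact mul_le_mul_of_nonneg_right (by linarith) (sq_nonneg' _)

/-- The version of `integral_nonpos_of_le_deriv` with a single limit. -/
theorem integral_nonpos_of_le_deriv' {F F' g : ℝ → ℝ} (hF : ∀ y, HasDerivAt F (F' y) y)
    (hg : Integrable g) (hle : ∀ y, g y ≤ F' y) (h : Tendsto F (cocompact ℝ) (𝓝 0)) :
    ∫ y, g y ≤ 0 :=
  integral_nonpos_of_le_deriv hF hg hle (h.mono_left atTop_le_cocompact)
    (h.mono_left atBot_le_cocompact)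

namespace BTSystem

theorem decays_u (hs : BTSystem a lam u p f) (j : Fin 3) :
    Decays (u j) ∧ Decays fun y => (y : ℂ) * u j y :=
  decays_of_weight (continuous_iff_continuousAt.mpr fun y => (hs.deriv_u j y).continuousAt)
    (hs.int_u j) (hs.lim_u j)

theorem decays_p (hs : BTSystem a lam u p f) (j : Fin 3) :
    Decays (p j) ∧ Decays fun y => (y : ℂ) * p j y :=
  decays_of_weight (continuous_iff_continuousAt.mpr fun y => (hs.deriv_p j y).continuousAt)
    (hs.int_p j) (hs.lim_p j)

theorem decays_sum (hs : BTSystem a lam u p f) : Decays fun y => u 0 y + u 1 y :=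
  (hs.decays_u 0).1.add (hs.decays_u 1).1

/-- Complex conjugation and exchange of the first two components. -/
theorem conj (hs : BTSystem a lam u p f) :
    BTSystem a (starRingEnd ℂ lam) (fun j y => starRingEnd ℂ (u (Equiv.swap 0 1 j) y))
      (fun j y => starRingEnd ℂ (p (Equiv.swap 0 1 j) y))
      (fun j y => starRingEnd ℂ (f (Equiv.swap 0 1 j) y)) := by
  have hsq : ∀ x : ℂ, sq (starRingEnd ℂ x) = sq x := fun x => by simp [sq]
  refine ⟨fun j y => ?_, fun j y => ?_, fun j => ?_, fun j => ?_, fun j => ?_, fun j => ?_,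
    fun j => ?_⟩
  · exact Complex.conjCLE.toContinuousLinearMap.hasFDerivAt.comp_hasDerivAt y (hs.deriv_u _ y)
  · refine (Complex.conjCLE.toContinuousLinearMap.hasFDerivAt.comp_hasDerivAt y
      (hs.deriv_p (Equiv.swap 0 1 j) y)).congr_deriv ?_
    have : (Equiv.swap (0 : Fin 3) 1) 2 = 2 := by decide
    fin_cases j
    · simp [rhsB, this]
    · simp [rhsB, this]
    · simp [rhsB, this, add_comm]
  · simpa only [hsq] using hs.int_u _
  · simpa only [hsq] using hs.int_p _
  · simpa only [hsq] using hs.int_f _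
  · simpa only [hsq] using hs.lim_u _
  · simpa only [hsq] using hs.lim_p _

/-- The energy identity for the form `formRe`. -/
theorem integral_sq_le (hs : BTSystem a lam u p f) (hν : lam.im ≠ 0) :
    ∫ y, ∑ j, sq (u j y) ≤ 2 * (∫ y, sq (u 0 y + u 1 y)) +
      1 / lam.im ^ 2 * ∫ y, ∑ j, sq (f j y) := by
  set ν := lam.im with hν'
  have iU : Integrable fun y => ∑ j, sq (u j y) :=
    integrable_finsetSum _ fun j _ => (hs.decays_u j).1.int
  have iF : Integrable fun y => ∑ j, sq (f j y) := integrable_finsetSum _ fun j _ => hs.int_f j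
  have iw := hs.decays_sum.int
  have i1 : Integrable fun y => 1 / 2 * ∑ j, sq (u j y) - sq (u 0 y + u 1 y) :=
    (iU.const_mul _).sub iw
  have e := integral_nonpos_of_le_deriv' (g := fun y => 1 / 2 * ∑ j, sq (u j y) -
      sq (u 0 y + u 1 y) - 1 / (2 * ν ^ 2) * ∑ j, sq (f j y))
    (fun y => (hasDerivAt_formIm (fun j => hs.deriv_p j y)
      (fun j => hs.deriv_u j y)).const_mul (1 / ν)) (i1.sub (iF.const_mul _)) (fun y => ?_) ?_
  · rw [integral_sub i1 (iF.const_mul _), integral_sub (iU.const_mul _) iw, integral_const_mul,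
      integral_const_mul] at e
    have : 1 / (2 * ν ^ 2) = 1 / 2 * (1 / ν ^ 2) := by field_simp
    rw [this] at e
    linarith
  · have h1 : ∀ i j, |1 / ν * wdg (f i y) (u j y)| ≤
        1 / 2 * sq (u j y) + 1 / (2 * ν ^ 2) * sq (f i y) := fun i j => by
      have hν0 : 0 < |ν| := abs_pos.mpr hν
      have := abs_wdg_le (t := 1 / |ν|) (by positivity) (f i y) (u j y)
      rw [abs_mul, abs_div, abs_one]
      calc 1 / |ν| * |wdg (f i y) (u j y)| ≤ 1 / |ν| * (1 / |ν| / 2 * sq (f i y) +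
            1 / (2 * (1 / |ν|)) * sq (u j y)) := by gcongr
        _ = 1 / 2 * sq (u j y) + 1 / (2 * |ν| ^ 2) * sq (f i y) := by field_simp; ring
        _ = _ := by rw [sq_abs]
    -- The matrix part without λ is symmetric for the Hermitian form, so its imaginary part sees
    -- only Im λ and the source; the form at (u, u) equals |u₀ + u₁|² - |u|².
    have h2 : 1 / ν * (formIm (rhsB a lam y (fun i => u i y) (fun i => f i y)) (fun i => u i y) +
        formIm (fun i => p i y) (fun i => p i y)) =
        ∑ j, sq (u j y) - sq (u 0 y + u 1 y) + (1 / ν * wdg (f 0 y) (u 1 y) +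
          1 / ν * wdg (f 1 y) (u 0 y) - 1 / ν * wdg (f 2 y) (u 2 y)) := by
      field_simp
      simp only [formIm, rhsB, Fin.sum_univ_three, Matrix.cons_val_zero, Matrix.cons_val_one,
        Matrix.cons_val]
      simp only [wdg, sq, Complex.add_re, Complex.add_im, Complex.mul_re, Complex.mul_im,
        Complex.sub_re, Complex.sub_im, Complex.neg_re, Complex.neg_im, Complex.ofReal_re,
        Complex.ofReal_im, Complex.I_re, Complex.I_im, ← hν']
      ring
    rw [h2]
    simp only [Fin.sum_univ_three]
    linarith [(abs_le.mp (h1 0 1)).1, (abs_le.mp (h1 1 0)).1, (abs_le.mp (h1 2 2)).2]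
  · have t : ∀ i j, Tendsto (fun y => wdg (p i y) (u j y)) (cocompact ℝ) (𝓝 0) := fun i j =>
      (hs.decays_p i).1.tendsto_wdg (hs.decays_u j).1
    simpa [formIm] using ((((t 0 1).add (t 1 0)).sub (t 2 2)).neg).const_mul (1 / ν)

theorem decays_diff (hs : BTSystem a lam u p f) : Decays fun y => u 0 y - u 1 y := by
  have := (hs.decays_u 0).1.add ((hs.decays_u 1).1.const_mul (-1))
  simpa only [neg_one_mul, ← sub_eq_add_neg] using this

theorem decays_flux (hs : BTSystem a lam u p f) :
    Decays fun y => Complex.I * (y * (u 0 y - u 1 y)) + 2 * a * u 2 y := by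
  have h1 := ((hs.decays_u 0).2.add ((hs.decays_u 1).2.const_mul (-1))).const_mul Complex.I
  have h2 := h1.add ((hs.decays_u 2).1.const_mul (2 * a))
  simpa only [neg_one_mul, ← sub_eq_add_neg, ← mul_sub] using h2

theorem decays_deriv_flux (hs : BTSystem a lam u p f) :
    Decays fun y => Complex.I * (u 0 y - u 1 y) + Complex.I * (y * (p 0 y - p 1 y)) +
      2 * a * p 2 y := by
  have h1 := ((hs.decays_p 0).2.add ((hs.decays_p 1).2.const_mul (-1))).const_mul Complex.I
  have h2 := ((hs.decays_diff.const_mul Complex.I).add h1).add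
    ((hs.decays_p 2).1.const_mul (2 * a))
  simpa only [neg_one_mul, ← sub_eq_add_neg, ← mul_sub] using h2

theorem hasDerivAt_flux (hs : BTSystem a lam u p f) (y : ℝ) :
    HasDerivAt (fun y : ℝ => Complex.I * (y * (u 0 y - u 1 y)) + 2 * a * u 2 y)
      (Complex.I * (u 0 y - u 1 y) + Complex.I * (y * (p 0 y - p 1 y)) + 2 * a * p 2 y) y := by
  refine ((((Complex.ofRealCLM.hasDerivAt (x := y)).mul
    ((hs.deriv_u 0 y).sub (hs.deriv_u 1 y))).const_mul Complex.I).add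
      ((hs.deriv_u 2 y).const_mul (2 * (a : ℂ)))).congr_deriv ?_
  simp only [Complex.ofRealCLM_apply, Complex.ofReal_one, Pi.sub_apply]
  ring

/-- With w = u₀ + u₁ and q the flux, w'' = q - λw and q'' = -(y² + 2a²)w - λq + 2i(u₀ - u₁)' up to
sources. The pair (w, q) is closed except for the commutator term 2i(u₀ - u₁)'. -/
theorem hasDerivAt_deriv_flux (hs : BTSystem a lam u p f) (y : ℝ) :
    HasDerivAt (fun y : ℝ => Complex.I * (u 0 y - u 1 y) + Complex.I * (y * (p 0 y - p 1 y)) +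
        2 * a * p 2 y)
      (-(((y ^ 2 + 2 * a ^ 2 : ℝ) : ℂ) * (u 0 y + u 1 y)) -
        lam * (Complex.I * (y * (u 0 y - u 1 y)) + 2 * a * u 2 y) +
        2 * Complex.I * (p 0 y - p 1 y) - Complex.I * (y * (f 0 y - f 1 y)) -
        2 * a * f 2 y) y := by
  refine (((((hs.deriv_u 0 y).sub (hs.deriv_u 1 y)).const_mul Complex.I).add
    (((Complex.ofRealCLM.hasDerivAt (x := y)).mul
    ((hs.deriv_p 0 y).sub (hs.deriv_p 1 y))).const_mul Complex.I)).add
      ((hs.deriv_p 2 y).const_mul (2 * (a : ℂ)))).congr_deriv ?_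
  simp only [Complex.ofRealCLM_apply, Complex.ofReal_one, Pi.sub_apply, rhsB,
    Matrix.cons_val_zero, Matrix.cons_val_one, Matrix.cons_val]
  push_cast
  linear_combination ((y : ℂ) ^ 2 * (u 0 y + u 1 y)) * Complex.I_sq

theorem hasDerivAt_deriv_sum (hs : BTSystem a lam u p f) (y : ℝ) :
    HasDerivAt (fun y : ℝ => p 0 y + p 1 y)
      (Complex.I * (y * (u 0 y - u 1 y)) + 2 * a * u 2 y - lam * (u 0 y + u 1 y) -
        (f 0 y + f 1 y)) y := by
  refine ((hs.deriv_p 0 y).add (hs.deriv_p 1 y)).congr_deriv ?_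
  simp only [rhsB, Matrix.cons_val_zero, Matrix.cons_val_one]
  ring

/-- The derivative of `u₀ + u₁`. -/
theorem integral_deriv_sum_le (hs : BTSystem a lam u p f) {e : ℝ} (he : 0 < e) :
    ∫ y, sq (p 0 y + p 1 y) ≤ (max lam.re 0 + e) * (∫ y, sq (u 0 y + u 1 y)) +
      1 / (2 * e) * (∫ y, sq (Complex.I * (y * (u 0 y - u 1 y)) + 2 * a * u 2 y)) +
      1 / e * ∫ y, ∑ j, sq (f j y) := by
  have iF : Integrable fun y => ∑ j, sq (f j y) := integrable_finsetSum _ fun j _ => hs.int_f j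
  have iw := hs.decays_sum.int
  have ip := ((hs.decays_p 0).1.add (hs.decays_p 1).1)
  have iq := hs.decays_flux.int
  have i1 : Integrable fun y => sq (p 0 y + p 1 y) -
      (max lam.re 0 + e) * sq (u 0 y + u 1 y) := ip.int.sub (iw.const_mul _)
  have i2 : Integrable fun y => sq (p 0 y + p 1 y) -
      (max lam.re 0 + e) * sq (u 0 y + u 1 y) - 1 / (2 * e) *
      sq (Complex.I * (y * (u 0 y - u 1 y)) + 2 * a * u 2 y) := i1.sub (iq.const_mul _)
  have h := integral_nonpos_of_le_deriv' (g := fun y => sq (p 0 y + p 1 y) -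
      (max lam.re 0 + e) * sq (u 0 y + u 1 y) - 1 / (2 * e) *
      sq (Complex.I * (y * (u 0 y - u 1 y)) + 2 * a * u 2 y) - 1 / e * ∑ j, sq (f j y))
    (fun y => hasDerivAt_dot ((hs.deriv_u 0 y).add (hs.deriv_u 1 y)) (hs.hasDerivAt_deriv_sum y))
    (i2.sub (iF.const_mul _)) (fun y => ?_) (hs.decays_sum.tendsto_dot ip)
  · rw [integral_sub i2 (iF.const_mul _), integral_sub i1 (iq.const_mul _),
      integral_sub ip.int (iw.const_mul _), integral_const_mul, integral_const_mul,
      integral_const_mul] at h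
    linarith
  · simp only [Pi.add_apply]
    generalize Complex.I * (y * (u 0 y - u 1 y)) + 2 * a * u 2 y = q
    generalize u 0 y + u 1 y = w
    generalize p 0 y + p 1 y = r
    have h1 := abs_le.mp (abs_dot_le he w q)
    have h2 := abs_le.mp (abs_dot_le he w (f 0 y + f 1 y))
    have h3 : sq (f 0 y + f 1 y) ≤ 2 * ∑ j, sq (f j y) := by
      rw [Fin.sum_univ_three]
      linarith [sq_add_le (f 0 y) (f 1 y), sq_nonneg' (f 2 y)]
    have h4 : dot r r + dot w (q - lam * w - (f 0 y + f 1 y)) =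
        sq r + dot w q - lam.re * sq w - dot w (f 0 y + f 1 y) := by
      simp only [dot, sq, Complex.add_re, Complex.add_im, Complex.mul_re, Complex.mul_im,
        Complex.sub_re, Complex.sub_im]
      ring
    have h5 : lam.re * sq w ≤ max lam.re 0 * sq w :=
      mul_le_mul_of_nonneg_right (le_max_left _ _) (sq_nonneg' w)
    have h6 : 1 / (2 * e) * sq (f 0 y + f 1 y) ≤ 1 / e * ∑ j, sq (f j y) := by
      calc 1 / (2 * e) * sq (f 0 y + f 1 y) ≤ 1 / (2 * e) * (2 * ∑ j, sq (f j y)) := by gcongr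
        _ = _ := by field_simp
    rw [h4]
    linarith [h1.1, h2.2]

/-- The main estimate for moderate real parts. -/
theorem integral_sum_le (hs : BTSystem a lam u p f) {η s : ℝ} (hη : 0 < η) (hη1 : η ≤ 1)
    (hs0 : 0 < s) (ha : 0 < a) (hν : lam.im ^ 2 ≤ (1 - η) * (2 * a ^ 2)) :
    3 * η / 8 * (2 * a ^ 2 * (∫ y, sq (u 0 y + u 1 y)) +
      ∫ y, sq (Complex.I * (y * (u 0 y - u 1 y)) + 2 * a * u 2 y)) ≤
      9 / η * (∫ y, ∑ j, sq (f j y)) + s * (∫ y, sq (u 0 y - u 1 y)) +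
        1 / s * ∫ y, sq (p 0 y + p 1 y) := by
  have iF : Integrable fun y => ∑ j, sq (f j y) := integrable_finsetSum _ fun j _ => hs.int_f j
  have dw := hs.decays_sum
  have dv := hs.decays_diff
  have dr := (hs.decays_p 0).1.add (hs.decays_p 1).1
  have dq := hs.decays_flux
  have dq' := hs.decays_deriv_flux
  have i1 : Integrable fun y => 2 * a ^ 2 * sq (u 0 y + u 1 y) +
      sq (Complex.I * (y * (u 0 y - u 1 y)) + 2 * a * u 2 y) := (dw.int.const_mul _).add dq.int
  have i2 : Integrable fun y => 9 / η * (∑ j, sq (f j y)) + s * sq (u 0 y - u 1 y) :=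
    (iF.const_mul _).add (dv.int.const_mul _)
  have i3 : Integrable fun y => 9 / η * (∑ j, sq (f j y)) + s * sq (u 0 y - u 1 y) +
      1 / s * sq (p 0 y + p 1 y) := i2.add (dr.int.const_mul _)
  have h := integral_nonpos_of_le_deriv' (g := fun y => 3 * η / 8 * (2 * a ^ 2 *
      sq (u 0 y + u 1 y) + sq (Complex.I * (y * (u 0 y - u 1 y)) + 2 * a * u 2 y)) -
      (9 / η * (∑ j, sq (f j y)) + s * sq (u 0 y - u 1 y) + 1 / s * sq (p 0 y + p 1 y)))
    -- The Wronskian of q and w eliminates Re λ. The added multiple of `wdg` moves the derivative in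
    -- the commutator term from u₀ - u₁ to w.
    (fun y => ((hasDerivAt_dot (hs.hasDerivAt_flux y) (hs.hasDerivAt_deriv_sum y)).sub
      (hasDerivAt_dot (hs.hasDerivAt_deriv_flux y) ((hs.deriv_u 0 y).add (hs.deriv_u 1 y)))).add
        ((hasDerivAt_wdg ((hs.deriv_u 0 y).sub (hs.deriv_u 1 y))
          ((hs.deriv_u 0 y).add (hs.deriv_u 1 y))).const_mul 2))
    ((i1.const_mul _).sub i3) (fun y => ?_) ?_
  · rw [integral_sub (i1.const_mul _) i3, integral_const_mul, integral_add (dw.int.const_mul _)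
      dq.int, integral_const_mul, integral_add i2 (dr.int.const_mul _), integral_add
      (iF.const_mul _) (dv.int.const_mul _), integral_const_mul, integral_const_mul,
      integral_const_mul] at h
    linarith
  · simp only [Pi.add_apply, Pi.sub_apply]
    generalize Complex.I * (y * (u 0 y - u 1 y)) + 2 * a * u 2 y = q
    generalize u 0 y + u 1 y = w
    generalize p 0 y + p 1 y = r
    generalize u 0 y - u 1 y = v
    generalize p 0 y - p 1 y = v'
    set ν := lam.im with hν'
    have key : dot (Complex.I * v + Complex.I * (y * v') + 2 * a * p 2 y) r +
        dot q (q - lam * w - (f 0 y + f 1 y)) -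
        (dot (-(((y ^ 2 + 2 * a ^ 2 : ℝ) : ℂ) * w) - lam * q + 2 * Complex.I * v' -
          Complex.I * (y * (f 0 y - f 1 y)) - 2 * a * f 2 y) w +
          dot (Complex.I * v + Complex.I * (y * v') + 2 * a * p 2 y) r) +
        2 * (wdg v' w + wdg v r) =
        (y ^ 2 + 2 * a ^ 2) * sq w + sq q + 2 * ν * wdg q w + y * wdg (f 0 y - f 1 y) w +
          2 * a * dot (f 2 y) w - dot q (f 0 y + f 1 y) + 2 * wdg v r := by
      simp only [dot, wdg, sq, Complex.add_re, Complex.add_im, Complex.mul_re, Complex.mul_im,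
        Complex.sub_re, Complex.sub_im, Complex.neg_re, Complex.neg_im, Complex.ofReal_re,
        Complex.ofReal_im, Complex.I_re, Complex.I_im, Complex.re_ofNat, Complex.im_ofNat, ← hν']
      ring
    rw [key]
    have w0 := sq_nonneg' w
    have q0 := sq_nonneg' q
    -- Here the threshold enters: 2|ν||q||w| is strictly dominated by |q|² + 2a²|w|² precisely when
    -- ν² < 2a². The inequality 1 - η ≤ (1 - η/2)² leaves a margin η/2.
    have h1 : |2 * ν * wdg q w| ≤ (1 - η / 2) * (sq q + 2 * a ^ 2 * sq w) := by
      have hν2 : ν ^ 2 ≤ (1 - η / 2) ^ 2 * (2 * a ^ 2) :=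
        hν.trans (by gcongr; nlinarith [sq_nonneg η])
      have e1 : ν ^ 2 ≤ ((1 - η / 2) * (√2 * a)) ^ 2 := by
        rw [mul_pow, mul_pow, Real.sq_sqrt (by norm_num)]; exact hν2
      have hc : 0 < √2 * a := by positivity
      have e2 : |ν| ≤ (1 - η / 2) * (√2 * a) :=
        abs_le_of_sq_le_sq e1 (mul_nonneg (by linarith) hc.le)
      have e3 := abs_wdg_le (t := 1 / (√2 * a)) (by positivity) q w
      rw [abs_mul, abs_mul, abs_two]
      calc 2 * |ν| * |wdg q w| ≤ 2 * ((1 - η / 2) * (√2 * a)) * (1 / (√2 * a) / 2 * sq q +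
            1 / (2 * (1 / (√2 * a))) * sq w) := by
            gcongr
            exact mul_nonneg two_pos.le (mul_nonneg (by linarith) hc.le)
        _ = (1 - η / 2) * (sq q + (√2) ^ 2 * a ^ 2 * sq w) := by field_simp
        _ = _ := by rw [Real.sq_sqrt (by norm_num)]
    have fm : sq (f 0 y - f 1 y) ≤ 2 * (sq (f 0 y) + sq (f 1 y)) := by
      have := sq_add_le (f 0 y) (-f 1 y)
      have e : sq (-f 1 y) = sq (f 1 y) := by simp [sq]
      rw [e, ← sub_eq_add_neg] at this
      linarith
    have fp := sq_add_le (f 0 y) (f 1 y)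
    -- The positive term y²|w|² is spent entirely on the source that carries the unbounded factor y.
    have h2 : |y * wdg (f 0 y - f 1 y) w| ≤ y ^ 2 * sq w + 1 / 2 * (sq (f 0 y) + sq (f 1 y)) := by
      rcases eq_or_ne y 0 with rfl | hy
      · have := sq_nonneg' (f 0 0); have := sq_nonneg' (f 1 0)
        simp only [zero_mul, abs_zero, ne_eq, OfNat.ofNat_ne_zero, not_false_eq_true, zero_pow]
        positivity
      · have hy0 : 0 < |y| := abs_pos.mpr hy
        have e3 := abs_wdg_le (t := 1 / (2 * |y|)) (by positivity) (f 0 y - f 1 y) w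
        rw [abs_mul]
        calc |y| * |wdg (f 0 y - f 1 y) w| ≤ |y| * (1 / (2 * |y|) / 2 * sq (f 0 y - f 1 y) +
              1 / (2 * (1 / (2 * |y|))) * sq w) := by gcongr
          _ = |y| ^ 2 * sq w + 1 / 4 * sq (f 0 y - f 1 y) := by field_simp; ring
          _ ≤ _ := by rw [sq_abs]; linarith
    have h3 : |2 * a * dot (f 2 y) w| ≤ 4 / η * sq (f 2 y) + η / 8 * (2 * a ^ 2 * sq w) := by
      have e3 := abs_dot_le (t := 4 / (η * a)) (by positivity) (f 2 y) w
      rw [abs_mul, abs_mul, abs_two, abs_of_pos ha]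
      calc 2 * a * |dot (f 2 y) w| ≤ 2 * a * (4 / (η * a) / 2 * sq (f 2 y) +
            1 / (2 * (4 / (η * a))) * sq w) := by gcongr
        _ = _ := by field_simp; ring
    have h4 : |dot q (f 0 y + f 1 y)| ≤ η / 8 * sq q + 4 / η * (sq (f 0 y) + sq (f 1 y)) := by
      have e3 := abs_dot_le (t := η / 4) (by positivity) q (f 0 y + f 1 y)
      refine e3.trans ?_
      have : 1 / (2 * (η / 4)) * sq (f 0 y + f 1 y) ≤
          1 / (2 * (η / 4)) * (2 * sq (f 0 y) + 2 * sq (f 1 y)) := by gcongr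
      have e : 1 / (2 * (η / 4)) * (2 * sq (f 0 y) + 2 * sq (f 1 y)) =
        4 / η * (sq (f 0 y) + sq (f 1 y)) := by ring
      linarith
    have h5 : |2 * wdg v r| ≤ s * sq v + 1 / s * sq r := by
      have e3 := abs_wdg_le hs0 v r
      rw [abs_mul, abs_two]
      have : 1 / (2 * s) * sq r = 1 / s * sq r / 2 := by field_simp
      linarith
    have h6 : sq (f 0 y) + sq (f 1 y) ≤ 1 / η * (sq (f 0 y) + sq (f 1 y)) :=
      le_mul_of_one_le_left (add_nonneg (sq_nonneg' _) (sq_nonneg' _)) (one_le_one_div hη hη1)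
    have h7 : 0 ≤ 1 / η * sq (f 2 y) := by have := sq_nonneg' (f 2 y); positivity
    have h8 : ∀ t : ℝ, 9 / η * t = 9 * (1 / η * t) := fun t => by ring
    have h9 : ∀ t : ℝ, 4 / η * t = 4 * (1 / η * t) := fun t => by ring
    rw [h9] at h3 h4
    rw [h8, Fin.sum_univ_three]
    have h10 : 0 ≤ η * (2 * a ^ 2 * sq w) := by positivity
    have h11 : 0 ≤ η * sq q := by positivity
    have h12 : 0 ≤ 1 / η * (sq (f 0 y) + sq (f 1 y)) := by
      have := sq_nonneg' (f 0 y); have := sq_nonneg' (f 1 y); positivity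
    have h13 : 1 / η * (sq (f 0 y) + sq (f 1 y) + sq (f 2 y)) =
      1 / η * (sq (f 0 y) + sq (f 1 y)) + 1 / η * sq (f 2 y) := by ring
    rw [h13]
    linarith only [(abs_le.mp h1).1, (abs_le.mp h2).1, (abs_le.mp h3).1, (abs_le.mp h4).2,
      (abs_le.mp h5).1, h6, h7, h10, h11, h12]
  · have t1 := dq.tendsto_dot dr
    have t2 := dq'.tendsto_dot dw
    have t3 := dv.tendsto_wdg dw
    have t4 := (t1.sub t2).add (t3.const_mul 2)
    rw [sub_zero, mul_zero, add_zero] at t4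
    exact t4

end BTSystem

end BlochTorrey

/-! ### Moderate real parts, and rescaling for large real parts -/

namespace BlochTorrey

open Set Filter Topology

namespace BTSystem

variable {a : ℝ} {lam : ℂ} {u p f : Fin 3 → ℝ → ℂ}

theorem integral_sum_sq_le_two (hs : BTSystem a lam u p f) :
    ∫ y, sq (u 0 y + u 1 y) ≤ 2 * ∫ y, ∑ j, sq (u j y) := by
  have iU : Integrable fun y => ∑ j, sq (u j y) :=
    integrable_finsetSum _ fun j _ => (hs.decays_u j).1.int
  rw [← integral_const_mul]
  refine integral_mono hs.decays_sum.int (iU.const_mul 2) fun y => ?_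
  simp only [Fin.sum_univ_three]
  linarith [sq_add_le (u 0 y) (u 1 y), sq_nonneg' (u 2 y)]

theorem integral_diff_sq_le_two (hs : BTSystem a lam u p f) :
    ∫ y, sq (u 0 y - u 1 y) ≤ 2 * ∫ y, ∑ j, sq (u j y) := by
  have iU : Integrable fun y => ∑ j, sq (u j y) :=
    integrable_finsetSum _ fun j _ => (hs.decays_u j).1.int
  rw [← integral_const_mul]
  refine integral_mono hs.decays_diff.int (iU.const_mul 2) fun y => ?_
  simp only [Fin.sum_univ_three]
  have h := sq_add_le (u 0 y) (-u 1 y)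
  have e : sq (-u 1 y) = sq (u 1 y) := by simp [sq]
  rw [e, ← sub_eq_add_neg] at h
  linarith [sq_nonneg' (u 2 y)]

/-- The estimate of `u₀ + u₁` for moderate real parts of `lam`. -/
theorem sum_estimate_moderate (hs : BTSystem a lam u p f) {η e : ℝ} (hη : 0 < η) (hη1 : η ≤ 1)
    (ha : 0 < a) (he : 0 < e) (hae : 2 * a ^ 2 = e ^ 2) (hν0 : lam.im ≠ 0)
    (hν : lam.im ^ 2 ≤ (1 - η) * e ^ 2)
    (hre : 1024 * (max lam.re 0 + e) ≤ η ^ 2 * e ^ 4) :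
    ∫ y, sq (u 0 y + u 1 y) ≤ 128 / (η ^ 2 * e ^ 2) *
      (1 + (max lam.re 0 + e) / (e ^ 2 * lam.im ^ 2)) * ∫ y, ∑ j, sq (f j y) := by
  set Λ := max lam.re 0 with hΛ
  have hΛ0 : 0 ≤ Λ := le_max_right _ _
  -- This weight balances the product of u₀ - u₁ and w': the share of w' becomes ηe²/16 times |w|²,
  -- while the share of u₀ - u₁ is that small exactly when `hre` holds.
  set s : ℝ := 16 * (Λ + e) / (η * e ^ 2) with hs'
  have hs0 : 0 < s := by positivity
  have h1 := hs.integral_sum_le hη hη1 hs0 ha (by rwa [hae])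
  have h2 := hs.integral_deriv_sum_le he
  have h3 := hs.integral_sq_le hν0
  have h4 := hs.integral_diff_sq_le_two
  rw [hae] at h1
  set w2 := ∫ y, sq (u 0 y + u 1 y)
  set q2 := ∫ y, sq (Complex.I * (y * (u 0 y - u 1 y)) + 2 * a * u 2 y)
  set d2 := ∫ y, sq (p 0 y + p 1 y)
  set v2 := ∫ y, sq (u 0 y - u 1 y)
  set U := ∫ y, ∑ j, sq (u j y)
  set Q := ∫ y, ∑ j, sq (f j y)
  have hw0 : 0 ≤ w2 := integral_nonneg fun y => sq_nonneg' _
  have hq0 : 0 ≤ q2 := integral_nonneg fun y => sq_nonneg' _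
  have hQ0 : 0 ≤ Q := integral_nonneg fun y => Finset.sum_nonneg fun j _ => sq_nonneg' _
  have e1 : 1 / s * d2 ≤ η / 16 * (e ^ 2 * w2) + η / 32 * q2 + η / 16 * Q := by
    have hsi : 1 / s = η * e ^ 2 / (16 * (Λ + e)) := by rw [hs', one_div_div]
    have hle : e / (Λ + e) ≤ 1 := by rw [div_le_one (by positivity)]; linarith
    calc 1 / s * d2 ≤ 1 / s * ((Λ + e) * w2 + 1 / (2 * e) * q2 + 1 / e * Q) := by gcongr
      _ = η / 16 * (e ^ 2 * w2) + e / (Λ + e) * (η / 32 * q2) + e / (Λ + e) * (η / 16 * Q) := by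
        rw [hsi]; field_simp; ring
      _ ≤ η / 16 * (e ^ 2 * w2) + 1 * (η / 32 * q2) + 1 * (η / 16 * Q) := by gcongr
      _ = _ := by ring
  have e2 : s * v2 ≤ η / 16 * (e ^ 2 * w2) + 2 * s * (1 / lam.im ^ 2 * Q) := by
    have h5 : v2 ≤ 4 * w2 + 2 * (1 / lam.im ^ 2 * Q) := by linarith
    have h6 : 4 * s ≤ η / 16 * e ^ 2 := by
      rw [hs', mul_div_assoc', div_le_iff₀ (by positivity)]
      linarith
    calc s * v2 ≤ s * (4 * w2 + 2 * (1 / lam.im ^ 2 * Q)) := by gcongr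
      _ = 4 * s * w2 + 2 * s * (1 / lam.im ^ 2 * Q) := by ring
      _ ≤ η / 16 * e ^ 2 * w2 + 2 * s * (1 / lam.im ^ 2 * Q) := by gcongr
      _ = _ := by ring
  have e3 : η / 16 * Q ≤ 1 / η * Q := by
    refine mul_le_mul_of_nonneg_right ?_ hQ0
    rw [div_le_div_iff₀ (by norm_num) hη]
    nlinarith
  have e4 : η / 4 * (e ^ 2 * w2) ≤ 10 / η * Q + 2 * s * (1 / lam.im ^ 2 * Q) := by
    have : 10 / η * Q = 9 / η * Q + 1 / η * Q := by ring
    have : 0 ≤ η * q2 := by positivity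
    linarith
  have e5 : w2 ≤ 4 / (η * e ^ 2) * (10 / η * Q + 2 * s * (1 / lam.im ^ 2 * Q)) := by
    calc w2 = 4 / (η * e ^ 2) * (η / 4 * (e ^ 2 * w2)) := by field_simp
      _ ≤ _ := by gcongr
  refine e5.trans ?_
  have e6 : 4 / (η * e ^ 2) * (10 / η * Q + 2 * s * (1 / lam.im ^ 2 * Q)) =
      1 / (η ^ 2 * e ^ 2) * (40 + 128 * ((Λ + e) / (e ^ 2 * lam.im ^ 2))) * Q := by
    rw [hs']; field_simp; ring
  have e7 : 128 / (η ^ 2 * e ^ 2) * (1 + (Λ + e) / (e ^ 2 * lam.im ^ 2)) * Q =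
      1 / (η ^ 2 * e ^ 2) * (128 + 128 * ((Λ + e) / (e ^ 2 * lam.im ^ 2))) * Q := by ring
  rw [e6, e7]
  gcongr
  norm_num

/-- The rescaled system. -/
theorem semiSystem (hs : BTSystem a lam u p f) {σ : ℝ} (hσ : 0 < σ) (hre : 4 * lam.re = σ ^ 4) :
    SemiSystem (σ ^ 3 / 2) (a / σ) (lam.im / σ)
      (fun j y => ![1, 1, -Complex.I] j * u j (σ * y))
      (fun j y => ![1, 1, -Complex.I] j * (-(2 / σ ^ 2 : ℝ) * Complex.I * p j (σ * y)))
      (fun j y => ![1, 1, -Complex.I] j * ((1 / σ : ℝ) * f j (σ * y))) := by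
  -- The condition 4 Re λ = σ⁴ makes k² = σ² Re λ for k = σ³/2. The phase -i on the third component
  -- turns the antisymmetric coupling into i times a real symmetric one.
  have hl : ∀ y : ℝ, HasDerivAt (fun t : ℝ => σ * t) σ y := fun y => by
    simpa using (hasDerivAt_id y).const_mul σ
  have hσc : (σ : ℂ) ≠ 0 := by exact_mod_cast hσ.ne'
  have hlam : lam = ((σ ^ 4 / 4 : ℝ) : ℂ) + lam.im * Complex.I := by
    conv_lhs => rw [← Complex.re_add_im lam]
    rw [← hre]; push_cast; ring
  refine ⟨fun j y => ?_, fun j y => ?_⟩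
  · refine (((hs.deriv_u j (σ * y)).scomp y (hl y)).const_mul _).congr_deriv ?_
    rw [Complex.real_smul]
    push_cast
    field_simp
    linear_combination (![1, 1, -Complex.I] j * p j (σ * y)) * Complex.I_sq
  · refine ((((hs.deriv_p j (σ * y)).scomp y (hl y)).const_mul _).const_mul _).congr_deriv ?_
    rw [Complex.real_smul]
    fin_cases j <;> simp [rhsB, mulM] <;> (conv_lhs => rw [hlam]) <;> push_cast <;> field_simp
    · linear_combination (16 * (lam.im - σ * y) * u 0 (σ * y)) * Complex.I_sq
    · linear_combination (16 * (lam.im + σ * y) * u 1 (σ * y)) * Complex.I_sq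
    · linear_combination (-(16 * (a * (u 0 (σ * y) + u 1 (σ * y)) +
        Complex.I * lam.im * u 2 (σ * y)))) * Complex.I_sq

end BTSystem

theorem sq_phase (j : Fin 3) (x : ℂ) : sq ((![1, 1, -Complex.I] : Fin 3 → ℂ) j * x) = sq x := by
  fin_cases j <;> simp [sq, add_comm]

theorem sq_real_mul (c : ℝ) (x : ℂ) : sq ((c : ℂ) * x) = c ^ 2 * sq x := by
  simp only [sq, Complex.mul_re, Complex.mul_im, Complex.ofReal_re, Complex.ofReal_im]
  ring

theorem sq_real_mul_I_mul (c : ℝ) (x : ℂ) : sq ((c : ℂ) * Complex.I * x) = c ^ 2 * sq x := by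
  rw [mul_assoc, sq_real_mul]
  simp [sq, add_comm]

theorem one_add_abs_le {σ : ℝ} (hσ : 0 < σ) (y : ℝ) :
    1 + |y| ≤ (2 + 1 / σ ^ 2) * (1 + (σ * y) ^ 2) := by
  have h1 : |y| ≤ 1 + y ^ 2 := by
    rw [← sq_abs y]; nlinarith [sq_nonneg (|y| - 1), abs_nonneg y]
  have h2 : (2 + 1 / σ ^ 2) * (1 + (σ * y) ^ 2) = 2 + y ^ 2 + 2 * (σ * y) ^ 2 + 1 / σ ^ 2 := by
    field_simp; ring
  rw [h2]
  nlinarith [sq_nonneg (σ * y), one_div_pos.2 (pow_pos hσ 2)]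

/-- The estimate for large real parts of `lam`. -/
theorem exists_estimate_large {V : ℝ} (hV : 1 ≤ V) : ∃ η C : ℝ, 0 < η ∧ 0 < C ∧
    ∀ (a : ℝ) (lam : ℂ) (σ : ℝ) (u p f : Fin 3 → ℝ → ℂ), BTSystem a lam u p f →
      0 < a → 0 < σ → 4 * lam.re = σ ^ 4 → 0 < lam.im → a / σ ≤ V → lam.im / σ ≤ V →
      2 ≤ η * a ^ 3 →
      ∫ y, ∑ j, sq (u j y) ≤
        C * (σ ^ 2 / a ^ 3 + 1 / lam.im) ^ 2 * ∫ y, ∑ j, sq (f j y) := by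
  obtain ⟨η, C, hη, hC, H⟩ := exists_semi_estimate hV
  refine ⟨η, C, hη, hC, fun a lam σ u p f hs ha hσ hre hν haV hνV hlarge => ?_⟩
  have hemb : Tendsto (fun y : ℝ => σ * y) (cocompact ℝ) (cocompact ℝ) :=
    (Homeomorph.mulLeft₀ σ hσ.ne').isClosedEmbedding.tendsto_cocompact
  have hint : ∀ {g : ℝ → ℝ}, Integrable g → Integrable fun y => g (σ * y) := fun hg =>
    hg.comp_mul_left' hσ.ne'
  have cu : ∀ j, Continuous (u j) := fun j =>
    continuous_iff_continuousAt.2 fun y => (hs.deriv_u j y).continuousAt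
  have h0 : 0 ≤ 2 + 1 / σ ^ 2 := by positivity
  have := H (a / σ) (lam.im / σ) (2 / σ ^ 3) (σ ^ 3 / 2) _ _ _ (by positivity) haV (by positivity)
    hνV (by positivity) ?_ (by field_simp) (hs.semiSystem hσ hre) ?_ ?_ ?_ ?_ ?_ ?_
  · simp only [sq_phase, sq_real_mul, ← Finset.mul_sum] at this
    rw [Measure.integral_comp_mul_left (fun y => ∑ j, sq (u j y)) σ, integral_const_mul,
      Measure.integral_comp_mul_left (fun y => ∑ j, sq (f j y)) σ, abs_of_pos (inv_pos.2 hσ),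
      smul_eq_mul, smul_eq_mul] at this
    have h1 := mul_le_mul_of_nonneg_left this hσ.le
    rw [mul_inv_cancel_left₀ hσ.ne'] at h1
    refine h1.trans (le_of_eq ?_)
    field_simp
  -- The smallness 2/σ³ ≤ η(a/σ)³ does not depend on σ: it reduces to 2 ≤ ηa³, that is, to ε being
  -- small.
  · rw [div_pow, mul_div_assoc']
    gcongr
  · intro j
    simp only [sq_phase]
    refine ((hint (hs.int_u j)).const_mul (2 + 1 / σ ^ 2)).mono'
      (Continuous.aestronglyMeasurable (by
        have := continuous_sq ((cu j).comp (continuous_const.mul continuous_id : Continuous fun y => σ * y))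
        simp only [Function.comp_def] at this
        fun_prop)) (ae_of_all _ fun y => ?_)
    rw [Real.norm_of_nonneg (mul_nonneg (by positivity) (sq_nonneg' _)), ← mul_assoc]
    exact mul_le_mul_of_nonneg_right (one_add_abs_le hσ y) (sq_nonneg' _)
  · intro j
    simp only [sq_phase]
    exact hint (hs.decays_u j).1.int
  · intro j
    simp only [sq_phase, ← Complex.ofReal_neg, sq_real_mul_I_mul]
    exact (hint (hs.decays_p j).1.int).const_mul _
  · intro j
    simp only [sq_phase, sq_real_mul]
    exact (hint (hs.int_f j)).const_mul _
  · intro j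
    simp only [sq_phase]
    have h1 := ((hs.lim_u j).comp hemb).const_mul (2 + 1 / σ ^ 2)
    rw [mul_zero] at h1
    refine squeeze_zero (fun y => mul_nonneg (by positivity) (sq_nonneg' _)) (fun y => ?_) h1
    simp only [Function.comp_apply]
    rw [← mul_assoc]
    exact mul_le_mul_of_nonneg_right (one_add_abs_le hσ y) (sq_nonneg' _)
  · intro j
    simp only [sq_phase, ← Complex.ofReal_neg, sq_real_mul_I_mul]
    have h1 := ((hs.decays_p j).1.lim.comp hemb).const_mul ((-(2 / σ ^ 2)) ^ 2)
    rw [mul_zero] at h1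
    exact h1

end BlochTorrey

/-! ### The a priori estimate of u₀ + u₁, with both regimes combined -/

namespace BlochTorrey

open Set Filter Topology

/-- Conjugation with exchange of the first two components replaces λ by its conjugate and preserves
all norms, so Im λ > 0 may be assumed. -/
theorem estimate_large_abs {a B : ℝ} {P : ℝ → ℝ → Prop}
    (H : ∀ (lam : ℂ) (u p f : Fin 3 → ℝ → ℂ), BTSystem a lam u p f → P lam.re |lam.im| →
      0 < lam.im → ∫ y, ∑ j, sq (u j y) ≤ B * ∫ y, ∑ j, sq (f j y))
    {lam : ℂ} {u p f : Fin 3 → ℝ → ℂ} (hs : BTSystem a lam u p f) (hP : P lam.re |lam.im|)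
    (h0 : lam.im ≠ 0) : ∫ y, ∑ j, sq (u j y) ≤ B * ∫ y, ∑ j, sq (f j y) := by
  rcases h0.lt_or_gt with h | h
  · have := H _ _ _ _ hs.conj (by simpa using hP) (by simpa using h)
    have e : ∀ x : ℂ, sq ((starRingEnd ℂ) x) = sq x := fun x => by simp [sq]
    have eu : ∀ (g : Fin 3 → ℝ → ℂ) (y : ℝ), ∑ j, sq (starRingEnd ℂ (g (Equiv.swap 0 1 j) y)) =
        ∑ j, sq (g j y) := fun g y => by
      simp only [e]
      exact Equiv.sum_comp (Equiv.swap (0 : Fin 3) 1) fun j => sq (g j y)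
    simpa only [eu] using this
  · exact H _ _ _ _ hs hP h

/-- In this and the next lemma r = √ε, L is the square root of the positive part of Re λ, and n =
|Im λ|. The comparison is (rL)² + r ≤ (1 + rL)², valid for r ≤ 1. -/
theorem combine_moderate {η r L n Q w : ℝ} (hη : 0 < η) (hr : 0 < r) (hr1 : r ≤ 1) (hL : 0 ≤ L)
    (hn : 0 < n) (hQ : 0 ≤ Q)
    (h : w ≤ 128 / (η ^ 2 * (1 / r) ^ 2) * (1 + (L ^ 2 + 1 / r) / ((1 / r) ^ 2 * n ^ 2)) * Q) :
    w ≤ (12 / η * r * (1 + (1 + r * L) / n)) ^ 2 * Q := by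
  refine h.trans (mul_le_mul_of_nonneg_right ?_ hQ)
  have e1 : 128 / (η ^ 2 * (1 / r) ^ 2) * (1 + (L ^ 2 + 1 / r) / ((1 / r) ^ 2 * n ^ 2)) =
      128 * (r / η) ^ 2 * (1 + ((r * L) ^ 2 + r) / n ^ 2) := by
    field_simp
  have e2 : (12 / η * r * (1 + (1 + r * L) / n)) ^ 2 =
      144 * (r / η) ^ 2 * (1 + (1 + r * L) ^ 2 / n ^ 2 + 2 * (1 + r * L) / n) := by
    field_simp
    ring
  rw [e1, e2]
  have hrL : 0 ≤ r * L := by positivity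
  have h1 : ((r * L) ^ 2 + r) / n ^ 2 ≤ (1 + r * L) ^ 2 / n ^ 2 := by
    gcongr
    nlinarith
  have h2 : 0 ≤ 2 * (1 + r * L) / n := by positivity
  refine mul_le_mul (by gcongr; norm_num) (by linarith) (by positivity) (by positivity)

/-- Both contributions are bounded by multiples of r · rL/n: L/a³ because a is comparable to 1/r and
nr ≤ 1, and 1/n because Lr² ≥ c. -/
theorem combine_large {C c r a L n Q U w : ℝ} (hC : 0 < C) (hc : 0 < c) (hr : 0 < r)
    (ha : 0 < a) (hL : 0 < L) (hn : 0 < n) (hQ : 0 ≤ Q) (har : 2 * a ^ 2 = (1 / r) ^ 2)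
    (hnr : n * r ≤ 1) (hcL : c ≤ L * r ^ 2) (hw : w ≤ 2 * U)
    (h : U ≤ C * (2 * L / a ^ 3 + 1 / n) ^ 2 * Q) :
    w ≤ ((2 * C + 1) * (8 + 1 / c) * r * (1 + (1 + r * L) / n)) ^ 2 * Q := by
  have har' : 2 * (a * r) ^ 2 = 1 := by
    rw [mul_pow, ← mul_assoc, har]; field_simp
  have h1 : a * r ≤ 1 := by
    by_contra hlt
    nlinarith
  have h2 : 1 / a ^ 3 ≤ 4 * r ^ 3 := by
    rw [div_le_iff₀ (by positivity)]
    have : 4 * r ^ 3 * a ^ 3 = 2 * (a * r) * (2 * (a * r) ^ 2) := by ring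
    rw [this, har']
    nlinarith [mul_pos ha hr]
  have h3 : 2 * L / a ^ 3 ≤ 8 * (r * (r * L / n)) := by
    calc 2 * L / a ^ 3 = 2 * L * (1 / a ^ 3) := by ring
      _ ≤ 2 * L * (4 * r ^ 3) := by gcongr
      _ = 8 * L * r ^ 2 / n * (n * r) := by field_simp; norm_num
      _ ≤ 8 * L * r ^ 2 / n * 1 := by gcongr
      _ = _ := by ring
  have h4 : 1 / n ≤ 1 / c * (r * (r * L / n)) := by
    calc 1 / n = 1 / c * (c / n) := by field_simp
      _ ≤ 1 / c * (L * r ^ 2 / n) := by gcongr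
      _ = _ := by ring
  have h5 : 2 * L / a ^ 3 + 1 / n ≤ (8 + 1 / c) * r * (1 + (1 + r * L) / n) := by
    calc 2 * L / a ^ 3 + 1 / n ≤ (8 + 1 / c) * r * (r * L / n) := by linarith
      _ ≤ (8 + 1 / c) * r * (1 + (1 + r * L) / n) := by
        gcongr
        have : (1 + r * L) / n = 1 / n + r * L / n := by ring
        have : 0 < 1 / n := by positivity
        linarith
  calc w ≤ 2 * (C * (2 * L / a ^ 3 + 1 / n) ^ 2 * Q) := by linarith
    _ ≤ 2 * (C * ((8 + 1 / c) * r * (1 + (1 + r * L) / n)) ^ 2 * Q) := by gcongr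
    _ = 2 * C * ((8 + 1 / c) * r * (1 + (1 + r * L) / n)) ^ 2 * Q := by ring
    _ ≤ (2 * C + 1) ^ 2 * ((8 + 1 / c) * r * (1 + (1 + r * L) / n)) ^ 2 * Q := by
      gcongr
      nlinarith
    _ = _ := by ring

/-- The a priori estimate of `u₀ + u₁`, with `r = √ε`. -/
theorem exists_sum_estimate {η : ℝ} (hη : 0 < η) (hη1 : η ≤ 1) :
    ∃ r₀ C : ℝ, 0 < r₀ ∧ r₀ ≤ 1 ∧ 0 < C ∧ ∀ (r a L : ℝ) (lam : ℂ) (u p f : Fin 3 → ℝ → ℂ),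
      BTSystem a lam u p f → 0 < r → r < r₀ → 0 < a → 2 * a ^ 2 = (1 / r) ^ 2 → 0 ≤ L →
      L ^ 2 = max lam.re 0 → lam.im ≠ 0 → lam.im ^ 2 ≤ (1 - η) * (1 / r) ^ 2 →
      ∫ y, sq (u 0 y + u 1 y) ≤
        (C * r * (1 + (1 + r * L) / |lam.im|)) ^ 2 * ∫ y, ∑ j, sq (f j y) := by
  -- Outside the moderate regime η² < 1024((Lr²)² + r³), and r³ ≤ η²/2048, so 2048(Lr²)² > η². Since
  -- 46² > 2048, this gives Lr² ≥ η/46.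
  set c : ℝ := η / 46 with hc'
  have hc : 0 < c := by positivity
  have hc1 : c ≤ 1 := by rw [hc']; linarith
  obtain ⟨η', C, hη', hC, H⟩ := exists_estimate_large (V := 1 / c) (by rw [le_div_iff₀ hc]; linarith)
  set r₀ := min 1 (min (η ^ 2 / 2048) (η' / 16)) with hr₀
  refine ⟨r₀, 12 / η + (2 * C + 1) * (8 + 1 / c), by positivity, min_le_left _ _, by positivity,
    fun r a L lam u p f hs hr hrr ha har hL hL2 h0 hν => ?_⟩
  have hr1 : r ≤ 1 := (hrr.trans_le (min_le_left _ _)).le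
  have hr2 : r ≤ η ^ 2 / 2048 := (hrr.trans_le ((min_le_right _ _).trans (min_le_left _ _))).le
  have hr3 : r ≤ η' / 16 := (hrr.trans_le ((min_le_right _ _).trans (min_le_right _ _))).le
  have hn : 0 < |lam.im| := abs_pos.2 h0
  have hcube : r ^ 3 ≤ r := by
    calc r ^ 3 = r * (r * r) := by ring
      _ ≤ r * (1 * 1) := by gcongr
      _ = r := by ring
  set Q := ∫ y, ∑ j, sq (f j y) with hQ'
  have hQ : 0 ≤ Q := integral_nonneg fun y => Finset.sum_nonneg fun j _ => sq_nonneg' _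
  have mono : ∀ {K w : ℝ}, 0 ≤ K → K ≤ 12 / η + (2 * C + 1) * (8 + 1 / c) →
      w ≤ (K * r * (1 + (1 + r * L) / |lam.im|)) ^ 2 * Q →
      w ≤ ((12 / η + (2 * C + 1) * (8 + 1 / c)) * r * (1 + (1 + r * L) / |lam.im|)) ^ 2 * Q :=
    fun {K w} hK hle hw => hw.trans (by gcongr)
  rcases le_or_gt (1024 * (max lam.re 0 + 1 / r)) (η ^ 2 * (1 / r) ^ 4) with hcase | hcase
  · have := hs.sum_estimate_moderate hη hη1 ha (by positivity) har h0 hν hcase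
    rw [← hL2] at this
    refine mono (by positivity) (le_add_of_nonneg_right (by positivity))
      (combine_moderate hη hr hr1 hL hn hQ ?_)
    rwa [sq_abs]
  · have hcL : c ≤ L * r ^ 2 := by
      rw [← hL2] at hcase
      have h1 : η ^ 2 < 1024 * ((L * r ^ 2) ^ 2 + r ^ 3) := by
        calc η ^ 2 = η ^ 2 * (1 / r) ^ 4 * r ^ 4 := by field_simp
          _ < 1024 * (L ^ 2 + 1 / r) * r ^ 4 := by gcongr
          _ = _ := by field_simp
      have h2 : (46 * c) ^ 2 ≤ 2048 * (L * r ^ 2) ^ 2 := by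
        rw [hc', mul_div_cancel₀ _ (by norm_num)]; linarith
      refine le_of_sq_le_sq ?_ (by positivity)
      nlinarith
    have hL0 : 0 < L := by
      by_contra hneg
      have : L = 0 := le_antisymm (not_lt.1 hneg) hL
      rw [this] at hcL
      linarith
    have hre : lam.re = L ^ 2 := by
      rw [hL2]
      rcases le_total lam.re 0 with h | h
      · rw [max_eq_right h] at hL2; exact absurd hL2 (by positivity)
      · rw [max_eq_left h]
    have hnr : |lam.im| * r ≤ 1 := by
      rw [← abs_of_pos hr, ← abs_mul, ← sq_le_one_iff_abs_le_one, mul_pow]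
      calc lam.im ^ 2 * r ^ 2 ≤ (1 - η) * (1 / r) ^ 2 * r ^ 2 := by gcongr
        _ = 1 - η := by field_simp
        _ ≤ 1 := by linarith
    have har' : 2 * (a * r) ^ 2 = 1 := by
      rw [mul_pow, ← mul_assoc, har]; field_simp
    have har1 : 1 / 2 ≤ a * r := by
      by_contra hlt
      nlinarith [mul_pos ha hr]
    have har2 : a * r ≤ 1 := by
      by_contra hlt
      nlinarith
    set σ := √(2 * L) with hσ'
    have hσ : 0 < σ := Real.sqrt_pos.2 (by positivity)
    have hσ2 : σ ^ 2 = 2 * L := Real.sq_sqrt (by positivity)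
    have hσr : c ≤ σ * r := by
      refine le_of_sq_le_sq ?_ (by positivity)
      rw [mul_pow, hσ2]
      nlinarith
    have hlarge : 2 ≤ η' * a ^ 3 := by
      have h1 : 1 / 8 ≤ (a * r) ^ 3 := by
        calc (1 / 8 : ℝ) = (1 / 2) ^ 3 := by norm_num
          _ ≤ _ := by gcongr
      have h2 : 2 * r ^ 3 ≤ η' * a ^ 3 * r ^ 3 := by
        calc 2 * r ^ 3 ≤ η' * (1 / 8) := by linarith
          _ ≤ η' * (a * r) ^ 3 := by gcongr
          _ = _ := by ring
      exact le_of_mul_le_mul_right h2 (by positivity)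
    have hbound : ∀ {t : ℝ}, 0 ≤ t → t * r ≤ 1 → t / σ ≤ 1 / c := fun {t} ht htr => by
      rw [div_le_div_iff₀ hσ hc, one_mul]
      refine le_of_mul_le_mul_right ?_ hr
      calc t * c * r = t * r * c := by ring
        _ ≤ 1 * c := by gcongr
        _ ≤ σ * r := by linarith
    have hU := estimate_large_abs (a := a) (P := fun x n => x = L ^ 2 ∧ n = |lam.im|)
      (B := C * (2 * L / a ^ 3 + 1 / |lam.im|) ^ 2) (fun lam' u p f hs' hP h0' => by
        obtain ⟨h1, h2⟩ := hP
        rw [abs_of_pos h0'] at h2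
        rw [← h2, ← hσ2]
        exact H a lam' σ u p f hs' ha hσ (by rw [h1]; linear_combination -(σ ^ 2 + 2 * L) * hσ2) h0'
          (hbound ha.le har2) (hbound h0'.le (by rw [h2]; exact hnr)) hlarge) hs ⟨hre, rfl⟩ h0
    exact mono (by positivity) (le_add_of_nonneg_left (by positivity))
      (combine_large hC hc hr ha hL0 hn hQ har hnr hcL hs.integral_sum_sq_le_two hU)

end BlochTorrey

namespace BlochTorrey

open Set Filter Topology

/-! ### The operator on Schwartz functions -/

/-- Multiplication by the coordinate. -/
noncomputable def xMul : 𝓢(ℝ, ℂ) →L[ℂ] 𝓢(ℝ, ℂ) := SchwartzMap.smulLeftCLM ℂ fun x : ℝ => (x : ℂ)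

theorem xMul_apply (φ : 𝓢(ℝ, ℂ)) (x : ℝ) : xMul φ x = x * φ x := by
  rw [xMul, SchwartzMap.smulLeftCLM_apply_apply (by fun_prop), smul_eq_mul]

/-- The second derivative. -/
noncomputable def dd : 𝓢(ℝ, ℂ) →L[ℂ] 𝓢(ℝ, ℂ) :=
  SchwartzMap.derivCLM ℂ ℂ ∘L SchwartzMap.derivCLM ℂ ℂ

theorem laplacian_eq_dd (φ : 𝓢(ℝ, ℂ)) : Laplacian.laplacian φ = dd φ := by
  ext x
  rw [SchwartzMap.laplacian_apply, InnerProductSpace.laplacian_eq_iteratedDeriv_real,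
    iteratedDeriv_succ, iteratedDeriv_one]
  rfl

theorem hasDerivAt_schwartz (φ : 𝓢(ℝ, ℂ)) (y : ℝ) :
    HasDerivAt φ (SchwartzMap.derivCLM ℂ ℂ φ y) y := φ.hasDerivAt y

theorem hasDerivAt_derivCLM (φ : 𝓢(ℝ, ℂ)) (y : ℝ) :
    HasDerivAt (SchwartzMap.derivCLM ℂ ℂ φ) (dd φ y) y :=
  (SchwartzMap.derivCLM ℂ ℂ φ).hasDerivAt y

/-- The operator minus `lam`, on triples of Schwartz functions. -/
noncomputable def opB (a : ℝ) (lam : ℂ) : (Fin 3 → 𝓢(ℝ, ℂ)) →ₗ[ℂ] (Fin 3 → 𝓢(ℝ, ℂ)) where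
  toFun φ := ![-dd (φ 0) + Complex.I • xMul (φ 0) + (a : ℂ) • φ 2 - lam • φ 0,
    -dd (φ 1) - Complex.I • xMul (φ 1) + (a : ℂ) • φ 2 - lam • φ 1,
    -((a : ℂ) • φ 0) - (a : ℂ) • φ 1 - dd (φ 2) - lam • φ 2]
  map_add' φ ψ := by
    ext j x
    fin_cases j <;> simp <;> ring
  map_smul' c φ := by
    ext j x
    fin_cases j <;> simp <;> ring

theorem opB_zero_apply (a : ℝ) (lam : ℂ) (φ : Fin 3 → 𝓢(ℝ, ℂ)) : opB a lam φ 0 =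
    -dd (φ 0) + Complex.I • xMul (φ 0) + (a : ℂ) • φ 2 - lam • φ 0 := rfl

theorem opB_one_apply (a : ℝ) (lam : ℂ) (φ : Fin 3 → 𝓢(ℝ, ℂ)) : opB a lam φ 1 =
    -dd (φ 1) - Complex.I • xMul (φ 1) + (a : ℂ) • φ 2 - lam • φ 1 := rfl

theorem opB_two_apply (a : ℝ) (lam : ℂ) (φ : Fin 3 → 𝓢(ℝ, ℂ)) : opB a lam φ 2 =
    -((a : ℂ) • φ 0) - (a : ℂ) • φ 1 - dd (φ 2) - lam • φ 2 := rfl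

theorem integrable_sq (φ : 𝓢(ℝ, ℂ)) : Integrable fun y => sq (φ y) := by
  simp only [sq_eq]
  exact (memLp_two_iff_integrable_sq_norm φ.continuous.aestronglyMeasurable).1 (φ.memLp 2)

theorem tendsto_sq (φ : 𝓢(ℝ, ℂ)) : Tendsto (fun y => sq (φ y)) (cocompact ℝ) (𝓝 0) := by
  simp only [sq_eq]
  simpa using (φ.tendsto_cocompact.norm).pow 2

theorem decays_schwartz (φ : 𝓢(ℝ, ℂ)) : Decays φ := ⟨φ.continuous, integrable_sq φ, tendsto_sq φ⟩

theorem one_add_sq_mul_sq (φ : 𝓢(ℝ, ℂ)) (y : ℝ) :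
    (1 + y ^ 2) * sq (φ y) = sq (φ y) + sq (xMul φ y) := by
  rw [xMul_apply, sq_real_mul]
  ring

theorem btSystem_schwartz (a : ℝ) (lam : ℂ) (φ : Fin 3 → 𝓢(ℝ, ℂ)) :
    BTSystem a lam (fun j => φ j) (fun j => SchwartzMap.derivCLM ℂ ℂ (φ j))
      (fun j => opB a lam φ j) where
  deriv_u j y := hasDerivAt_schwartz (φ j) y
  deriv_p j y := by
    refine (hasDerivAt_derivCLM (φ j) y).congr_deriv ?_
    fin_cases j
    · simp [rhsB, opB_zero_apply, xMul_apply]; ring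
    · simp [rhsB, opB_one_apply, xMul_apply]; ring
    · simp [rhsB, opB_two_apply]; ring
  int_u j := by
    simp only [one_add_sq_mul_sq]
    exact (integrable_sq _).add (integrable_sq _)
  int_p j := by
    simp only [one_add_sq_mul_sq]
    exact (integrable_sq _).add (integrable_sq _)
  int_f j := integrable_sq _
  lim_u j := by
    simp only [one_add_sq_mul_sq]
    simpa using (tendsto_sq (φ j)).add (tendsto_sq (xMul (φ j)))
  lim_p j := by
    simp only [one_add_sq_mul_sq]
    simpa using (tendsto_sq (SchwartzMap.derivCLM ℂ ℂ (φ j))).add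
      (tendsto_sq (xMul (SchwartzMap.derivCLM ℂ ℂ (φ j))))

/-- The embedding of triples of Schwartz functions. -/
noncomputable def embed : (Fin 3 → 𝓢(ℝ, ℂ)) →ₗ[ℂ] L2Vec :=
  (WithLp.linearEquiv 2 ℂ (Fin 3 → L2)).symm.toLinearMap ∘ₗ
    LinearMap.pi fun j => (SchwartzMap.toLpCLM ℂ ℂ 2 volume).toLinearMap ∘ₗ LinearMap.proj j

theorem norm_toLp_sq (φ : 𝓢(ℝ, ℂ)) : ‖φ.toLp 2‖ ^ 2 = ∫ y, sq (φ y) := by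
  rw [SchwartzMap.norm_toLp' (by norm_num) (by norm_num)]
  have h0 : 0 ≤ ∫ x, ‖φ x‖ ^ (2 : ℝ≥0∞).toReal := integral_nonneg fun _ => by positivity
  rw [← Real.rpow_natCast, ← Real.rpow_mul h0]
  simp [sq_eq]

theorem norm_embed_sq (φ : Fin 3 → 𝓢(ℝ, ℂ)) : ‖embed φ‖ ^ 2 = ∫ y, ∑ j, sq (φ j y) := by
  rw [PiLp.norm_sq_eq_of_L2, integral_finsetSum _ fun j _ => integrable_sq (φ j)]
  exact Finset.sum_congr rfl fun j _ => norm_toLp_sq (φ j)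

theorem norm_embed_sum_sq (φ : Fin 3 → 𝓢(ℝ, ℂ)) :
    ‖embed φ 0 + embed φ 1‖ ^ 2 = ∫ y, sq (φ 0 y + φ 1 y) := by
  have : embed φ 0 + embed φ 1 = (φ 0 + φ 1).toLp 2 :=
    ((SchwartzMap.toLpCLM ℂ ℂ 2 volume).map_add (φ 0) (φ 1)).symm
  rw [this, norm_toLp_sq]
  rfl

/-- The graph estimate for `-d²/dx² + i s x`. -/
theorem graph_estimate {s : ℝ} (hs : s ^ 2 ≤ 1) (φ : 𝓢(ℝ, ℂ)) :
    ‖(dd φ).toLp 2‖ ^ 2 / 2 + s ^ 2 * ‖(xMul φ).toLp 2‖ ^ 2 ≤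
      ‖(-dd φ + (s * Complex.I) • xMul φ).toLp 2‖ ^ 2 + 2 * ‖φ.toLp 2‖ ^ 2 := by
  set p := SchwartzMap.derivCLM ℂ ℂ φ with hp
  simp only [norm_toLp_sq]
  -- The first summand of `F` integrates the cross term of |-φ'' + isxφ|² by parts: only the
  -- commutator with x survives, a product of φ' and φ. The second turns |φ'|² into -φ·φ''.
  have h := integral_nonpos_of_le_deriv'
    (F := fun y => 2 * s * dot (p y) (Complex.I * xMul φ y) + dot (φ y) (p y))
    (F' := fun y => 2 * s * (dot (dd φ y) (Complex.I * xMul φ y) +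
      dot (p y) (Complex.I * (φ y + y * p y))) + (dot (p y) (p y) + dot (φ y) (dd φ y)))
    (g := fun y => sq (dd φ y) / 2 + s ^ 2 * sq (xMul φ y) -
      (sq ((-dd φ + (s * Complex.I) • xMul φ) y) + 2 * sq (φ y)))
    (fun y => ?_)
    ((((integrable_sq _).div_const _).add ((integrable_sq _).const_mul _)).sub
      ((integrable_sq _).add ((integrable_sq _).const_mul _))) (fun y => ?_) ?_
  · have i1 : Integrable fun y => sq (dd φ y) / 2 := (integrable_sq _).div_const _
    have i2 : Integrable fun y => s ^ 2 * sq (xMul φ y) := (integrable_sq _).const_mul _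
    have i3 : Integrable fun y => sq ((-dd φ + (s * Complex.I) • xMul φ) y) := integrable_sq _
    have i4 : Integrable fun y => 2 * sq (φ y) := (integrable_sq _).const_mul _
    have i12 : Integrable fun y => sq (dd φ y) / 2 + s ^ 2 * sq (xMul φ y) := i1.add i2
    have i34 : Integrable fun y => sq ((-dd φ + (s * Complex.I) • xMul φ) y) + 2 * sq (φ y) :=
      i3.add i4
    rw [integral_sub i12 i34, integral_add i1 i2, integral_add i3 i4,
      integral_div, integral_const_mul, integral_const_mul] at h
    linarith
  · have hx : HasDerivAt (xMul φ) (φ y + y * p y) y := by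
      have h1 : HasDerivAt (fun y : ℝ => (y : ℂ) * φ y) (1 * φ y + y * p y) y :=
        (HasDerivAt.ofReal_comp (hasDerivAt_id y)).mul (hasDerivAt_schwartz φ y)
      rw [one_mul] at h1
      exact h1.congr_of_eventuallyEq (Eventually.of_forall fun z => xMul_apply φ z)
    exact ((hasDerivAt_dot (hasDerivAt_derivCLM φ y) (hx.const_mul Complex.I)).const_mul
      (2 * s)).add (hasDerivAt_dot (hasDerivAt_schwartz φ y) (hasDerivAt_derivCLM φ y))
  · simp only [add_apply, neg_apply, smul_apply, xMul_apply,
      sq, dot, smul_eq_mul]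
    simp
    generalize (dd φ y).re = dr
    generalize (dd φ y).im = di
    generalize (p y).re = pr
    generalize (p y).im = pi
    generalize (φ y).re = ur
    generalize (φ y).im = ui
    nlinarith [sq_nonneg (pr - s * ui), sq_nonneg (pi + s * ur), sq_nonneg (dr + ur),
      sq_nonneg (di + ui), mul_nonneg (sub_nonneg.2 hs) (sq_nonneg ur),
      mul_nonneg (sub_nonneg.2 hs) (sq_nonneg ui)]
  · have h1 := (decays_schwartz p).tendsto_dot ((decays_schwartz (xMul φ)).const_mul Complex.I)
    have h2 := (decays_schwartz φ).tendsto_dot (decays_schwartz p)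
    simpa using (h1.const_mul (2 * s)).add h2

/-- The accretivity estimate. -/
theorem BTSystem.integral_sq_le_of_re_neg {a : ℝ} {lam : ℂ} {u p f : Fin 3 → ℝ → ℂ}
    (hs : BTSystem a lam u p f) (hre : lam.re < 0) :
    ∫ y, ∑ j, sq (u j y) ≤ 1 / lam.re ^ 2 * ∫ y, ∑ j, sq (f j y) := by
  set m := -lam.re with hm
  have hm0 : 0 < m := by rw [hm]; linarith
  have iu : Integrable fun y => ∑ j, sq (u j y) :=
    integrable_finsetSum _ fun j _ => (hs.decays_u j).1.int
  have if' : Integrable fun y => ∑ j, sq (f j y) := integrable_finsetSum _ fun j _ => hs.int_f j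
  have h := integral_nonpos_of_le_deriv'
    (F := fun y => ∑ j, dot (u j y) (p j y))
    (F' := fun y => ∑ j, (dot (p j y) (p j y) +
      dot (u j y) (rhsB a lam y (fun i => u i y) (fun i => f i y) j)))
    (g := fun y => m / 2 * ∑ j, sq (u j y) - 1 / (2 * m) * ∑ j, sq (f j y))
    (fun y => HasDerivAt.fun_sum fun j _ => hasDerivAt_dot (hs.deriv_u j y) (hs.deriv_p j y))
    ((iu.const_mul _).sub (if'.const_mul _)) (fun y => ?_) ?_
  · rw [integral_sub (iu.const_mul _) (if'.const_mul _), integral_const_mul,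
      integral_const_mul] at h
    have e : lam.re ^ 2 = m ^ 2 := by rw [hm]; ring
    rw [e]
    set U := ∫ y, ∑ j, sq (u j y)
    set Q := ∫ y, ∑ j, sq (f j y)
    calc U = 2 / m * (m / 2 * U) := by field_simp
      _ ≤ 2 / m * (1 / (2 * m) * Q) :=
        mul_le_mul_of_nonneg_left (by linarith) (by positivity)
      _ = _ := by field_simp
  · have k := fun j => abs_dot_le hm0 (u j y) (f j y)
    have k0 := (abs_le.1 (k 0)).2
    have k1 := (abs_le.1 (k 1)).2
    have k2 := (abs_le.1 (k 2)).2
    -- The coupling is antisymmetric and ±iy is imaginary, so both drop out of the real part.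
    have e : ∑ j, dot (u j y) (rhsB a lam y (fun i => u i y) (fun i => f i y) j) =
        m * ∑ j, sq (u j y) - ∑ j, dot (u j y) (f j y) := by
      simp [Fin.sum_univ_three, rhsB, dot, sq, hm]
      ring
    rw [Finset.sum_add_distrib, e]
    simp only [Fin.sum_univ_three, dot_self] at *
    have := sq_nonneg' (p 0 y)
    have := sq_nonneg' (p 1 y)
    have := sq_nonneg' (p 2 y)
    linarith
  · have := tendsto_finsetSum (Finset.univ : Finset (Fin 3)) fun j _ =>
      (hs.decays_u j).1.tendsto_dot (hs.decays_p j).1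
    simpa using this

end BlochTorrey

namespace BlochTorrey

open Set Filter Topology

/-! ### Density of the range of the diagonal part -/

theorem exists_primitive_compact {k : ℝ → ℝ} (hk : ContDiff ℝ (⊤ : ℕ∞) k) (hc : HasCompactSupport k)
    (h0 : ∫ x, k x = 0) :
    ∃ θ : ℝ → ℝ, ContDiff ℝ (⊤ : ℕ∞) θ ∧ HasCompactSupport θ ∧ ∀ x, HasDerivAt θ (k x) x := by
  obtain ⟨R, hR⟩ := hc.isCompact.isBounded.subset_closedBall 0
  have hz : ∀ x, R < |x| → k x = 0 := fun x hx => by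
    by_contra hne
    have := hR (subset_tsupport k hne)
    rw [Metric.mem_closedBall, dist_zero_right, Real.norm_eq_abs] at this
    linarith
  have hd : ∀ x, HasDerivAt (fun x => ∫ t in (-(|R| + 1))..x, k t) (k x) x := fun x =>
    intervalIntegral.integral_hasDerivAt_right (hk.continuous.intervalIntegrable _ _)
      (hk.continuous.stronglyMeasurableAtFilter _ _) hk.continuous.continuousAt
  refine ⟨fun x => ∫ t in (-(|R| + 1))..x, k t, ?_, ?_, hd⟩
  · rw [contDiff_infty_iff_deriv]
    refine ⟨fun x => (hd x).differentiableAt, ?_⟩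
    rwa [funext fun x => (hd x).deriv]
  · refine HasCompactSupport.intro (isCompact_Icc (a := -(|R| + 1)) (b := |R|)) fun x hx => ?_
    rw [mem_Icc, not_and_or, not_le, not_le] at hx
    rcases hx with hx | hx
    · refine (intervalIntegral.integral_congr fun t ht => ?_).trans
        intervalIntegral.integral_zero
      rw [uIcc_of_ge hx.le, mem_Icc] at ht
      refine hz t ?_
      rw [abs_of_neg (by linarith [abs_nonneg R, ht.2])]
      linarith [le_abs_self R, ht.2]
    · rw [intervalIntegral.integral_eq_integral_of_support_subset, h0]
      intro t ht
      have ht' : |t| ≤ R := by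
        by_contra hlt
        exact ht (hz t (not_le.1 hlt))
      rw [mem_Ioc]
      constructor <;> linarith [(abs_le.1 ht').1, (abs_le.1 ht').2, le_abs_self R]

/-- A locally integrable function on the line with vanishing distributional derivative is
constant. -/
theorem ae_eq_const_of_integral_deriv_eq_zero {Z : ℝ → ℂ} (hZ : LocallyIntegrable Z)
    (h : ∀ θ : ℝ → ℝ, ContDiff ℝ (⊤ : ℕ∞) θ → HasCompactSupport θ → ∫ x, deriv θ x • Z x = 0) :
    ∃ c : ℂ, ∀ᵐ x, Z x = c := by
  let b : ContDiffBump (0 : ℝ) := ⟨1, 2, one_pos, one_lt_two⟩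
  set χ := b.normed volume with hχ'
  have hχ : ContDiff ℝ (⊤ : ℕ∞) χ := b.contDiff_normed
  have hχc : HasCompactSupport χ := b.hasCompactSupport_normed
  have hχi : ∫ x, χ x = 1 := b.integral_normed
  refine ⟨∫ x, χ x • Z x, ?_⟩
  have key := ae_eq_zero_of_integral_contDiff_smul_eq_zero (μ := volume)
    (f := fun x => Z x - ∫ x, χ x • Z x) (hZ.sub (locallyIntegrable_const _)) ?_
  · filter_upwards [key] with x hx
    exact sub_eq_zero.1 hx
  · intro g hg hgc
    have ig : Integrable g := hg.continuous.integrable_of_hasCompactSupport hgc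
    have iχ : Integrable χ := hχ.continuous.integrable_of_hasCompactSupport hχc
    have hkc : HasCompactSupport fun x => g x - (∫ y, g y) * χ x :=
      hgc.sub (hχc.mul_left (f := fun _ => ∫ y, g y))
    obtain ⟨θ, hθ, hθc, hθd⟩ := exists_primitive_compact
      (k := fun x => g x - (∫ y, g y) * χ x) (hg.sub (contDiff_const.mul hχ)) hkc (by
        rw [integral_sub ig (iχ.const_mul _), integral_const_mul, hχi]; ring)
    have h1 := h θ hθ hθc
    simp only [fun x => (hθd x).deriv] at h1
    have igZ : Integrable fun x => g x • Z x :=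
      hZ.integrable_smul_left_of_hasCompactSupport hg.continuous hgc
    have iχZ : Integrable fun x => χ x • Z x :=
      hZ.integrable_smul_left_of_hasCompactSupport hχ.continuous hχc
    have e1 : ∀ x, (g x - (∫ y, g y) * χ x) • Z x = g x • Z x - (∫ y, g y) • (χ x • Z x) :=
      fun x => by rw [sub_smul, mul_smul]
    simp only [e1] at h1
    have iχZ' : Integrable fun x => (∫ y, g y) • (χ x • Z x) :=
      iχZ.smul (∫ y, g y)
    rw [integral_sub igZ iχZ', integral_smul] at h1
    simp only [smul_sub]
    rw [integral_sub igZ (ig.smul_const _), integral_smul_const]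
    exact h1

theorem lineDerivOp_one_eq (φ : 𝓢(ℝ, ℂ)) :
    LineDeriv.lineDerivOp (1 : ℝ) φ = SchwartzMap.derivCLM ℂ ℂ φ := by
  ext x
  rw [SchwartzMap.lineDerivOp_apply_eq_fderiv, SchwartzMap.derivCLM_apply, fderiv_apply_one_eq_deriv]

theorem smulLeftCLM_inner_one (φ : 𝓢(ℝ, ℂ)) :
    SchwartzMap.smulLeftCLM ℂ (fun x : ℝ => inner ℝ x 1) φ = xMul φ := by
  ext x
  rw [SchwartzMap.smulLeftCLM_apply_apply (by fun_prop), xMul_apply]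
  simp

open FourierTransform in
theorem derivCLM_fourier (φ : 𝓢(ℝ, ℂ)) : SchwartzMap.derivCLM ℂ ℂ (𝓕 φ) =
    𝓕 (-(2 * Real.pi * Complex.I) • xMul φ) := by
  rw [← lineDerivOp_one_eq, SchwartzMap.lineDerivOp_fourier_eq, smulLeftCLM_inner_one]

open FourierTransform in
theorem fourier_derivCLM (φ : 𝓢(ℝ, ℂ)) : 𝓕 (SchwartzMap.derivCLM ℂ ℂ φ) =
    (2 * Real.pi * Complex.I) • xMul (𝓕 φ) := by
  rw [← lineDerivOp_one_eq, SchwartzMap.fourier_lineDerivOp_eq, smulLeftCLM_inner_one]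

-- Multiplication by x becomes a first derivative and -d²/dx² a multiplication, so the diagonal
-- operator turns into a first order one that is explicitly solvable.
open FourierTransform in
theorem diag_fourier (s : ℝ) (φ : 𝓢(ℝ, ℂ)) :
    -dd (𝓕 φ) + ((s : ℂ) * Complex.I) • xMul (𝓕 φ) + 𝓕 φ =
      𝓕 ((4 * Real.pi ^ 2 : ℂ) • xMul (xMul φ) +
        (s / (2 * Real.pi) : ℂ) • SchwartzMap.derivCLM ℂ ℂ φ + φ) := by
  have hπ : (Real.pi : ℂ) ≠ 0 := by exact_mod_cast Real.pi_ne_zero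
  have h1 : dd (𝓕 φ) = 𝓕 (-(4 * Real.pi ^ 2 : ℂ) • xMul (xMul φ)) := by
    change SchwartzMap.derivCLM ℂ ℂ (SchwartzMap.derivCLM ℂ ℂ (𝓕 φ)) = _
    rw [derivCLM_fourier, derivCLM_fourier, map_smul, smul_smul]
    congr 2
    linear_combination (4 * Real.pi ^ 2 : ℂ) * Complex.I_sq
  have h2 : ((s : ℂ) * Complex.I) • xMul (𝓕 φ) =
      𝓕 ((s / (2 * Real.pi) : ℂ) • SchwartzMap.derivCLM ℂ ℂ φ) := by
    rw [FourierTransform.fourier_smul, fourier_derivCLM, smul_smul]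
    congr 1
    field_simp
  rw [h1, h2, FourierTransform.fourier_add, FourierTransform.fourier_add]
  congr 2
  rw [neg_smul, FourierTransform.fourier_smul, ← neg_smul, FourierTransform.fourier_smul,
    neg_smul, neg_neg]

/-- The phase which conjugates the diagonal part to a derivative, on the Fourier side. -/
noncomputable def phase (s x : ℝ) : ℝ := s * (2 * Real.pi * (x + 4 * Real.pi ^ 2 * x ^ 3 / 3))

theorem hasDerivAt_phase (s x : ℝ) :
    HasDerivAt (phase s) (s * (2 * Real.pi * (1 + 4 * Real.pi ^ 2 * x ^ 2))) x := by
  unfold phase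
  refine ((((hasDerivAt_id x).add ((((hasDerivAt_id x).pow 3).const_mul
    (4 * Real.pi ^ 2)).div_const 3)).const_mul (2 * Real.pi)).const_mul s).congr_deriv ?_
  simp only [Nat.cast_ofNat, id]
  ring

theorem contDiff_phase (s : ℝ) : ContDiff ℝ (⊤ : ℕ∞) (phase s) := by
  unfold phase
  fun_prop

open FourierTransform in
theorem diag_range_fourier {s : ℝ} {y : L2}
    (h : ∀ φ : 𝓢(ℝ, ℂ), toDistr y (-dd φ + ((s : ℂ) * Complex.I) • xMul φ + φ) = 0)
    (φ : 𝓢(ℝ, ℂ)) :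
    ∫ x, ((4 * Real.pi ^ 2 * x ^ 2 + 1) * φ x + s / (2 * Real.pi) * deriv φ x) * (𝓕 y : L2) x
      = 0 := by
  have h1 := h (𝓕 φ)
  rw [diag_fourier] at h1
  have h2 := congrArg (fun T => T ((4 * Real.pi ^ 2 : ℂ) • xMul (xMul φ) +
        (s / (2 * Real.pi) : ℂ) • SchwartzMap.derivCLM ℂ ℂ φ + φ))
    (Lp.fourier_toTemperedDistribution_eq y)
  simp only [TemperedDistribution.fourier_apply] at h2
  have h3 : (Lp.toTemperedDistribution (𝓕 y : L2)) ((4 * Real.pi ^ 2 : ℂ) • xMul (xMul φ) +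
        (s / (2 * Real.pi) : ℂ) • SchwartzMap.derivCLM ℂ ℂ φ + φ) = 0 := by
    rw [← h2]; exact h1
  rw [Lp.toTemperedDistribution_apply] at h3
  rw [← h3]
  refine integral_congr_ae (ae_of_all _ fun x => ?_)
  simp only [add_apply, smul_apply, xMul_apply, SchwartzMap.derivCLM_apply, smul_eq_mul]
  ring

theorem exists_schwartz_eq_ofReal {g : ℝ → ℝ} (hg : ContDiff ℝ (⊤ : ℕ∞) g)
    (hc : HasCompactSupport g) : ∃ φ : 𝓢(ℝ, ℂ), ∀ x, φ x = g x :=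
  ⟨(hc.comp_left (g := Complex.ofReal) Complex.ofReal_zero).toSchwartzMap
    (Complex.ofRealCLM.contDiff.comp hg), fun _ => rfl⟩

theorem locallyIntegrable_L2 (y : L2) : LocallyIntegrable (fun x => y x) :=
  (Lp.memLp y).locallyIntegrable (by norm_num)

-- On the Fourier side an annihilator Y of the range solves a first order equation, so for s = ±1 it
-- equals c exp(`phase s`). On the half-line sx ≥ 0 this has modulus at least |c|, which is not
-- square integrable unless c = 0. For s = 0 the operator is multiplication by a positive function.
open FourierTransform in
theorem eq_zero_of_diag_range {s : ℝ} (hs : s = 0 ∨ s ^ 2 = 1) {y : L2}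
    (h : ∀ φ : 𝓢(ℝ, ℂ), toDistr y (-dd φ + ((s : ℂ) * Complex.I) • xMul φ + φ) = 0) : y = 0 := by
  set Y : L2 := 𝓕 y with hY
  suffices hY0 : Y = 0 by
    have := Lp.norm_fourier_eq y
    rw [← hY, hY0, norm_zero] at this
    exact norm_eq_zero.1 this.symm
  have key := diag_range_fourier h
  rw [← hY] at key
  have hder : ∀ {g : ℝ → ℝ} {φ : 𝓢(ℝ, ℂ)} {x g' : ℝ}, (∀ x, φ x = g x) → HasDerivAt g g' x →
      deriv φ x = g' := fun {g φ x g'} h1 h2 => by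
    rw [show (φ : ℝ → ℂ) = fun x => (g x : ℂ) from funext h1]
    exact h2.ofReal_comp.deriv
  rw [Lp.eq_zero_iff_ae_eq_zero]
  rcases hs with rfl | hs
  · have hloc : LocallyIntegrable fun x => ((4 * Real.pi ^ 2 * x ^ 2 + 1 : ℝ) : ℂ) * Y x :=
      (locallyIntegrable_L2 Y).continuous_mul (by fun_prop)
    have := ae_eq_zero_of_integral_contDiff_smul_eq_zero hloc fun g hg hgc => by
      obtain ⟨φ, hφ⟩ := exists_schwartz_eq_ofReal hg hgc
      rw [← key φ]
      refine integral_congr_ae (ae_of_all _ fun x => ?_)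
      simp [hφ]
      ring
    filter_upwards [this] with x hx
    have hne : ((4 * Real.pi ^ 2 * x ^ 2 + 1 : ℝ) : ℂ) ≠ 0 := by
      exact_mod_cast (by positivity : (0 : ℝ) < 4 * Real.pi ^ 2 * x ^ 2 + 1).ne'
    exact (mul_eq_zero.1 hx).resolve_left hne
  · have hs0 : s ≠ 0 := by rintro rfl; norm_num at hs
    have hce : Continuous fun x => ((Real.exp (-phase s x) : ℝ) : ℂ) :=
      Complex.continuous_ofReal.comp
        (Real.continuous_exp.comp (contDiff_phase s).continuous.neg)
    obtain ⟨c, hc⟩ := ae_eq_const_of_integral_deriv_eq_zero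
      ((locallyIntegrable_L2 Y).continuous_mul hce) fun θ hθ hθc => by
      -- The integrating factor removes the zeroth order term, by s² = 1, and leaves only the
      -- derivative of θ.
      obtain ⟨φ, hφ⟩ := exists_schwartz_eq_ofReal (g := fun x => θ x * Real.exp (-phase s x))
        (hθ.mul (Real.contDiff_exp.comp (contDiff_phase s).neg)) hθc.mul_right
      have hk := key φ
      have e : ∀ x, ((4 * Real.pi ^ 2 * x ^ 2 + 1) * φ x +
          s / (2 * Real.pi) * deriv φ x) * Y x = (s / (2 * Real.pi) : ℂ) *
          (deriv θ x • (((Real.exp (-phase s x) : ℝ) : ℂ) * Y x)) := fun x => by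
        rw [hder hφ (((hθ.differentiable (by simp) x).hasDerivAt).mul
          ((hasDerivAt_phase s x).neg.exp)), hφ]
        have hπ : (Real.pi : ℂ) ≠ 0 := by exact_mod_cast Real.pi_ne_zero
        have hs' : (s : ℂ) ^ 2 = 1 := by exact_mod_cast hs
        rw [Complex.real_smul, Pi.neg_apply]
        push_cast
        field_simp
        linear_combination (-(θ x * (1 + 4 * Real.pi ^ 2 * x ^ 2) * 2 * Real.pi : ℂ) * Y x) * hs'
      simp only [e] at hk
      rw [integral_const_mul] at hk
      refine (mul_eq_zero.1 hk).resolve_left ?_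
      have : (s / (2 * Real.pi) : ℝ) ≠ 0 := div_ne_zero hs0 (by positivity)
      exact_mod_cast this
    by_cases hc0 : c = 0
    · filter_upwards [hc] with x hx
      rw [hc0] at hx
      exact (mul_eq_zero.1 hx).resolve_left (by exact_mod_cast (Real.exp_pos _).ne')
    · exfalso
      have hint : Integrable fun x => ‖Y x‖ ^ 2 :=
        (memLp_two_iff_integrable_sq_norm (Lp.memLp Y).1).1 (Lp.memLp Y)
      have hfin := hint.measure_ge_lt_top (ε := ‖c‖ ^ 2) (by positivity)
      have hsub : ∀ᵐ x, 0 ≤ s * x → ‖c‖ ^ 2 ≤ ‖Y x‖ ^ 2 := by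
        filter_upwards [hc] with x hx hsx
        have hp : Real.exp (-phase s x) ≤ 1 := by
          rw [Real.exp_le_one_iff]
          have : phase s x = s * x * (2 * Real.pi * (1 + 4 * Real.pi ^ 2 * x ^ 2 / 3)) := by
            unfold phase; ring
          rw [this]
          have := Real.pi_pos
          exact neg_nonpos.2 (by positivity)
        have : ‖c‖ ≤ ‖Y x‖ := by
          rw [← hx, norm_mul, Complex.norm_real, Real.norm_of_nonneg (Real.exp_pos _).le]
          exact mul_le_of_le_one_left (norm_nonneg _) hp
        gcongr
      have hinf : volume {x : ℝ | 0 ≤ s * x} = ⊤ := by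
        rcases (sq_eq_one_iff.1 hs : s = 1 ∨ s = -1) with rfl | rfl
        · rw [show {x : ℝ | 0 ≤ 1 * x} = Ici 0 by ext; simp, Real.volume_Ici]
        · rw [show {x : ℝ | 0 ≤ -1 * x} = Iic 0 by ext; simp, Real.volume_Iic]
      have := measure_mono_ae (μ := volume) (s := {x : ℝ | 0 ≤ s * x})
        (t := {x | ‖c‖ ^ 2 ≤ ‖Y x‖ ^ 2}) hsub
      rw [hinf] at this
      exact absurd hfin (not_lt.2 this)

end BlochTorrey

namespace BlochTorrey

open Set Filter Topology

/-! ### Density of the range by continuity -/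

section Abstract

variable {X H : Type*} [AddCommGroup X] [Module ℂ X] [NormedAddCommGroup H]
  [InnerProductSpace ℂ H] [CompleteSpace H]

theorem dense_range_of_orthogonal {A : X →ₗ[ℂ] H}
    (hA : ∀ y : H, (∀ φ, inner ℂ y (A φ) = 0) → y = 0) (f : H) : f ∈ closure (range A) := by
  have h : (LinearMap.range A).topologicalClosure = ⊤ := by
    rw [Submodule.topologicalClosure_eq_top_iff, Submodule.eq_bot_iff]
    intro y hy
    refine hA y fun φ => ?_
    rw [← inner_conj_symm, (Submodule.mem_orthogonal _ _).1 hy _ ⟨φ, rfl⟩, map_zero]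
  have : f ∈ (LinearMap.range A).topologicalClosure := by rw [h]; trivial
  rwa [← SetLike.mem_coe, Submodule.topologicalClosure_coe, LinearMap.coe_range] at this

/-- Density of the range of A is applied to y itself. If y is orthogonal to the range of A', then
⟨y, Aφ⟩ = -⟨y, (A' - A)φ⟩ is at most κC‖y‖‖Aφ‖; letting Aφ tend to y gives ‖y‖² ≤ κC‖y‖². -/
theorem eq_zero_of_orthogonal_of_close {A A' : X →ₗ[ℂ] H} {J : X → H} {C κ : ℝ}
    (hC : ∀ φ, ‖J φ‖ ≤ C * ‖A φ‖) (hκ0 : 0 ≤ κ) (hκ : ∀ φ, ‖A' φ - A φ‖ ≤ κ * ‖J φ‖)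
    (hlt : κ * C < 1) (hA : ∀ y : H, (∀ φ, inner ℂ y (A φ) = 0) → y = 0) (y : H)
    (hy : ∀ φ, inner ℂ y (A' φ) = 0) : y = 0 := by
  have hlim : ∀ f ∈ closure (range A), f = y → ‖y‖ ^ 2 ≤ κ * C * ‖y‖ * ‖f‖ := by
    intro f hf hfy
    obtain ⟨x, hx, hxf⟩ := mem_closure_iff_seq_limit.1 hf
    choose φ hφ using hx
    have h1 : Tendsto (fun n => (inner ℂ y (x n) : ℂ)) atTop (𝓝 (inner ℂ y f)) :=
      tendsto_const_nhds.inner hxf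
    have h2 := h1.norm
    have e0 : ‖(inner ℂ y y : ℂ)‖ = ‖y‖ ^ 2 := by rw [inner_self_eq_norm_sq_to_K]; simp
    rw [hfy, e0] at h2
    refine le_of_tendsto_of_tendsto h2 (hxf.norm.const_mul (κ * C * ‖y‖)) (Eventually.of_forall
      fun n => ?_)
    have e : inner ℂ y (x n) = -inner ℂ y (A' (φ n) - A (φ n)) := by
      rw [inner_sub_right, hy, hφ, zero_sub, neg_neg]
    simp only [e, norm_neg]
    calc ‖inner ℂ y (A' (φ n) - A (φ n))‖ ≤ ‖y‖ * ‖A' (φ n) - A (φ n)‖ := norm_inner_le_norm _ _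
      _ ≤ ‖y‖ * (κ * (C * ‖A (φ n)‖)) := by
        gcongr
        exact (hκ _).trans (mul_le_mul_of_nonneg_left (hC _) hκ0)
      _ = κ * C * ‖y‖ * ‖x n‖ := by rw [hφ]; ring
  have h := hlim y (dense_range_of_orthogonal hA y) rfl
  by_contra hne
  have : 0 < ‖y‖ := norm_pos_iff.2 hne
  nlinarith [mul_pos this this]

/-- The method of continuity: more than κC equal steps make each step short enough for the preceding
lemma. -/
theorem eq_zero_of_orthogonal_of_segment {A : ℝ → X →ₗ[ℂ] H} {J : X → H} {C κ : ℝ} (hC0 : 0 ≤ C)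
    (hκ0 : 0 ≤ κ) (hC : ∀ t, 0 ≤ t → t ≤ 1 → ∀ φ, ‖J φ‖ ≤ C * ‖A t φ‖)
    (hκ : ∀ t t' φ, ‖A t' φ - A t φ‖ ≤ κ * |t' - t| * ‖J φ‖)
    (hA : ∀ y : H, (∀ φ, inner ℂ y (A 0 φ) = 0) → y = 0) :
    ∀ y : H, (∀ φ, inner ℂ y (A 1 φ) = 0) → y = 0 := by
  obtain ⟨n, hn⟩ := exists_nat_gt (κ * C)
  have hn0 : (0 : ℝ) < n := (mul_nonneg hκ0 hC0).trans_lt hn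
  have step : ∀ k : ℕ, k ≤ n → ∀ y : H, (∀ φ, inner ℂ y (A (k / n) φ) = 0) → y = 0 := by
    intro k
    induction k with
    | zero => intro _; simpa using hA
    | succ k ih =>
      intro hk
      have hk' : (k : ℝ) ≤ n := by exact_mod_cast (Nat.le_succ k).trans hk
      refine eq_zero_of_orthogonal_of_close (hC (k / n) (by positivity)
        ((div_le_one hn0).2 hk')) (κ := κ / n) (by positivity) (fun φ => ?_) ?_
        (ih ((Nat.le_succ k).trans hk))
      · refine (hκ (k / n) _ φ).trans (le_of_eq ?_)
        have : ((k + 1 : ℕ) : ℝ) / n - k / n = 1 / n := by push_cast; ring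
        rw [this, abs_of_pos (by positivity)]
        ring
      · rw [div_mul_eq_mul_div, div_lt_one hn0]
        exact hn
  have := step n le_rfl
  rwa [div_self hn0.ne'] at this

end Abstract

/-- Componentwise complex conjugation. -/
noncomputable def conjVec (y : L2Vec) : L2Vec := WithLp.toLp 2 fun j => star (y j)

theorem conjVec_apply (y : L2Vec) (j : Fin 3) : conjVec y j = star (y j) := rfl

theorem conjVec_conjVec (y : L2Vec) : conjVec (conjVec y) = y := by
  ext1 j
  rw [conjVec_apply, conjVec_apply, star_star]

theorem star_zero_L2 : star (0 : L2) = 0 := by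
  refine Lp.ext ?_
  filter_upwards [Lp.coeFn_star (0 : L2), Lp.coeFn_zero ℂ 2 (volume : Measure ℝ)] with x h1 h2
  rw [h1, h2]
  simp

theorem inner_star_toLp (y : L2) (φ : 𝓢(ℝ, ℂ)) :
    inner ℂ (star y) (φ.toLp 2) = toDistr y φ := by
  rw [L2.inner_def]
  refine (integral_congr_ae ?_).trans (Lp.toTemperedDistribution_apply y φ).symm
  filter_upwards [Lp.coeFn_star y, φ.coeFn_toLp 2 volume] with x h1 h2
  rw [h1, h2]
  simp

theorem inner_conjVec_embed (y : L2Vec) (φ : Fin 3 → 𝓢(ℝ, ℂ)) :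
    inner ℂ (conjVec y) (embed φ) = ∑ j, toDistr (y j) (φ j) := by
  rw [PiLp.inner_apply]
  exact Finset.sum_congr rfl fun j _ => inner_star_toLp (y j) (φ j)

theorem orthogonal_base (y : L2Vec) (hy : ∀ φ, inner ℂ y (embed (opB 0 (-1) φ)) = 0) : y = 0 := by
  rw [← conjVec_conjVec y] at hy ⊢
  set z := conjVec y
  simp only [inner_conjVec_embed, Fin.sum_univ_three, opB_zero_apply, opB_one_apply,
    opB_two_apply] at hy
  have h0 : z 0 = 0 := eq_zero_of_diag_range (s := 1) (Or.inr (by norm_num)) fun ψ => by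
    have := hy ![ψ, 0, 0]
    simp at this
    simpa using this
  have h1 : z 1 = 0 := eq_zero_of_diag_range (s := -1) (Or.inr (by norm_num)) fun ψ => by
    have := hy ![0, ψ, 0]
    simp at this
    simpa [sub_eq_add_neg] using this
  have h2 : z 2 = 0 := eq_zero_of_diag_range (s := 0) (Or.inl rfl) fun ψ => by
    have := hy ![0, 0, ψ]
    simp at this
    simpa using this
  ext1 j
  rw [conjVec_apply]
  fin_cases j <;> simp [h0, h1, h2, star_zero_L2]

theorem norm_embed_opB_sub_le (a a' : ℝ) (lam lam' : ℂ) (φ : Fin 3 → 𝓢(ℝ, ℂ)) :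
    ‖embed (opB a' lam' φ) - embed (opB a lam φ)‖ ≤
      (2 * |a' - a| + ‖lam' - lam‖) * ‖embed φ‖ := by
  have e : embed (opB a' lam' φ) - embed (opB a lam φ) =
      ((a' - a : ℝ) : ℂ) • embed ![φ 2, φ 2, -φ 0 - φ 1] - (lam' - lam) • embed φ := by
    rw [← map_sub, ← map_smul, ← map_smul, ← map_sub]
    congr 1
    ext j x
    fin_cases j <;> simp [opB_zero_apply, opB_one_apply, opB_two_apply] <;> ring
  have hk : ‖embed ![φ 2, φ 2, -φ 0 - φ 1]‖ ≤ 2 * ‖embed φ‖ := by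
    refine le_of_sq_le_sq ?_ (by positivity)
    rw [mul_pow, norm_embed_sq, norm_embed_sq, ← integral_const_mul]
    refine integral_mono (integrable_finsetSum _ fun j _ => integrable_sq _)
      ((integrable_finsetSum _ fun j _ => integrable_sq _).const_mul _) fun y => ?_
    simp only [Fin.sum_univ_three]
    have h := sq_add_le (-φ 0 y) (-φ 1 y)
    have hneg : ∀ x : ℂ, sq (-x) = sq x := fun x => by simp [sq]
    rw [hneg, hneg, ← sub_eq_add_neg] at h
    have := sq_nonneg' (φ 0 y)
    have := sq_nonneg' (φ 1 y)
    have := sq_nonneg' (φ 2 y)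
    simp
    linarith
  rw [e]
  refine (norm_sub_le _ _).trans ?_
  rw [norm_smul, norm_smul, Complex.norm_real, Real.norm_eq_abs]
  nlinarith [mul_le_mul_of_nonneg_left hk (abs_nonneg (a' - a))]

theorem norm_embed_le_of_re_neg {a : ℝ} {lam : ℂ} (h : lam.re < 0) (φ : Fin 3 → 𝓢(ℝ, ℂ)) :
    ‖embed φ‖ ≤ 1 / (-lam.re) * ‖embed (opB a lam φ)‖ := by
  have h0 : 0 < -lam.re := by linarith
  refine le_of_sq_le_sq ?_ (by positivity)
  rw [mul_pow, norm_embed_sq, norm_embed_sq, div_pow, one_pow, neg_sq]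
  exact (btSystem_schwartz a lam φ).integral_sq_le_of_re_neg h

/-- The range on Schwartz functions is dense as soon as a priori estimates hold on the left. -/
theorem orthogonal_of_apriori {a : ℝ} {lam : ℂ} {C : ℝ} (hC : 0 ≤ C)
    (h : ∀ μ : ℝ, μ ≤ max lam.re (-1) → ∀ φ,
      ‖embed φ‖ ≤ C * ‖embed (opB a (μ + lam.im * Complex.I) φ)‖)
    (y : L2Vec) (hy : ∀ φ, inner ℂ y (embed (opB a lam φ)) = 0) : y = 0 := by
  -- At real part -1 accretivity gives the constant 1 for every coupling and every imaginary part,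
  -- so both are switched on together.
  have h1 := eq_zero_of_orthogonal_of_segment
    (A := fun t => embed ∘ₗ opB (t * a) (-1 + ((t * lam.im : ℝ) : ℂ) * Complex.I)) (J := embed)
    (C := 1) (κ := 2 * |a| + |lam.im|) zero_le_one (by positivity) (fun t _ _ φ => by
      have := norm_embed_le_of_re_neg (a := t * a)
        (lam := -1 + ((t * lam.im : ℝ) : ℂ) * Complex.I) (by simp) φ
      simpa using this) (fun t t' φ => by
      refine (norm_embed_opB_sub_le _ _ _ _ φ).trans (le_of_eq ?_)
      have e1 : t' * a - t * a = a * (t' - t) := by ring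
      have e2 : (-1 + ((t' * lam.im : ℝ) : ℂ) * Complex.I) -
          (-1 + ((t * lam.im : ℝ) : ℂ) * Complex.I) =
          ((lam.im * (t' - t) : ℝ) : ℂ) * Complex.I := by push_cast; ring
      rw [e1, e2, norm_mul, Complex.norm_I, Complex.norm_real, Real.norm_eq_abs, abs_mul, abs_mul]
      ring) (by simpa using orthogonal_base)
  -- Now the real part moves from -1 to that of λ at fixed imaginary part. The maximum with -1 in
  -- `h` covers both directions of travel.
  have h2 := eq_zero_of_orthogonal_of_segment
    (A := fun t => embed ∘ₗ opB a (((-1 + t * (lam.re + 1) : ℝ) : ℂ) + lam.im * Complex.I))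
    (J := embed) (C := C) (κ := |lam.re + 1|) hC (by positivity) (fun t ht0 ht1 φ => by
      refine h _ ?_ φ
      rcases le_total lam.re (-1) with hle | hle
      · exact (by nlinarith : -1 + t * (lam.re + 1) ≤ -1).trans (le_max_right _ _)
      · exact (by nlinarith : -1 + t * (lam.re + 1) ≤ lam.re).trans (le_max_left _ _))
    (fun t t' φ => by
      refine (norm_embed_opB_sub_le _ _ _ _ φ).trans (le_of_eq ?_)
      have e2 : (((-1 + t' * (lam.re + 1) : ℝ) : ℂ) + lam.im * Complex.I) -
          (((-1 + t * (lam.re + 1) : ℝ) : ℂ) + lam.im * Complex.I) =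
          (((lam.re + 1) * (t' - t) : ℝ) : ℂ) := by push_cast; ring
      rw [e2, Complex.norm_real, Real.norm_eq_abs, abs_mul, sub_self, abs_zero]
      ring) (by simpa using h1)
  refine h2 y fun φ => ?_
  have e : (((-1 + 1 * (lam.re + 1) : ℝ) : ℂ) + lam.im * Complex.I) = lam := by
    rw [one_mul, neg_add_cancel_comm_assoc]
    exact Complex.re_add_im lam
  simp only [e]
  exact hy φ

end BlochTorrey

namespace BlochTorrey

open Set Filter Topology

/-! ### Closedness -/

theorem toDistr_apply (u : L2) (ψ : 𝓢(ℝ, ℂ)) : toDistr u ψ = ∫ x, ψ x * u x :=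
  Lp.toTemperedDistribution_apply u ψ

theorem toDistr_toLp_apply (φ ψ : 𝓢(ℝ, ℂ)) : toDistr (φ.toLp 2) ψ = ∫ x, ψ x * φ x := by
  rw [toDistr_apply]
  refine integral_congr_ae ?_
  filter_upwards [φ.coeFn_toLp 2 volume] with x hx
  rw [hx]

theorem tendsto_toDistr {u : ℕ → L2} {v : L2} (h : Tendsto u atTop (𝓝 v)) (ψ : 𝓢(ℝ, ℂ)) :
    Tendsto (fun n => toDistr (u n) ψ) atTop (𝓝 (toDistr v ψ)) := by
  have h1 := ((Lp.toTemperedDistributionCLM ℂ (volume : Measure ℝ) 2).continuous.tendsto v).comp h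
  exact ((PointwiseConvergenceCLM.evalCLM (RingHom.id ℂ) ℂ ψ).continuous.tendsto _).comp h1

/-- The Bessel potential of order 2 has symbol 1 + |ξ|², so it equals 1 - (2π)⁻²Δ. -/
theorem mem_H2_of_laplacian {u v : L2} (h : Laplacian.laplacian (toDistr u) = toDistr v) :
    u ∈ H2 := by
  change TemperedDistribution.MemSobolev 2 2 (toDistr u)
  refine ⟨u - (((2 * Real.pi) ^ 2)⁻¹ : ℂ) • v, ?_⟩
  change _ = toDistr (u - (((2 * Real.pi) ^ 2)⁻¹ : ℂ) • v)
  rw [map_sub, map_smul, ← h, TemperedDistribution.laplacian_eq_fourierMultiplierCLM,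
    TemperedDistribution.besselPotential]
  have e : (fun x : ℝ => (((1 + ‖x‖ ^ 2) ^ ((2 : ℝ) / 2) : ℝ) : ℂ)) =
      (fun _ => 1) + fun x : ℝ => ((‖x‖ ^ 2 : ℝ) : ℂ) := by
    ext x
    simp
  rw [e, TemperedDistribution.fourierMultiplierCLM_apply,
    TemperedDistribution.smulLeftCLM_add (by fun_prop) (by fun_prop), add_apply,
    FourierTransform.fourierInv_add, ← TemperedDistribution.fourierMultiplierCLM_apply,
    ← TemperedDistribution.fourierMultiplierCLM_apply,
    TemperedDistribution.fourierMultiplierCLM_const]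
  have hπ : (Real.pi : ℂ) ≠ 0 := by exact_mod_cast Real.pi_ne_zero
  ext ψ
  simp

theorem exists_secondDeriv_eq {φ : ℕ → 𝓢(ℝ, ℂ)} {u v : L2}
    (hu : Tendsto (fun n => (φ n).toLp 2) atTop (𝓝 u))
    (hv : Tendsto (fun n => (dd (φ n)).toLp 2) atTop (𝓝 v)) :
    ∃ h : u ∈ H2, secondDeriv ⟨u, h⟩ = v := by
  have hL : Laplacian.laplacian (toDistr u) = toDistr v := by
    ext ψ
    rw [TemperedDistribution.laplacian_apply_apply]
    refine tendsto_nhds_unique (tendsto_toDistr hu _) ((tendsto_toDistr hv ψ).congr fun n => ?_)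
    rw [toDistr_toLp_apply, toDistr_toLp_apply, ← laplacian_eq_dd,
      SchwartzMap.integral_mul_laplacian_right_eq_left]
  refine ⟨mem_H2_of_laplacian hL, toDistr_injective ?_⟩
  rw [toDistr_secondDeriv, hL]

theorem exists_mulX_eq {φ : ℕ → 𝓢(ℝ, ℂ)} {u w : L2}
    (hu : Tendsto (fun n => (φ n).toLp 2) atTop (𝓝 u))
    (hw : Tendsto (fun n => (xMul (φ n)).toLp 2) atTop (𝓝 w)) :
    ∃ h : u ∈ xDomain, mulX ⟨u, h⟩ = w := by
  have hae : ∀ᵐ x : ℝ, (x : ℂ) * u x = w x := by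
    have hloc : LocallyIntegrable fun x : ℝ => (x : ℂ) * u x :=
      (locallyIntegrable_L2 u).continuous_mul Complex.continuous_ofReal
    have := ae_eq_zero_of_integral_contDiff_smul_eq_zero (μ := volume)
      (hloc.sub (locallyIntegrable_L2 w)) fun g hg hgc => by
      obtain ⟨ψ, hψ⟩ := exists_schwartz_eq_ofReal hg hgc
      have h1 : toDistr u (xMul ψ) = toDistr w ψ := by
        refine tendsto_nhds_unique (tendsto_toDistr hu _)
          ((tendsto_toDistr hw ψ).congr fun n => ?_)
        rw [toDistr_toLp_apply, toDistr_toLp_apply]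
        refine integral_congr_ae (ae_of_all _ fun x => ?_)
        simp only [xMul_apply]
        ring
      rw [toDistr_apply, toDistr_apply] at h1
      have i1 : Integrable fun x => g x • ((x : ℂ) * u x) :=
        hloc.integrable_smul_left_of_hasCompactSupport hg.continuous hgc
      have i2 : Integrable fun x => g x • w x :=
        (locallyIntegrable_L2 w).integrable_smul_left_of_hasCompactSupport hg.continuous hgc
      simp only [Pi.sub_apply, smul_sub]
      rw [integral_sub i1 i2, sub_eq_zero]
      refine Eq.trans ?_ (h1.trans ?_) <;>
      · refine integral_congr_ae (ae_of_all _ fun x => ?_)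
        simp [xMul_apply, hψ]
        try ring
    filter_upwards [this] with x hx
    exact sub_eq_zero.1 hx
  have hmem : MemLp (fun x : ℝ => (x : ℂ) * u x) 2 volume :=
    (memLp_congr_ae hae).2 (Lp.memLp w)
  refine ⟨hmem, Lp.ext ?_⟩
  change (hmem.toLp : L2) =ᵐ[volume] w
  filter_upwards [hmem.coeFn_toLp, hae] with x h1 h2
  rw [h1, h2]

theorem exists_tendsto_of_norm_le {X E F G : Type*} [AddCommGroup X] [Module ℂ X]
    [NormedAddCommGroup E] [Module ℂ E] [NormedAddCommGroup F] [Module ℂ F]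
    [NormedAddCommGroup G] [Module ℂ G] [CompleteSpace G] {A : X →ₗ[ℂ] E} {J : X →ₗ[ℂ] F}
    {B : X →ₗ[ℂ] G} {K : ℝ} {φ : ℕ → X} {g : E} {u : F}
    (hg : Tendsto (fun n => A (φ n)) atTop (𝓝 g)) (hu : Tendsto (fun n => J (φ n)) atTop (𝓝 u))
    (hK : 0 ≤ K) (hB : ∀ ψ, ‖B ψ‖ ≤ K * (‖A ψ‖ + ‖J ψ‖)) :
    ∃ v, Tendsto (fun n => B (φ n)) atTop (𝓝 v) := by
  refine cauchySeq_tendsto_of_complete (Metric.cauchySeq_iff.2 fun ε hε => ?_)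
  obtain ⟨N, hN⟩ := Metric.cauchySeq_iff.1 hu.cauchySeq (ε / (2 * (K + 1))) (by positivity)
  obtain ⟨M, hM⟩ := Metric.cauchySeq_iff.1 hg.cauchySeq (ε / (2 * (K + 1))) (by positivity)
  refine ⟨max N M, fun m hm n hn => ?_⟩
  have h1 := hN m ((le_max_left _ _).trans hm) n ((le_max_left _ _).trans hn)
  have h2 := hM m ((le_max_right _ _).trans hm) n ((le_max_right _ _).trans hn)
  rw [dist_eq_norm, ← map_sub] at h1 h2 ⊢
  calc ‖B (φ m - φ n)‖ ≤ K * (‖A (φ m - φ n)‖ + ‖J (φ m - φ n)‖) := hB _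
    _ ≤ K * (ε / (2 * (K + 1)) + ε / (2 * (K + 1))) := by gcongr
    _ = ε * (K / (K + 1)) := by field_simp; norm_num
    _ < ε * 1 := by
      gcongr
      rw [div_lt_one (by positivity)]
      linarith
    _ = ε := mul_one ε

theorem norm_dd_le {s : ℝ} (hs : s ^ 2 ≤ 1) (ψ : 𝓢(ℝ, ℂ)) : ‖(dd ψ).toLp 2‖ ≤
    2 * (‖(-dd ψ + ((s : ℂ) * Complex.I) • xMul ψ).toLp 2‖ + ‖ψ.toLp 2‖) := by
  refine le_of_sq_le_sq ?_ (by positivity)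
  have h1 := graph_estimate hs ψ
  have h2 : 0 ≤ s ^ 2 * ‖(xMul ψ).toLp 2‖ ^ 2 := by positivity
  have h3 : 0 ≤ ‖(-dd ψ + ((s : ℂ) * Complex.I) • xMul ψ).toLp 2‖ * ‖ψ.toLp 2‖ := by positivity
  nlinarith

theorem norm_xMul_le {s : ℝ} (hs : s ^ 2 ≤ 1) (hs0 : s ≠ 0) (ψ : 𝓢(ℝ, ℂ)) :
    ‖(xMul ψ).toLp 2‖ ≤
      2 / |s| * (‖(-dd ψ + ((s : ℂ) * Complex.I) • xMul ψ).toLp 2‖ + ‖ψ.toLp 2‖) := by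
  refine le_of_sq_le_sq ?_ (by positivity)
  have h1 := graph_estimate hs ψ
  have h3 : 0 ≤ ‖(-dd ψ + ((s : ℂ) * Complex.I) • xMul ψ).toLp 2‖ * ‖ψ.toLp 2‖ := by positivity
  have hs2 : 0 < s ^ 2 := by positivity
  rw [mul_pow, div_pow, sq_abs, div_mul_eq_mul_div, le_div_iff₀ hs2]
  nlinarith [sq_nonneg ‖(dd ψ).toLp 2‖,
    sq_nonneg ‖(-dd ψ + ((s : ℂ) * Complex.I) • xMul ψ).toLp 2‖]

/-- The embedding of the Schwartz functions. -/
noncomputable def schwartzL2 : 𝓢(ℝ, ℂ) →ₗ[ℂ] L2 := (SchwartzMap.toLpCLM ℂ ℂ 2 volume).toLinearMap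

theorem tendsto_of_diag {s : ℝ} (hs : s ^ 2 ≤ 1) {φ : ℕ → 𝓢(ℝ, ℂ)} {u g : L2}
    (hu : Tendsto (fun n => schwartzL2 (φ n)) atTop (𝓝 u))
    (hg : Tendsto (fun n => schwartzL2 (-dd (φ n) + ((s : ℂ) * Complex.I) • xMul (φ n))) atTop
      (𝓝 g)) :
    (∃ v : L2, Tendsto (fun n => schwartzL2 (dd (φ n))) atTop (𝓝 v)) ∧
      (s ≠ 0 → ∃ w : L2, Tendsto (fun n => schwartzL2 (xMul (φ n))) atTop (𝓝 w)) := by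
  have hA : ∀ ψ, (schwartzL2 ∘ₗ (-dd.toLinearMap + ((s : ℂ) * Complex.I) • xMul.toLinearMap)) ψ =
    schwartzL2 (-dd ψ + ((s : ℂ) * Complex.I) • xMul ψ) := fun ψ => rfl
  have hg' : Tendsto (fun n => (schwartzL2 ∘ₗ
      (-dd.toLinearMap + ((s : ℂ) * Complex.I) • xMul.toLinearMap)) (φ n)) atTop (𝓝 g) := by
    simpa only [hA] using hg
  refine ⟨exists_tendsto_of_norm_le (B := schwartzL2 ∘ₗ dd.toLinearMap) (K := 2) hg' hu
    zero_le_two fun ψ => ?_, fun hs0 => exists_tendsto_of_norm_le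
      (B := schwartzL2 ∘ₗ xMul.toLinearMap) (K := 2 / |s|) hg' hu (by positivity) fun ψ => ?_⟩
  · rw [hA]
    exact norm_dd_le hs ψ
  · rw [hA]
    exact norm_xMul_le hs hs0 ψ

end BlochTorrey

namespace BlochTorrey

open Set Filter Topology

/-! ### The resolvent -/

/-- By the graph estimate the two parts of the diagonal operator converge separately. For s = 0
nothing is learned about xu, in agreement with a domain that puts no weight on the third component.
-/
theorem exists_diag_limit {s : ℝ} (hs : s ^ 2 ≤ 1) {φ : ℕ → 𝓢(ℝ, ℂ)} {u g : L2}
    (hu : Tendsto (fun n => schwartzL2 (φ n)) atTop (𝓝 u))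
    (hg : Tendsto (fun n => schwartzL2 (-dd (φ n) + ((s : ℂ) * Complex.I) • xMul (φ n))) atTop
      (𝓝 g)) :
    ∃ h : u ∈ H2, (s = 0 → -secondDeriv ⟨u, h⟩ = g) ∧
      (s ≠ 0 → ∃ hx : u ∈ xDomain,
        -secondDeriv ⟨u, h⟩ + ((s : ℂ) * Complex.I) • mulX ⟨u, hx⟩ = g) := by
  obtain ⟨⟨v, hv⟩, hw⟩ := tendsto_of_diag hs hu hg
  obtain ⟨h, hd⟩ := exists_secondDeriv_eq hu hv
  simp only [map_add, map_neg, map_smul] at hg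
  refine ⟨h, fun h0 => ?_, fun h0 => ?_⟩
  · rw [hd]
    subst h0
    refine tendsto_nhds_unique hv.neg ?_
    simpa using hg
  · obtain ⟨w, hw⟩ := hw h0
    obtain ⟨hx, hm⟩ := exists_mulX_eq hu hw
    refine ⟨hx, ?_⟩
    rw [hd, hm]
    exact tendsto_nhds_unique (hv.neg.add (hw.const_smul _)) hg

/-- The real coupling constant. -/
noncomputable def realCoupling (ε : ℝ) : ℝ := 1 / √2 * ε ^ (-(1 / 2) : ℝ)

theorem checkB_zero (ε : ℝ) (v : (checkB ε).domain) : checkB ε v 0 =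
    -D2 0 v + Complex.I • xFst v + (realCoupling ε : ℂ) • (v : L2Vec) 2 := rfl

theorem checkB_one (ε : ℝ) (v : (checkB ε).domain) : checkB ε v 1 =
    -D2 1 v - Complex.I • xSnd v + (realCoupling ε : ℂ) • (v : L2Vec) 2 := rfl

theorem checkB_two (ε : ℝ) (v : (checkB ε).domain) : checkB ε v 2 =
    -((realCoupling ε : ℂ) • (v : L2Vec) 0) - (realCoupling ε : ℂ) • (v : L2Vec) 1 - D2 2 v := rfl

theorem tendsto_component {x : ℕ → L2Vec} {u : L2Vec} (h : Tendsto x atTop (𝓝 u)) (j : Fin 3) :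
    Tendsto (fun n => x n j) atTop (𝓝 (u j)) :=
  ((PiLp.proj 2 (fun _ : Fin 3 => L2) j : L2Vec →L[ℂ] L2).continuous.tendsto u).comp h

/-- The coupling and λ act boundedly, so each diagonal part converges by itself. -/
theorem exists_domain_of_tendsto {ε : ℝ} {lam : ℂ} {φ : ℕ → Fin 3 → 𝓢(ℝ, ℂ)} {u f : L2Vec}
    (hu : Tendsto (fun n => embed (φ n)) atTop (𝓝 u))
    (hf : Tendsto (fun n => embed (opB (realCoupling ε) lam (φ n))) atTop (𝓝 f)) :
    ∃ v : (checkB ε).domain, (v : L2Vec) = u ∧ checkB ε v - lam • (v : L2Vec) = f := by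
  have hu' : ∀ j, Tendsto (fun n => schwartzL2 (φ n j)) atTop (𝓝 (u j)) := tendsto_component hu
  have hf' : ∀ j, Tendsto (fun n => schwartzL2 (opB (realCoupling ε) lam (φ n) j)) atTop
    (𝓝 (f j)) := tendsto_component hf
  set a : ℂ := (realCoupling ε : ℂ) with ha
  obtain ⟨h0, -, h0'⟩ := exists_diag_limit (s := 1) (by norm_num) (hu' 0)
    (g := f 0 - a • u 2 + lam • u 0) <| by
      refine (((hf' 0).sub ((hu' 2).const_smul a)).add ((hu' 0).const_smul lam)).congr fun n => ?_
      rw [opB_zero_apply, ← schwartzL2.map_smul, ← schwartzL2.map_smul, ← map_sub, ← map_add]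
      congr 1
      rw [Complex.ofReal_one, one_mul]
      abel
  obtain ⟨h1, -, h1'⟩ := exists_diag_limit (s := -1) (by norm_num) (hu' 1)
    (g := f 1 - a • u 2 + lam • u 1) <| by
      refine (((hf' 1).sub ((hu' 2).const_smul a)).add ((hu' 1).const_smul lam)).congr fun n => ?_
      rw [opB_one_apply, ← schwartzL2.map_smul, ← schwartzL2.map_smul, ← map_sub, ← map_add]
      congr 1
      rw [Complex.ofReal_neg, Complex.ofReal_one, neg_one_mul, neg_smul]
      abel
  obtain ⟨h2, h2', -⟩ := exists_diag_limit (s := 0) (by norm_num) (hu' 2)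
    (g := f 2 + a • u 0 + a • u 1 + lam • u 2) <| by
      refine ((((hf' 2).add ((hu' 0).const_smul a)).add ((hu' 1).const_smul a)).add
        ((hu' 2).const_smul lam)).congr fun n => ?_
      rw [opB_two_apply, ← schwartzL2.map_smul, ← schwartzL2.map_smul, ← schwartzL2.map_smul, ← map_add, ← map_add, ← map_add]
      congr 1
      rw [Complex.ofReal_zero, zero_mul, zero_smul]
      abel
  obtain ⟨x0, h0'⟩ := h0' one_ne_zero
  obtain ⟨x1, h1'⟩ := h1' (by norm_num)
  have h2' := h2' rfl
  refine ⟨⟨u, fun j => by fin_cases j <;> assumption, x0, x1⟩, rfl, ?_⟩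
  ext1 j
  rw [PiLp.sub_apply, PiLp.smul_apply]
  fin_cases j
  · change (-secondDeriv ⟨u 0, h0⟩ + Complex.I • mulX ⟨u 0, x0⟩ + a • u 2) - lam • u 0 = f 0
    rw [Complex.ofReal_one, one_mul] at h0'
    rw [h0']
    abel
  · change (-secondDeriv ⟨u 1, h1⟩ - Complex.I • mulX ⟨u 1, x1⟩ + a • u 2) - lam • u 1 = f 1
    rw [Complex.ofReal_neg, Complex.ofReal_one, neg_one_mul, neg_smul, ← sub_eq_add_neg] at h1'
    rw [h1']
    abel
  · change (-(a • u 0) - a • u 1 - secondDeriv ⟨u 2, h2⟩) - lam • u 2 = f 2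
    rw [sub_eq_add_neg _ (secondDeriv _), h2']
    abel

theorem toDistr_dd (v : H2) (ψ : 𝓢(ℝ, ℂ)) :
    toDistr (v : L2) (dd ψ) = toDistr (secondDeriv v) ψ := by
  rw [toDistr_secondDeriv, TemperedDistribution.laplacian_apply_apply, laplacian_eq_dd]

theorem toDistr_xMul (v : xDomain) (ψ : 𝓢(ℝ, ℂ)) :
    toDistr (v : L2) (xMul ψ) = toDistr (mulX v) ψ := by
  rw [toDistr_apply, toDistr_apply]
  refine integral_congr_ae ?_
  filter_upwards [(memLp_mul_x v).coeFn_toLp] with x hx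
  change _ = ψ x * ((memLp_mul_x v).toLp : L2) x
  rw [hx, xMul_apply]
  ring

/-- Conjugation by diag(1, 1, -1) turns the operator into its transpose. Hence (u₀, u₁, -u₂)
annihilates the range bilinearly when u is a null vector, and density of the range gives
injectivity. -/
theorem eq_zero_of_checkB_eq {ε : ℝ} {lam : ℂ}
    (hd : ∀ y : L2Vec, (∀ φ, inner ℂ y (embed (opB (realCoupling ε) lam φ)) = 0) → y = 0)
    (v : (checkB ε).domain) (hv : checkB ε v - lam • (v : L2Vec) = 0) : v = 0 := by
  set u : L2Vec := v.1 with hu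
  have e : ∀ (j : Fin 3) (ψ : 𝓢(ℝ, ℂ)), toDistr ((checkB ε v - lam • u) j) ψ = 0 := fun j ψ => by
    rw [hv, PiLp.zero_apply, map_zero]
    rfl
  have hy := hd (conjVec (WithLp.toLp 2 ![u 0, u 1, -u 2])) fun φ => by
    rw [inner_conjVec_embed]
    have e0 := e 0 (φ 0)
    have e1 := e 1 (φ 1)
    have e2 := e 2 (φ 2)
    have d0 : toDistr (u 0) (dd (φ 0)) = toDistr (D2 0 v) (φ 0) := toDistr_dd ⟨u 0, v.2.1 0⟩ _
    have d1 : toDistr (u 1) (dd (φ 1)) = toDistr (D2 1 v) (φ 1) := toDistr_dd ⟨u 1, v.2.1 1⟩ _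
    have d2 : toDistr (u 2) (dd (φ 2)) = toDistr (D2 2 v) (φ 2) := toDistr_dd ⟨u 2, v.2.1 2⟩ _
    have x0 : toDistr (u 0) (xMul (φ 0)) = toDistr (xFst v) (φ 0) := toDistr_xMul ⟨u 0, v.2.2.1⟩ _
    have x1 : toDistr (u 1) (xMul (φ 1)) = toDistr (xSnd v) (φ 1) := toDistr_xMul ⟨u 1, v.2.2.2⟩ _
    rw [PiLp.sub_apply, PiLp.smul_apply, checkB_zero] at e0
    rw [PiLp.sub_apply, PiLp.smul_apply, checkB_one] at e1
    rw [PiLp.sub_apply, PiLp.smul_apply, checkB_two] at e2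
    simp only [map_add, map_sub, map_neg, map_smul, ← hu] at e0 e1 e2
    simp only [Fin.sum_univ_three, opB_zero_apply, opB_one_apply, opB_two_apply, map_add, map_sub,
      map_neg, map_smul]
    simp at e0 e1 e2 ⊢
    linear_combination e0 + e1 - e2 - d0 - d1 + d2 + Complex.I * x0 - Complex.I * x1
  have hy' := congrArg conjVec hy
  rw [conjVec_conjVec] at hy'
  have hz : ∀ j, conjVec 0 j = 0 := fun j => by
    rw [conjVec_apply, PiLp.zero_apply, star_zero_L2]
  ext1
  change u = 0
  ext1 j
  have hj := fun j => (congrArg (fun w : L2Vec => w j) hy').trans (hz j)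
  fin_cases j
  · exact hj 0
  · exact hj 1
  · exact neg_eq_zero.1 (hj 2)

/-- Density, the a priori bound and passage to limits in the domain solve the equation for every f;
injectivity makes the solution unique, hence linear in f. The approximating Schwartz sequences are
kept because they transfer further estimates to the whole domain. -/
theorem exists_isResolventAt {ε : ℝ} {lam : ℂ} {C : ℝ} (hC : 0 ≤ C)
    (h : ∀ μ : ℝ, μ ≤ max lam.re (-1) → ∀ φ,
      ‖embed φ‖ ≤ C * ‖embed (opB (realCoupling ε) (μ + lam.im * Complex.I) φ)‖) :
    ∃ R : L2Vec →L[ℂ] L2Vec, IsResolventAt (checkB ε) lam R ∧ ‖R‖ ≤ C ∧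
      ∀ u : (checkB ε).domain, ∃ φ : ℕ → Fin 3 → 𝓢(ℝ, ℂ),
        Tendsto (fun n => embed (φ n)) atTop (𝓝 (u : L2Vec)) ∧
        Tendsto (fun n => embed (opB (realCoupling ε) lam (φ n))) atTop
          (𝓝 (checkB ε u - lam • (u : L2Vec))) := by
  have hd := orthogonal_of_apriori hC h
  have hap : ∀ φ, ‖embed φ‖ ≤ C * ‖embed (opB (realCoupling ε) lam φ)‖ := fun φ => by
    have := h lam.re (le_max_left _ _) φ
    rwa [Complex.re_add_im] at this
  have inj : ∀ u v : (checkB ε).domain, checkB ε u - lam • (u : L2Vec) =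
      checkB ε v - lam • (v : L2Vec) → u = v := fun u v huv => by
    rw [← sub_eq_zero]
    refine eq_zero_of_checkB_eq hd _ ?_
    rw [LinearPMap.map_sub, Submodule.coe_sub, smul_sub, sub_sub_sub_comm, huv, sub_self]
  have solve : ∀ f : L2Vec, ∃ u : (checkB ε).domain, checkB ε u - lam • (u : L2Vec) = f ∧
      ‖(u : L2Vec)‖ ≤ C * ‖f‖ ∧ ∃ φ : ℕ → Fin 3 → 𝓢(ℝ, ℂ),
        Tendsto (fun n => embed (φ n)) atTop (𝓝 (u : L2Vec)) ∧
        Tendsto (fun n => embed (opB (realCoupling ε) lam (φ n))) atTop (𝓝 f) := fun f => by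
    obtain ⟨x, hx, hxf⟩ := mem_closure_iff_seq_limit.1
      (dense_range_of_orthogonal (A := embed ∘ₗ opB (realCoupling ε) lam) hd f)
    choose φ hφ using hx
    have hf : Tendsto (fun n => (embed ∘ₗ opB (realCoupling ε) lam) (φ n)) atTop (𝓝 f) := by
      simpa only [hφ] using hxf
    obtain ⟨u, hu⟩ := exists_tendsto_of_norm_le (B := embed) hf hf hC fun ψ =>
      (hap ψ).trans (mul_le_mul_of_nonneg_left (le_add_of_nonneg_right (norm_nonneg _)) hC)
    obtain ⟨v, rfl, hvf⟩ := exists_domain_of_tendsto hu hf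
    exact ⟨v, hvf, le_of_tendsto_of_tendsto' hu.norm (hf.norm.const_mul C) fun n => hap (φ n),
      φ, hu, hf⟩
  choose S hS using solve
  let R₀ : L2Vec →ₗ[ℂ] L2Vec :=
    { toFun := fun f => S f
      map_add' := fun f g => by
        rw [← Submodule.coe_add]
        congr 1
        refine inj _ _ ?_
        rw [(hS _).1, LinearPMap.map_add, Submodule.coe_add, smul_add, add_sub_add_comm, (hS f).1,
          (hS g).1]
      map_smul' := fun c f => by
        rw [RingHom.id_apply, ← Submodule.coe_smul]
        congr 1
        refine inj _ _ ?_
        rw [(hS _).1, LinearPMap.map_smul, Submodule.coe_smul, smul_comm lam c, ← smul_sub,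
          (hS f).1] }
  refine ⟨R₀.mkContinuous C fun f => (hS f).2.1, ⟨fun u => ?_, fun f => ⟨S f, rfl, (hS f).1⟩⟩,
    LinearMap.mkContinuous_norm_le _ hC _, fun u => ?_⟩
  · exact congrArg Subtype.val (inj _ _ (hS (checkB ε u - lam • (u : L2Vec))).1)
  · have hu := inj _ _ (hS (checkB ε u - lam • (u : L2Vec))).1
    obtain ⟨φ, h1, h2⟩ := (hS (checkB ε u - lam • (u : L2Vec))).2.2
    rw [hu] at h1
    exact ⟨φ, h1, h2⟩

end BlochTorrey

namespace BlochTorrey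

open Set Filter Topology

/-! ### The estimates -/

/-- The second bound follows from the first: `BTSystem.integral_sq_le` recovers u from u₀ + u₁ at
the price of a term ‖f‖/|Im λ|. -/
theorem exists_schwartz_estimate {δ : ℝ} (hδ : 0 < δ) (hδ1 : δ ≤ 1 / 2) :
    ∃ ε₀ : ℝ, 0 < ε₀ ∧ ∃ C : ℝ, 0 < C ∧ ∀ ε : ℝ, 0 < ε → ε < ε₀ → ∀ lam : ℂ, 0 < |lam.im| →
      |lam.im| ≤ (1 - 2 * δ ^ 4) ^ (1 / 2 : ℝ) * ε ^ (-(1 / 2) : ℝ) →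
      ∀ φ, ‖embed φ 0 + embed φ 1‖ ≤
          C * ε ^ (1 / 2 : ℝ) * growth ε lam * ‖embed (opB (realCoupling ε) lam φ)‖ ∧
        ‖embed φ‖ ≤
          C * (1 + 1 / |lam.im|) * growth ε lam * ‖embed (opB (realCoupling ε) lam φ)‖ := by
  have hδ4 : 2 * δ ^ 4 ≤ 1 := by
    calc 2 * δ ^ 4 ≤ 2 * (1 / 2) ^ 4 := by gcongr
      _ ≤ 1 := by norm_num
  -- The margin η = 2δ⁴ matches the factor (1 - 2δ⁴)^(1/2) after squaring, and r = √ε turns the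
  -- bound r₀ into r₀² for ε.
  obtain ⟨r₀, C, hr₀, hr₀1, hC, H⟩ := exists_sum_estimate (η := 2 * δ ^ 4) (by positivity) hδ4
  refine ⟨r₀ ^ 2, by positivity, 2 * C + 1, by positivity, fun ε hε hε₀ lam hn hν φ => ?_⟩
  set r := ε ^ (1 / 2 : ℝ) with hr
  have hr0 : 0 < r := Real.rpow_pos_of_pos hε _
  have hrr : r ^ 2 = ε := by
    rw [hr, ← Real.sqrt_eq_rpow, Real.sq_sqrt hε.le]
  have hrlt : r < r₀ := lt_of_pow_lt_pow_left₀ 2 hr₀.le (by rwa [hrr])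
  have hri : ε ^ (-(1 / 2) : ℝ) = 1 / r :=
    (Real.rpow_neg hε.le _).trans (one_div _).symm
  have ha : 0 < realCoupling ε := by
    unfold realCoupling
    positivity
  have ha2 : 2 * realCoupling ε ^ 2 = (1 / r) ^ 2 := by
    rw [realCoupling, hri, mul_pow, div_pow, Real.sq_sqrt zero_le_two]
    ring
  have hL0 : (0 : ℝ) ≤ max lam.re 0 := le_max_right _ _
  have hL2 : (max lam.re 0 ^ (1 / 2 : ℝ)) ^ 2 = max lam.re 0 := by
    rw [← Real.sqrt_eq_rpow, Real.sq_sqrt hL0]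
  have hν2 : lam.im ^ 2 ≤ (1 - 2 * δ ^ 4) * (1 / r) ^ 2 := by
    rw [← sq_abs]
    calc |lam.im| ^ 2 ≤ ((1 - 2 * δ ^ 4) ^ (1 / 2 : ℝ) * ε ^ (-(1 / 2) : ℝ)) ^ 2 := by gcongr
      _ = _ := by rw [hri, mul_pow, ← Real.sqrt_eq_rpow, Real.sq_sqrt (by linarith)]
  have hs := btSystem_schwartz (realCoupling ε) lam φ
  have h1 := H r (realCoupling ε) _ lam _ _ _ hs hr0 hrlt ha ha2 (Real.rpow_nonneg hL0 _) hL2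
    (abs_pos.1 hn) hν2
  have h2 := hs.integral_sq_le (abs_pos.1 hn)
  have hG : growth ε lam = 1 + (1 + r * max lam.re 0 ^ (1 / 2 : ℝ)) / |lam.im| := rfl
  rw [← hG, ← norm_embed_sq, ← norm_embed_sum_sq] at h1
  rw [← norm_embed_sq, ← norm_embed_sq, ← norm_embed_sum_sq] at h2
  set G := growth ε lam
  have hG1 : 1 ≤ G := by
    rw [hG]
    exact le_add_of_nonneg_right (by positivity)
  set N := ‖embed (opB (realCoupling ε) lam φ)‖ with hN
  have hN0 : 0 ≤ N := norm_nonneg _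
  have hr1 : r ≤ 1 := hrlt.le.trans hr₀1
  constructor
  · refine le_of_sq_le_sq (h1.trans ?_) (by positivity)
    rw [← mul_pow]
    gcongr
    linarith
  · refine le_of_sq_le_sq (h2.trans ?_) (by positivity)
    rw [← sq_abs lam.im]
    set n := |lam.im|
    have e1 : (C * r * G) ^ 2 ≤ (C * (1 + 1 / n) * G) ^ 2 := by
      have : r ≤ 1 + 1 / n := hr1.trans (le_add_of_nonneg_right (by positivity))
      gcongr
    have e2 : 1 / n ^ 2 ≤ ((1 + 1 / n) * G) ^ 2 := by
      rw [← one_div_pow]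
      gcongr
      calc 1 / n ≤ (1 + 1 / n) * 1 := by linarith
        _ ≤ (1 + 1 / n) * G := by gcongr
    calc 2 * ‖embed φ 0 + embed φ 1‖ ^ 2 + 1 / n ^ 2 * N ^ 2
        ≤ 2 * ((C * (1 + 1 / n) * G) ^ 2 * N ^ 2) + ((1 + 1 / n) * G) ^ 2 * N ^ 2 := by
          refine add_le_add ?_ (by gcongr)
          exact mul_le_mul_of_nonneg_left (h1.trans (by gcongr)) zero_le_two
      _ = (2 * C ^ 2 + 1) * (((1 + 1 / n) * G) ^ 2 * N ^ 2) := by ring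
      _ ≤ (2 * C + 1) ^ 2 * (((1 + 1 / n) * G) ^ 2 * N ^ 2) := by
          gcongr
          nlinarith
      _ = _ := by ring

/-- Monotonicity in the real part lets the constant at λ serve along the whole path from the left
used by the method of continuity. -/
theorem growth_le {ε : ℝ} (hε : 0 < ε) {lam : ℂ} {μ : ℝ} (hμ : μ ≤ max lam.re (-1)) :
    growth ε (μ + lam.im * Complex.I) ≤ growth ε lam := by
  have hre : ((μ : ℂ) + lam.im * Complex.I).re = μ := by simp
  have him : ((μ : ℂ) + lam.im * Complex.I).im = lam.im := by simp
  have h : max μ 0 ≤ max lam.re 0 := by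
    refine max_le (hμ.trans (max_le_max le_rfl (by norm_num))) (le_max_right _ _)
  unfold growth
  rw [hre, him]
  gcongr

theorem exists_resolvent_estimate {δ : ℝ} (hδ : 0 < δ) (hδ1 : δ ≤ 1 / 2) :
    ∃ ε₀ : ℝ, 0 < ε₀ ∧ ∃ C : ℝ, 0 < C ∧ ∀ ε : ℝ, 0 < ε → ε < ε₀ → ∀ lam : ℂ, 0 < |lam.im| →
      |lam.im| ≤ (1 - 2 * δ ^ 4) ^ (1 / 2 : ℝ) * ε ^ (-(1 / 2) : ℝ) →
      (∀ (u : (checkB ε).domain) (f : L2Vec), checkB ε u - lam • (u : L2Vec) = f →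
        ‖(u : L2Vec) 0 + (u : L2Vec) 1‖ ≤ C * ε ^ (1 / 2 : ℝ) * growth ε lam * ‖f‖) ∧
      ∃ R : L2Vec →L[ℂ] L2Vec, IsResolventAt (checkB ε) lam R ∧
        ‖R‖ ≤ C * (1 + 1 / |lam.im|) * growth ε lam := by
  obtain ⟨ε₀, hε₀, C, hC, H⟩ := exists_schwartz_estimate hδ hδ1
  refine ⟨ε₀, hε₀, C, hC, fun ε hε hlt lam hn hν => ?_⟩
  have hG : 0 ≤ growth ε lam := by
    unfold growth
    positivity
  obtain ⟨R, hR, hRC, hcore⟩ := exists_isResolventAt (ε := ε) (lam := lam)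
    (C := C * (1 + 1 / |lam.im|) * growth ε lam) (by positivity) fun μ hμ φ => by
      have him : ((μ : ℂ) + lam.im * Complex.I).im = lam.im := by simp
      refine (H ε hε hlt (μ + lam.im * Complex.I) (by rwa [him]) (by rwa [him]) φ).2.trans ?_
      rw [him]
      gcongr
      exact growth_le hε hμ
  refine ⟨fun u f huf => ?_, R, hR, hRC⟩
  obtain ⟨φ, h1, h2⟩ := hcore u
  rw [huf] at h2
  exact le_of_tendsto_of_tendsto' ((tendsto_component h1 0).add (tendsto_component h1 1)).norm
    (h2.norm.const_mul _) fun n => (H ε hε hlt lam hn hν (φ n)).1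

theorem mem_resolventSet_of_neg {ε : ℝ} {lam : ℂ} (hre : lam.re < 0) :
    lam ∈ resolventSet (checkB ε) := by
  obtain ⟨R, hR, -⟩ := exists_isResolventAt (ε := ε) (lam := lam) (C := 1 / (-max lam.re (-1)))
    (by
      have : max lam.re (-1) < 0 := max_lt hre (by norm_num)
      exact one_div_nonneg.2 (by linarith)) fun μ hμ φ => by
      have h0 : max lam.re (-1) < 0 := max_lt hre (by norm_num)
      have hμ0 : ((μ : ℂ) + lam.im * Complex.I).re = μ := by simp
      refine (norm_embed_le_of_re_neg (a := realCoupling ε) (by rw [hμ0]; linarith) φ).trans ?_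
      rw [hμ0]
      have : 0 < -max lam.re (-1) := by linarith
      gcongr
  exact ⟨R, hR⟩

theorem exists_spectrum_inter_strip_eq_empty {δ : ℝ} (hδ : 0 < δ) :
    ∃ ε₀ : ℝ, 0 < ε₀ ∧ ∀ ε : ℝ, 0 < ε → ε < ε₀ → spectrum (checkB ε) ∩ strip ε δ = ∅ := by
  -- A smaller δ gives a wider strip, so nothing is lost by capping at 1/2.
  set d := min δ (1 / 2) with hd
  have hd0 : 0 < d := lt_min hδ (by norm_num)
  have hd1 : d ≤ 1 / 2 := min_le_right _ _
  obtain ⟨ε₀, hε₀, C, hC, H⟩ := exists_resolvent_estimate hd0 hd1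
  refine ⟨ε₀, hε₀, fun ε hε hlt => ?_⟩
  rw [eq_empty_iff_forall_notMem]
  rintro lam ⟨hspec, hlam, him⟩
  refine hspec ?_
  rcases eq_or_ne lam.im 0 with h0 | h0
  · exact mem_resolventSet_of_neg (lt_of_not_ge fun h => hlam ⟨h0, h⟩)
  -- For d ≤ 1/2 one has (1 - d)² ≤ 1 - 2d⁴, so the nonreal part of the strip lies where the
  -- resolvent estimate applies.
  · have hle : 1 - δ ≤ (1 - 2 * d ^ 4) ^ (1 / 2 : ℝ) := by
      rw [← Real.sqrt_eq_rpow]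
      refine (sub_le_sub_left (min_le_left δ (1 / 2)) 1).trans (Real.le_sqrt_of_sq_le ?_)
      change (1 - d) ^ 2 ≤ _
      have h3 : d ^ 3 ≤ (1 / 2) ^ 3 := by gcongr
      nlinarith [mul_le_mul_of_nonneg_left h3 hd0.le]
    obtain ⟨-, R, hR, -⟩ := H ε hε hlt lam (abs_pos.2 h0)
      (him.le.trans (mul_le_mul_of_nonneg_right hle (Real.rpow_nonneg hε.le _)))
    exact ⟨R, hR⟩

end BlochTorrey

theorem mainTheorem11 :
    (∀ δ : ℝ, 0 < δ → δ ≤ 1 / 2 →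
      ∃ ε₀ : ℝ, 0 < ε₀ ∧ ∃ C : ℝ, 0 < C ∧
        ∀ ε : ℝ, 0 < ε → ε < ε₀ →
          ∀ lam : ℂ, 0 < |lam.im| →
            |lam.im| ≤ (1 - 2 * δ ^ 4) ^ (1 / 2 : ℝ) * ε ^ (-(1 / 2) : ℝ) →
            (∀ (u : (BlochTorrey.checkB ε).domain) (f : BlochTorrey.L2Vec),
              BlochTorrey.checkB ε u - lam • (u : BlochTorrey.L2Vec) = f →
              ‖(u : BlochTorrey.L2Vec) 0 + (u : BlochTorrey.L2Vec) 1‖ ≤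
                C * ε ^ (1 / 2 : ℝ) * BlochTorrey.growth ε lam * ‖f‖) ∧
            ∃ R : BlochTorrey.L2Vec →L[ℂ] BlochTorrey.L2Vec,
              BlochTorrey.IsResolventAt (BlochTorrey.checkB ε) lam R ∧
              ‖R‖ ≤ C * (1 + 1 / |lam.im|) * BlochTorrey.growth ε lam) ∧
    (∀ δ : ℝ, 0 < δ →
      ∃ ε₀ : ℝ, 0 < ε₀ ∧ ∀ ε : ℝ, 0 < ε → ε < ε₀ →
        BlochTorrey.spectrum (BlochTorrey.checkB ε) ∩ BlochTorrey.strip ε δ = ∅) :=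
  ⟨fun _ hδ hδ1 => BlochTorrey.exists_resolvent_estimate hδ hδ1,
    fun _ hδ => BlochTorrey.exists_spectrum_inter_strip_eq_empty hδ⟩
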